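/- Setting. Consider a finite two-player zero-sum game with imperfect information and length $H$: a finite set of states partitioned into the information sets $x\in\mathcal X$ of the max-player and into the information sets $y\in\mathcal Y$ of the min-player, finite action sets $\mathcal A(x)$ and $\mathcal B(y)$, an initial state distribution, transition kernels $p_h(\cdot\mid s,a,b)$ and rewards $r_h(s,a,b)\in[0,1]$ (received by the max-player and paid by the min-player). At each step $h=1,\dots,H$ both players observe their information sets $x_h,y_h$ and choose actions $a_h,b_h$. Both players have perfect recall: each information set $x$ has a unique history $(x_1,a_1,\dots,x_h=x)$, so that $\mathcal X$ is the disjoint union of the sets $\mathcal X_h$ of information sets at step $h$ and carries a tree structure ($x'\ge x$ means that $x$ lies on the history of $x'$, including $x'=x$), in which for $h<H$ every pair $(x_h,a_h)$ is followed by at least one information set; likewise for $\mathcal Y$. Let $A_{\mathcal X}=\sum_x|\mathcal A(x)|$ and $B_{\mathcal Y}=\sum_y|\mathcal B(y)|$. A policy $\mu$ gives a distribution $\mu_h(\cdot\mid x_h)$ on $\mathcal A(x_h)$ for every $x_h$; its realization plan is $\mu_{1:h}(x_h,a_h)=\prod_{h'\le h}\mu_{h'}(a_{h'}\mid x_{h'})$,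 and $V^{\mu,\nu}$ is the expected total reward. In each of $T$ episodes $t=1,\dots,T$ the players choose policies $\mu^t,\nu^t$ on the basis of the past, and a trajectory is then drawn under $(\mu^t,\nu^t)$. Put $\mathrm{Regret}_{\max}^T=\max_{\mu^\dagger}\sum_{t=1}^T\big(V^{\mu^\dagger,\nu^t}-V^{\mu^t,\nu^t}\big)$. Algorithm. Let $A_\tau(x)=\sum_{x'\ge x}|\mathcal A(x')|$ and let $p^\star_{1:h}(x_h)$ be the product, along the path from the root to $x_h$, of the balanced transitions $p_0^\star(x_1)=A_\tau(x_1)/A_{\mathcal X}$ and $p^\star_h(x_{h+1}\mid x_h,a_h)=A_\tau(x_{h+1})/\sum_{x'}A_\tau(x')$, where $x'$ runs over the information sets that follow $(x_h,a_h)$. Balanced-FTRL-Shannon with parameters $(\gamma_h)$ and $(\eta_h)$ plays in episode $t$ a policy $\mu^t$ that minimizes $$\sum_{h=1}^H\sum_{(x_h,a_h)}\mu_{1:h}(x_h,a_h)\sum_{k<t}\tilde\ell^k_h(x_h,a_h)+\sum_{h=1}^H\frac1{\eta_h}\sum_{(x_h,a_h)}w_h\log w_h,\qquad w_h=p^\star_{1:h}(x_h)\,\mu_{1:h}(x_h,a_h),$$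 over all policies $\mu$, where $$\tilde\ell^k_h(x_h,a_h)=\frac{\mathbf 1\{x^k_h=x_h,\ a^k_h=a_h\}\,(1-r^k_h)}{\mu^k_{1:h}(x_h,a_h)+\gamma_h/p^\star_{1:h}(x_h)}$$ is computed from the information set $x^k_h$, the action $a^k_h$ and the reward $r^k_h$ at step $h$ of episode $k$. The min-player's version is the same on $\mathcal Y$, with $r^k_h$ in place of $1-r^k_h$. Theorem. (i) Suppose that every information set of the max-player has exactly $A$ actions. Let $\delta\in(0,1)$ and $\iota=\log(3A_{\mathcal X}/\delta)$. If the max-player uses Balanced-FTRL-Shannon with $$\gamma_h=\sqrt{A^{H-h}\,\iota/(2A_{\mathcal X}T)},\qquad \eta_h=\sqrt{2A^{H-h}\log(A_{\mathcal X})/(A_{\mathcal X}T)},$$ then, against any adaptive opponent, with probability at least $1-\delta$, $$\mathrm{Regret}_{\max}^T\le\big(5\sqrt{\log A_{\mathcal X}}+8\iota\big)\sqrt{A_{\mathcal X}T}.$$ (ii) There is a universal constant $C>0$ such that the following holds for all games in which every information set of the max-player has exactly $A$ actions and every information set of the min-player exactly $B$ actions, all $\varepsilon>0$ and all $\delta\in(0,1)$.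 If both players use Balanced-FTRL-Shannon with the parameters of (i) (for the min-player with $B$ and $B_{\mathcal Y}$ in place of $A$ and $A_{\mathcal X}$) and $$T\ge C\,(A_{\mathcal X}+B_{\mathcal Y})\log(1/\delta+A_{\mathcal X}+B_{\mathcal Y})/\varepsilon^2,$$ then, with probability at least $1-\delta$, there are policies $\bar\mu,\bar\nu$ whose realization plans are the averages over the $T$ episodes of those of $\mu^t$ and of $\nu^t$ respectively, and every such profile is $\varepsilon$-optimal: $\max_{\mu^\dagger}V^{\mu^\dagger,\bar\nu}-\min_{\nu^\dagger}V^{\bar\mu,\nu^\dagger}\le\varepsilon$. -/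

import Mathlib

open MeasureTheory ProbabilityTheory

universe u v

noncomputable section

/-- A (behavioural) policy over information sets `x : X` with action sets `A x`:
a probability distribution over `A x` for each `x`. -/
abbrev Policy {X : Type u} (A : X → Type u) [∀ x, Fintype (A x)] : Type u :=
  {μ : (x : X) → A x → ℝ // ∀ x, μ x ∈ stdSimplex ℝ (A x)}

/-- Total number of actions of a player, summed over all information sets. -/
def totalActions {X : Type u} [Fintype X] (A : X → Type u) [∀ x, Fintype (A x)] : ℕ :=
  ∑ x, Fintype.card (A x)

/-- The tree structure of the information sets of a player with perfect recall, for a game with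
`H` steps. Each information set `x` has exactly one history `(x₁, a₁, …, x_{h-1}, a_{h-1})`
leading to it; `hist x` is this list, *most recent pair first*. The step `h ∈ {1, …, H}` at which
`x` occurs is `(hist x).length + 1`. Before step `H`, every action at an information set is
followed by at least one information set, as the game goes on until step `H`. -/
structure InfoTree (X : Type u) (A : X → Type u) (H : ℕ) where
  hist : X → List (Σ x, A x)
  hist_tail : ∀ (x y : X) (a : A y) (l : List (Σ x, A x)), hist x = ⟨y, a⟩ :: l → hist y = l
  length_hist_lt : ∀ x, (hist x).length < H
  exists_next : ∀ (x : X) (a : A x), (hist x).length + 1 < H → ∃ x', hist x' = ⟨x, a⟩ :: hist x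

namespace InfoTree

variable {X : Type u} {A : X → Type u} {H : ℕ}

/-- The step at which `x` occurs, counted from `0`. -/
def level (𝒯 : InfoTree X A H) (x : X) : Fin H :=
  ⟨(𝒯.hist x).length, 𝒯.length_hist_lt x⟩

/-- Realization plan: `μ_{1:h}(x_h, a_h) = ∏_{h' ≤ h} μ_{h'}(a_{h'} | x_{h'})`, the product being
along the history of `x_h`. -/
def plan [∀ x, Fintype (A x)] (𝒯 : InfoTree X A H) (μ : Policy A) (x : X) (a : A x) : ℝ :=
  ((𝒯.hist x).map fun q => μ.1 q.1 q.2).prod * μ.1 x a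

variable [Fintype X] [∀ x, Fintype (A x)]

open Classical in
/-- Number of actions in the subtree of `x`: the sum of `|A x'|` over `x' ≥ x`, that is,
over `x' = x` and all `x'` that have `x` in their history. -/
def subtreeActions (𝒯 : InfoTree X A H) (x : X) : ℕ :=
  ∑ x' with x' = x ∨ ∃ a : A x, (⟨x, a⟩ : Σ x, A x) ∈ 𝒯.hist x', Fintype.card (A x')

open Classical in
/-- Balanced transition into `x` from its predecessor (from the start of the game if `x` is a
root): proportional to the number of actions in the subtree. The information sets that share
the history of `x` are those that may follow the same pair (information set, action). -/
def balancedStep (𝒯 : InfoTree X A H) (x : X) : ℝ :=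
  if 𝒯.hist x = [] then (𝒯.subtreeActions x : ℝ) / totalActions A
  else (𝒯.subtreeActions x : ℝ) / ∑ x' with 𝒯.hist x' = 𝒯.hist x, (𝒯.subtreeActions x' : ℝ)

/-- `p⋆_{1:h}(x_h)`: product of the balanced transitions along the path from the root to `x_h`. -/
def balanced (𝒯 : InfoTree X A H) (x : X) : ℝ :=
  𝒯.balancedStep x * ((𝒯.hist x).map fun q => 𝒯.balancedStep q.1).prod

open Classical in
/-- Shannon regularizer at step `h` of the distribution `p⋆_{1:h} · μ_{1:h}` over the pairs
(information set, action) of that step. -/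
def shannon (𝒯 : InfoTree X A H) (h : Fin H) (μ : Policy A) : ℝ :=
  ∑ x with 𝒯.level x = h, ∑ a,
    (𝒯.balanced x * 𝒯.plan μ x a) * Real.log (𝒯.balanced x * 𝒯.plan μ x a)

/-- The function minimized by Balanced-FTRL-Shannon, for a cumulative loss estimate `L`. -/
def ftrlObjective (𝒯 : InfoTree X A H) (η : Fin H → ℝ) (L : (x : X) → A x → ℝ)
    (μ : Policy A) : ℝ :=
  (∑ x, ∑ a, 𝒯.plan μ x a * L x a) + ∑ h, 𝒯.shannon h μ / η h

open Classical in
/-- Implicit-exploration loss estimate after an episode played with `μ`. What the player observes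
is `o`: at each step `h`, the pair `(x_h, a_h)` and the incurred loss. The IX parameter is
`γ⋆_h(x) = γ_h / p⋆_{1:h}(x)`. -/
def ixLoss (𝒯 : InfoTree X A H) (γ : Fin H → ℝ) (μ : Policy A)
    (o : Fin H → (Σ x, A x) × ℝ) (x : X) (a : A x) : ℝ :=
  if (o (𝒯.level x)).1 = ⟨x, a⟩ then
    (o (𝒯.level x)).2 / (𝒯.plan μ x a + γ (𝒯.level x) / 𝒯.balanced x)
  else 0

/-- The policies `μ 0, …, μ (T-1)` are those of Balanced-FTRL-Shannon with IX parameters `γ` and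
learning rates `η`, when the observations in the successive episodes are `o 0, …, o (T-1)`. -/
def IsBalancedFTRL (𝒯 : InfoTree X A H) (γ η : Fin H → ℝ) (T : ℕ)
    (μ : ℕ → Policy A) (o : ℕ → Fin H → (Σ x, A x) × ℝ) : Prop :=
  ∀ t < T, ∀ μ' : Policy A,
    𝒯.ftrlObjective η (fun x a => ∑ k ∈ Finset.range t, 𝒯.ixLoss γ (μ k) (o k) x a) (μ t) ≤
    𝒯.ftrlObjective η (fun x a => ∑ k ∈ Finset.range t, 𝒯.ixLoss γ (μ k) (o k) x a) μ'

/-- `μbar` is an average policy: its realization plan is the mean of those of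
`μ 0, …, μ (T-1)`. -/
def IsAverage (𝒯 : InfoTree X A H) (T : ℕ) (μ : ℕ → Policy A) (μbar : Policy A) : Prop :=
  ∀ x a, 𝒯.plan μbar x a = (1 / (T : ℝ)) * ∑ t ∈ Finset.range T, 𝒯.plan (μ t) x a

end InfoTree

/-- An episodic, finite, two-player, zero-sum game with imperfect information: states `S`,
information sets `X` (max-player) and `Y` (min-player), both partitions of `S`, action sets
`A x` and `B y`, and length `H`. Steps are counted from `0` here: `trans h` leads from
step `h` to step `h + 1` and plays no role for `h + 1 ≥ H`, nor does `reward h` for `h ≥ H`. -/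
structure GameForm (S X Y : Type u) [Fintype S] (A : X → Type u) (B : Y → Type u) where
  infoX : S → X
  infoY : S → Y
  infoX_surjective : Function.Surjective infoX
  infoY_surjective : Function.Surjective infoY
  init : S → ℝ
  init_mem : init ∈ stdSimplex ℝ S
  trans : ℕ → (s : S) → A (infoX s) → B (infoY s) → S → ℝ
  trans_mem : ∀ h s a b, trans h s a b ∈ stdSimplex ℝ S
  reward : ℕ → (s : S) → A (infoX s) → B (infoY s) → ℝ
  reward_mem : ∀ h s a b, reward h s a b ∈ Set.Icc (0 : ℝ) 1

/-- `G.Reach H lX lY s`: in an episode of length `H`, the state `s` can be reached (with positive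
probability, for some policies) at step `lX.length`, counted from `0`, after the players have
gone through the histories `lX` and `lY` (most recent pair first). -/
inductive GameForm.Reach {S X Y : Type u} [Fintype S] {A : X → Type u} {B : Y → Type u}
    (G : GameForm S X Y A B) (H : ℕ) : List (Σ x, A x) → List (Σ y, B y) → S → Prop
  | start (s : S) : 0 < G.init s → GameForm.Reach G H [] [] s
  | step (lX : List (Σ x, A x)) (lY : List (Σ y, B y)) (s : S)
      (a : A (G.infoX s)) (b : B (G.infoY s)) (s' : S) :
      GameForm.Reach G H lX lY s → lX.length + 1 < H → 0 < G.trans lX.length s a b s' →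
      GameForm.Reach G H (⟨G.infoX s, a⟩ :: lX) (⟨G.infoY s, b⟩ :: lY) s'

/-- A game of length `H` in which both players have perfect recall: whenever an information set
is reached, the past information sets and actions of the player are those of its unique
history. -/
structure Game (S X Y : Type u) [Fintype S] (A : X → Type u) (B : Y → Type u) (H : ℕ)
    extends GameForm S X Y A B where
  treeX : InfoTree X A H
  treeY : InfoTree Y B H
  recallX : ∀ lX lY s, toGameForm.Reach H lX lY s → treeX.hist (infoX s) = lX
  recallY : ∀ lX lY s, toGameForm.Reach H lX lY s → treeY.hist (infoY s) = lY

namespace Game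

variable {S X Y : Type u} [Fintype S] {A : X → Type u} {B : Y → Type u} {H : ℕ}

/-- What happens at one step: the state, and the actions of the two players. -/
abbrev Node (G : Game S X Y A B H) : Type u := Σ s : S, A (G.infoX s) × B (G.infoY s)

/-- Probability that the state at step `h` is the one of the trajectory `e`, given what happened
before in `e`. -/
def arrival (G : Game S X Y A B H) {n : ℕ} (e : Fin n → G.Node) : Fin n → ℝ
  | ⟨0, h₀⟩ => G.init (e ⟨0, h₀⟩).1
  | ⟨k + 1, hk⟩ =>
      G.trans k (e ⟨k, by omega⟩).1 (e ⟨k, by omega⟩).2.1 (e ⟨k, by omega⟩).2.2 (e ⟨k + 1, hk⟩).1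

/-- What the max-player observes in an episode `e`: the pairs `(x_h, a_h)` and the
losses `1 - r_h`. -/
def observedX (G : Game S X Y A B H) (e : Fin H → G.Node) (h : Fin H) : (Σ x, A x) × ℝ :=
  (⟨G.infoX (e h).1, (e h).2.1⟩, 1 - G.reward h (e h).1 (e h).2.1 (e h).2.2)

/-- What the min-player observes in an episode `e`: the pairs `(y_h, b_h)` and the
losses `r_h`. -/
def observedY (G : Game S X Y A B H) (e : Fin H → G.Node) (h : Fin H) : (Σ y, B y) × ℝ :=
  (⟨G.infoY (e h).1, (e h).2.2⟩, G.reward h (e h).1 (e h).2.1 (e h).2.2)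

variable [∀ x, Fintype (A x)] [∀ y, Fintype (B y)]

/-- Probability that the first `n` steps of an episode played with `(μ, ν)` are `e`
(for an entire episode, `n = H`). -/
def prob (G : Game S X Y A B H) (μ : Policy A) (ν : Policy B) {n : ℕ} (e : Fin n → G.Node) : ℝ :=
  ∏ h, G.arrival e h * (μ.1 (G.infoX (e h).1) (e h).2.1 * ν.1 (G.infoY (e h).1) (e h).2.2)

/-- Expected total reward `V^{μ,ν}` of the max-player. -/
def value (G : Game S X Y A B H) (μ : Policy A) (ν : Policy B) : ℝ :=
  ∑ e : Fin H → G.Node, G.prob μ ν e * ∑ h : Fin H, G.reward h (e h).1 (e h).2.1 (e h).2.2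

/-- Regret of the max-player after `T` episodes played with `(μ 0, ν 0), …, (μ (T-1), ν (T-1))`. -/
def regretMax (G : Game S X Y A B H) (T : ℕ) (μ : ℕ → Policy A) (ν : ℕ → Policy B) : ℝ :=
  ⨆ μ' : Policy A, ∑ t ∈ Finset.range T, (G.value μ' (ν t) - G.value (μ t) (ν t))

/-- `(μ, ν)` is an `ε`-optimal profile (`ε`-Nash-equilibrium):
`max_{μ'} V^{μ',ν} - min_{ν'} V^{μ,ν'} ≤ ε`. -/
def IsOptimalProfile (G : Game S X Y A B H) (ε : ℝ) (μ : Policy A) (ν : Policy B) : Prop :=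
  ∀ (μ' : Policy A) (ν' : Policy B), G.value μ' ν - G.value μ ν' ≤ ε

/-- `T` successive episodes of the game. `ℱ t` is what has happened before episode `t`
(`t = 0, …, T-1`), possibly including additional randomness of the players: the policies
`μ t` and `ν t` of episode `t` are chosen based on `ℱ t`, and the trajectory `τ t` of episode `t` is
then drawn, conditionally on `ℱ t`, according to the law of an episode under `(μ t, ν t)`. -/
structure Interaction (G : Game S X Y A B H) (T : ℕ) {Ω : Type v} [mΩ : MeasurableSpace Ω]
    (P : Measure Ω) where
  ℱ : Filtration ℕ mΩ
  μ : ℕ → Ω → Policy A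
  ν : ℕ → Ω → Policy B
  τ : ℕ → Ω → Fin H → G.Node
  measurable_μ : ∀ t < T, ∀ x a, Measurable[ℱ t] fun ω => (μ t ω).1 x a
  measurable_ν : ∀ t < T, ∀ y b, Measurable[ℱ t] fun ω => (ν t ω).1 y b
  measurable_τ : ∀ t < T, ∀ e, MeasurableSet[ℱ (t + 1)] {ω | τ t ω = e}
  law_τ : ∀ t < T, ∀ e, P⟦{ω | τ t ω = e} | ℱ t⟧ =ᵐ[P] fun ω => G.prob (μ t ω) (ν t ω) e

end Game

/-- `ι = log (3 N / δ)`, with `N` the total number of actions of the player. -/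
def iota (N : ℕ) (δ : ℝ) : ℝ := Real.log (3 * N / δ)

/-- IX parameters `γ_h = √(A^{H-h} ι / (2 N T))`, where `A` is the size of the action sets, `N` the
total number of actions and `h = 1, …, H` is `k + 1`. -/
def ixParam (A N H T : ℕ) (δ : ℝ) (k : Fin H) : ℝ :=
  √((A : ℝ) ^ (H - (k.1 + 1)) * iota N δ / (2 * N * T))

/-- Learning rates `η_h = √(2 A^{H-h} log N / (N T))`, with `h = k + 1`. -/
def learningRate (A N H T : ℕ) (k : Fin H) : ℝ :=
  √(2 * (A : ℝ) ^ (H - (k.1 + 1)) * Real.log N / (N * T))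

end

/-! ### Elementary inequalities for the exponential and the logarithm. -/

section RealInequalities

/-! Perfect recall makes the value affine in the realization plan (`Game.sum_plan_mul_lossVec`):
against a fixed opponent, `H - V` pairs the plan with a nonnegative vector `lossVec`. The regret is
therefore that of online linear optimization over the convex set of plans, where the algorithm sees
estimates instead of losses. It splits into four terms, assembled in `measure_regret_gt_le`; write
`N` for the total number of actions.

(1) FTRL on the estimates has a deterministic regret: at each step, `log N / η_h` plus `η_h / 2`
times the sum of all estimates divided by `p⋆` (`entropicFTRL_regret`, `regret_ixLoss_le`). (2)
Implicit exploration biases the estimated loss of the played policy downwards, in each episode by at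
most `γ_h N / A^(H-h)` at step `h`. (3) That estimated loss fluctuates around its conditional mean;
it lies in `[0, H]`, so this costs order `H √(T ι)`. (4) For the comparator, implicit exploration
bounds the overestimation of each pair by `p⋆ J / (2 γ_h)`; since `p⋆ μ'` sums to one over a step,
the total is `J / (2 γ_h)` per step, whatever the number of pairs.

Balancing enters (1) and (2) through one fact: some policy satisfies `p⋆ μ ≥ A^(H-h) / N` at every
pair (`exists_balancedPolicy`). The expected loss at a step being at most one, `lossVec / p⋆` sums
to at most `N / A^(H-h)` over that step. With the prescribed parameters the main term of step `h` is
of order `√(N T / A^(H-h))` up to `ι` and `log N`. This is geometric in `h`, so no factor `H`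
appears, and the `H` of (3) is absorbed by `H² ≤ N`.

All deviations come from one exponential supermartingale inequality (`lintegral_exp_sum_le_one`),
applied to `N + H + 1 ≤ 3 N` events. For (ii), the min-player is the max-player of the swapped game,
and the two regrets together bound the gap of the average profile. -/

theorem Real.exp_neg_le_quadratic {y : ℝ} (hy : 0 ≤ y) : Real.exp (-y) ≤ 1 - y + y ^ 2 / 2 := by
  have h1 := Real.quadratic_le_exp_of_nonneg hy
  have h2 : 0 < Real.exp (-y) := Real.exp_pos _
  have h3 : Real.exp (-y) * Real.exp y = 1 := by rw [← Real.exp_add]; simp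
  have h4 : Real.exp (-y) * (1 + y + y ^ 2 / 2) ≤ 1 := by
    exact (mul_le_mul_of_nonneg_left h1 h2.le).trans h3.le
  have h5 : 0 < 1 + y + y ^ 2 / 2 := by positivity
  rw [← mul_le_mul_iff_left₀ h5]
  -- `(1 + y + y²/2)(1 - y + y²/2) = 1 + y⁴/4`.
  nlinarith [sq_nonneg (y ^ 2)]

/-- Convexity of `w ↦ w log w`: the graph lies above the tangent at `v`. -/
theorem Real.mul_log_sub_mul_log_ge {w v : ℝ} (hw : 0 ≤ w) (hv : 0 < v) :
    w - v ≤ w * Real.log w - w * Real.log v := by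
  rcases hw.eq_or_lt with rfl | hw
  · simpa using hv.le
  · have := Real.log_le_sub_one_of_pos (div_pos hv hw)
    rw [Real.log_div hv.ne' hw.ne'] at this
    have h2 := mul_le_mul_of_nonneg_left this hw.le
    have h3 : w * (v / w - 1) = v - w := by field_simp
    linarith

/-- As a function of `w'`, the right-hand side is smallest at `w' = w e^{-z}`, so the tangent of `w
log w` is taken there; the minimum `w (1 - z - e^{-z})` is then bounded by the quadratic estimate of
`e^{-z}`. -/
theorem Real.entropy_stability {w w' z : ℝ} (hw : 0 < w) (hw' : 0 ≤ w') (hz : 0 ≤ z) :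
    -(w * z ^ 2 / 2) ≤
      (w' - w) * z + (w' * Real.log w' - w' * Real.log w - w' + w) := by
  have h1 := Real.mul_log_sub_mul_log_ge hw' (mul_pos hw (Real.exp_pos (-z)))
  rw [Real.log_mul hw.ne' (Real.exp_pos _).ne', Real.log_exp] at h1
  have h2 := mul_le_mul_of_nonneg_left (Real.exp_neg_le_quadratic hz) hw.le
  linarith

/-- The key inequality behind implicit exploration. -/
theorem Real.exp_ix_le {α l p g : ℝ} (hα : 0 ≤ α) (hl : 0 ≤ l) (hl1 : l ≤ 1) (hp : 0 < p)
    (hαg : α ≤ 2 * g) : Real.exp (α * (l / (p + g))) ≤ 1 + α * (l / p) := by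
  have hg : 0 ≤ g := by linarith
  have hz : 0 ≤ α * (l / p) := by positivity
  rw [← Real.le_log_iff_exp_le (by positivity)]
  -- With `z = α l / p`, the bound `2 z / (2 + z) ≤ log (1 + z)` reduces the claim to `α l ≤ 2 g`.
  refine le_trans ?_ (Real.le_log_one_add_of_nonneg hz)
  have h1 : 2 * (α * (l / p)) / (α * (l / p) + 2) = 2 * (α * l) / (α * l + 2 * p) := by
    field_simp
  rw [h1, ← mul_div_assoc, div_le_div_iff₀ (by positivity) (by positivity)]
  have : α * l ≤ 2 * g := by nlinarith
  nlinarith [mul_nonneg hα hl]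

end RealInequalities

/-! ### Follow-the-regularized-leader with entropy on a convex set of nonnegative vectors. -/

section EntropicFTRL

variable {ι : Type*} [Fintype ι]

/-- Linear loss `L` plus the entropy of the rescaled vector `c * q`, with learning rates `η`. -/
noncomputable def entropicObjective (c η L q : ι → ℝ) : ℝ :=
  ∑ i, (q i * L i + c i * q i * Real.log (c i * q i) / η i)

variable {c η L : ι → ℝ} {K : Set (ι → ℝ)} {q : ι → ℝ}

/-- Convexity bounds the increase from `q` to the mixture by `s` times the derivative at the
mixture. The tangent is taken there and not at `q`, where a coordinate may still vanish and the
logarithm has no derivative. -/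
theorem entropicObjective_directional_nonneg (hc : ∀ i, 0 < c i) (hη : ∀ i, 0 < η i)
    (hK : Convex ℝ K) (hK0 : ∀ q ∈ K, ∀ i, 0 ≤ q i) (hq : q ∈ K)
    (hmin : ∀ q' ∈ K, entropicObjective c η L q ≤ entropicObjective c η L q')
    {u : ι → ℝ} (hu : u ∈ K) {s : ℝ} (hs0 : 0 < s) (hs1 : s < 1)
    (hpos : ∀ i, 0 < (1 - s) * q i + s * u i) :
    0 ≤ ∑ i, ((u i - q i) * L i +
      c i * (u i - q i) * (Real.log (c i * ((1 - s) * q i + s * u i)) + 1) / η i) := by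
  have hm : (fun i => (1 - s) * q i + s * u i) ∈ K := by
    have := hK hq hu (sub_nonneg.2 hs1.le) hs0.le (by ring)
    exact this
  have h1 := hmin _ hm
  rw [← sub_nonneg, entropicObjective, entropicObjective, ← Finset.sum_sub_distrib] at h1
  have h2 : s * ∑ i, ((u i - q i) * L i +
      c i * (u i - q i) * (Real.log (c i * ((1 - s) * q i + s * u i)) + 1) / η i) ≥ 0 := by
    refine h1.trans ?_
    rw [Finset.mul_sum]
    refine Finset.sum_le_sum fun i _ => ?_
    have h3 := Real.mul_log_sub_mul_log_ge (mul_nonneg (hc i).le (hK0 q hq i))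
      (mul_pos (hc i) (hpos i))
    have h4 : c i * ((1 - s) * q i + s * u i) *
          Real.log (c i * ((1 - s) * q i + s * u i)) / η i - c i * q i * Real.log (c i * q i) / η i
        ≤ s * (c i * (u i - q i) * (Real.log (c i * ((1 - s) * q i + s * u i)) + 1) / η i) := by
      rw [← sub_div, ← mul_div_assoc]
      refine div_le_div_of_nonneg_right ?_ (hη i).le
      linarith
    linarith
  exact nonneg_of_mul_nonneg_right h2 hs0

/-- Entropy acts as a barrier: if `q j = 0`, the derivative towards `u` contains a positive multiple
of `log s`, which tends to `-∞` as `s → 0`, while the other terms stay bounded above. -/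
theorem entropicObjective_minimizer_pos (hc : ∀ i, 0 < c i) (hη : ∀ i, 0 < η i)
    (hK : Convex ℝ K) (hK0 : ∀ q ∈ K, ∀ i, 0 ≤ q i) (hq : q ∈ K)
    (hmin : ∀ q' ∈ K, entropicObjective c η L q ≤ entropicObjective c η L q')
    {u : ι → ℝ} (hu : u ∈ K) (hu0 : ∀ i, 0 < u i) (j : ι) : 0 < q j := by
  by_contra hj
  have hj : q j = 0 := le_antisymm (not_lt.1 hj) (hK0 q hq j)
  classical
  -- Upper bounds uniform in `s`: replacing the mixture by `u i` inside the logarithm can only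
  -- increase a term, whichever sign `u i - q i` has.
  set b : ι → ℝ := fun i => (u i - q i) * L i + c i * (u i - q i) * (Real.log (c i * u i) + 1) / η i
  have key : ∀ s : ℝ, 0 < s → s < 1 → 0 ≤ ∑ i, b i + c j * u j * Real.log s / η j := by
    intro s hs0 hs1
    have hpos : ∀ i, 0 < (1 - s) * q i + s * u i := fun i => by
      have := hK0 q hq i
      have := mul_pos hs0 (hu0 i)
      have := mul_nonneg (sub_nonneg.2 hs1.le) (hK0 q hq i)
      linarith
    refine (entropicObjective_directional_nonneg hc hη hK hK0 hq hmin hu hs0 hs1 hpos).trans ?_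
    have h5 : c j * u j * Real.log s / η j
        = ∑ i, if i = j then c j * u j * Real.log s / η j else 0 := by simp
    rw [h5, ← Finset.sum_add_distrib]
    refine Finset.sum_le_sum fun i _ => ?_
    simp only [b]
    split_ifs with hij
    · subst hij
      rw [hj, mul_zero, zero_add, sub_zero, show c i * (s * u i) = s * (c i * u i) by ring,
        Real.log_mul hs0.ne' (mul_pos (hc i) (hu0 i)).ne']
      apply le_of_eq; ring
    · rw [add_zero, add_le_add_iff_left]
      refine div_le_div_of_nonneg_right ?_ (hη i).le
      rw [mul_assoc, mul_assoc]
      refine mul_le_mul_of_nonneg_left ?_ (hc i).le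
      rcases le_total (q i) (u i) with h | h
      · refine mul_le_mul_of_nonneg_left ?_ (sub_nonneg.2 h)
        have : (1 - s) * q i + s * u i ≤ u i := by nlinarith
        have := Real.log_le_log (mul_pos (hc i) (hpos i))
          (mul_le_mul_of_nonneg_left this (hc i).le)
        linarith
      · refine mul_le_mul_of_nonpos_left ?_ (sub_nonpos.2 h)
        have : u i ≤ (1 - s) * q i + s * u i := by nlinarith
        have := Real.log_le_log (mul_pos (hc i) (hu0 i))
          (mul_le_mul_of_nonneg_left this (hc i).le)
        linarith
  have hd : 0 < c j * u j / η j := div_pos (mul_pos (hc j) (hu0 j)) (hη j)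
  set M : ℝ := (|∑ i, b i| + 1) / (c j * u j / η j)
  have hM : 0 < M := by positivity
  have := key (Real.exp (-M)) (Real.exp_pos _) (by simpa using hM)
  rw [Real.log_exp] at this
  have h6 : c j * u j * -M / η j = -(|∑ i, b i| + 1) := by
    have : M * (c j * u j / η j) = |∑ i, b i| + 1 := div_mul_cancel₀ _ hd.ne'
    rw [← this]; ring
  rw [h6] at this
  linarith [le_abs_self (∑ i, b i)]

/-- Once the minimizer is positive, letting `s → 0` gives the first-order condition at `q` itself;
the objective differs from its linearization at `q` exactly by the Bregman divergence of the
entropy. -/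
theorem entropicObjective_growth (hc : ∀ i, 0 < c i) (hη : ∀ i, 0 < η i)
    (hK : Convex ℝ K) (hK0 : ∀ q ∈ K, ∀ i, 0 ≤ q i) (hq : q ∈ K)
    (hmin : ∀ q' ∈ K, entropicObjective c η L q ≤ entropicObjective c η L q')
    (hq0 : ∀ i, 0 < q i) {u : ι → ℝ} (hu : u ∈ K) :
    entropicObjective c η L q + ∑ i, (c i * u i * Real.log (c i * u i) -
      c i * u i * Real.log (c i * q i) - c i * u i + c i * q i) / η i
      ≤ entropicObjective c η L u := by
  have hlim : Filter.Tendsto (fun s : ℝ => ∑ i, ((u i - q i) * L i +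
      c i * (u i - q i) * (Real.log (c i * ((1 - s) * q i + s * u i)) + 1) / η i))
      (nhdsWithin 0 (Set.Ioi 0)) (nhds (∑ i, ((u i - q i) * L i +
      c i * (u i - q i) * (Real.log (c i * q i) + 1) / η i))) := by
    refine tendsto_finsetSum _ fun i _ => ?_
    have h0 : Filter.Tendsto (fun s : ℝ => c i * ((1 - s) * q i + s * u i))
        (nhdsWithin 0 (Set.Ioi 0)) (nhds (c i * q i)) := by
      have : Continuous (fun s : ℝ => c i * ((1 - s) * q i + s * u i)) := by fun_prop
      have := (this.tendsto 0).mono_left (nhdsWithin_le_nhds (s := Set.Ioi 0))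
      simpa using this
    have h1 := h0.log (mul_pos (hc i) (hq0 i)).ne'
    exact (((h1.add_const 1).const_mul _).div_const _).const_add _
  have h2 : 0 ≤ ∑ i, ((u i - q i) * L i +
      c i * (u i - q i) * (Real.log (c i * q i) + 1) / η i) := by
    refine ge_of_tendsto hlim ?_
    filter_upwards [Ioo_mem_nhdsGT (zero_lt_one' ℝ)] with s hs
    refine entropicObjective_directional_nonneg hc hη hK hK0 hq hmin hu hs.1 hs.2 fun i => ?_
    have := mul_pos (sub_pos.2 hs.2) (hq0 i)
    have := mul_nonneg hs.1.le (hK0 u hu i)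
    linarith
  rw [← sub_nonneg]
  refine h2.trans (le_of_eq ?_)
  rw [entropicObjective, entropicObjective, ← Finset.sum_add_distrib, ← Finset.sum_sub_distrib]
  refine Finset.sum_congr rfl fun i _ => ?_
  have := (hη i).ne'
  field_simp
  ring

/-- Regret of follow-the-regularized-leader with an entropic regularizer, for nonnegative losses. -/
theorem entropicFTRL_regret (hc : ∀ i, 0 < c i) (hη : ∀ i, 0 < η i)
    (hK : Convex ℝ K) (hK0 : ∀ q ∈ K, ∀ i, 0 ≤ q i) {u₀ : ι → ℝ} (hu₀ : u₀ ∈ K)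
    (hu₀_pos : ∀ i, 0 < u₀ i) {T : ℕ} {q ℓ : ℕ → ι → ℝ} (hℓ : ∀ t i, 0 ≤ ℓ t i)
    (hq : ∀ t < T, q t ∈ K)
    (hmin : ∀ t < T, ∀ q' ∈ K,
      entropicObjective c η (fun i => ∑ k ∈ Finset.range t, ℓ k i) (q t) ≤
      entropicObjective c η (fun i => ∑ k ∈ Finset.range t, ℓ k i) q') :
    ∀ t < T, ∀ u ∈ K,
      entropicObjective c η 0 (q 0) +
          ∑ k ∈ Finset.range (t + 1), ∑ i, (q k i * ℓ k i - η i / 2 * (q k i * ℓ k i ^ 2 / c i)) ≤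
        entropicObjective c η (fun i => ∑ k ∈ Finset.range (t + 1), ℓ k i) u := by
  -- The divergence gained by moving away from the minimizer `q t` pays for the change of the new
  -- loss, coordinate by coordinate, up to the quadratic term of `Real.entropy_stability` with `z =
  -- η ℓ / c`.
  have step : ∀ t < T, ∀ u ∈ K,
      entropicObjective c η (fun i => ∑ k ∈ Finset.range t, ℓ k i) (q t) +
        ∑ i, (q t i * ℓ t i - η i / 2 * (q t i * ℓ t i ^ 2 / c i)) ≤
      entropicObjective c η (fun i => ∑ k ∈ Finset.range (t + 1), ℓ k i) u := by
    intro t ht u hu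
    have hpos := fun i => entropicObjective_minimizer_pos hc hη hK hK0 (hq t ht) (hmin t ht)
      hu₀ hu₀_pos i
    have h1 := entropicObjective_growth hc hη hK hK0 (hq t ht) (hmin t ht) hpos hu
    have h2 : entropicObjective c η (fun i => ∑ k ∈ Finset.range (t + 1), ℓ k i) u =
        entropicObjective c η (fun i => ∑ k ∈ Finset.range t, ℓ k i) u + ∑ i, u i * ℓ t i := by
      simp only [entropicObjective, Finset.sum_range_succ]
      rw [← Finset.sum_add_distrib]
      refine Finset.sum_congr rfl fun i _ => by ring
    rw [h2]
    refine le_trans ?_ (add_le_add_left h1 _)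
    rw [add_assoc, add_le_add_iff_left, ← Finset.sum_add_distrib]
    refine Finset.sum_le_sum fun i _ => ?_
    have h3 := Real.entropy_stability (mul_pos (hc i) (hpos i))
      (mul_nonneg (hc i).le (hK0 u hu i))
      (div_nonneg (mul_nonneg (hη i).le (hℓ t i)) (hc i).le)
    have h4 := div_le_div_of_nonneg_right h3 (hη i).le
    have h5 : -(c i * q t i * (η i * ℓ t i / c i) ^ 2 / 2) / η i =
        - (η i / 2 * (q t i * ℓ t i ^ 2 / c i)) := by
      have := (hη i).ne'
      have := (hc i).ne'
      field_simp
    have h6 : (c i * u i - c i * q t i) * (η i * ℓ t i / c i) / η i =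
        u i * ℓ t i - q t i * ℓ t i := by
      have := (hη i).ne'
      have := (hc i).ne'
      field_simp
    rw [h5, add_div, h6] at h4
    linarith
  intro t
  induction t with
  | zero =>
    intro ht u hu
    have := step 0 ht u hu
    simpa [Pi.zero_def] using this
  | succ t ih =>
    intro ht u hu
    -- The induction hypothesis is used with the next leader as comparator, so that the sums
    -- telescope.
    have h1 := ih (by omega) (q (t + 1)) (hq _ ht)
    have h2 := step (t + 1) ht u hu
    rw [Finset.sum_range_succ]
    linarith

end EntropicFTRL

/-- Lower bound on the negative entropy of a probability vector. -/
theorem neg_log_le_sum_mul_log {ι : Type*} {w : ι → ℝ} (s : Finset ι) (hw : ∀ i, 0 ≤ w i)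
    (hsum : ∑ i ∈ s, w i = 1) {N : ℝ} (hN : 0 < N) (hs : (s.card : ℝ) ≤ N) :
    -Real.log N ≤ ∑ i ∈ s, w i * Real.log (w i) := by
  have h : ∀ i ∈ s, w i - 1 / N - w i * Real.log N ≤ w i * Real.log (w i) := fun i _ => by
    have := Real.mul_log_sub_mul_log_ge (hw i) (one_div_pos.2 hN)
    rw [one_div, Real.log_inv] at this
    rw [one_div]
    linarith
  refine le_trans ?_ (Finset.sum_le_sum h)
  rw [Finset.sum_sub_distrib, Finset.sum_sub_distrib, ← Finset.sum_mul, hsum, Finset.sum_const,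
    nsmul_eq_mul, mul_one_div]
  have : (s.card : ℝ) / N ≤ 1 := (div_le_one hN).2 hs
  linarith

/-! ### Ancestors and subtrees in the tree of information sets. -/

namespace InfoTree

variable {X : Type u} {A : X → Type u} {H : ℕ}

/-- `hist_tail` speaks only of the most recent pair; induction along the history extends it to every
pair, so that a history contains the full histories of all its entries. -/
theorem hist_eq_append_of_mem (𝒯 : InfoTree X A H) {y : X} {b : A y} :
    ∀ {x : X}, (⟨y, b⟩ : Σ x, A x) ∈ 𝒯.hist x → ∃ l, 𝒯.hist x = l ++ ⟨y, b⟩ :: 𝒯.hist y := by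
  suffices ∀ (n : ℕ) (x : X), (𝒯.hist x).length = n → (⟨y, b⟩ : Σ x, A x) ∈ 𝒯.hist x →
      ∃ l, 𝒯.hist x = l ++ ⟨y, b⟩ :: 𝒯.hist y from fun {x} h => this _ x rfl h
  intro n
  induction n with
  | zero =>
    intro x hx h
    rw [List.length_eq_zero_iff.1 hx] at h
    simp at h
  | succ n ih =>
    intro x hx h
    rcases hl : 𝒯.hist x with _ | ⟨⟨z, c⟩, l⟩
    · rw [hl] at h; simp at h
    · have hz := 𝒯.hist_tail x z c l hl
      rw [hl, List.mem_cons] at h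
      rcases h with h | h
      · cases h
        exact ⟨[], by rw [hz]; rfl⟩
      · rw [← hz] at h
        obtain ⟨l', hl'⟩ := ih z (by rw [hz]; rw [hl] at hx; simpa using hx) h
        exact ⟨⟨z, c⟩ :: l', by rw [← hz, hl']; rfl⟩

theorem mem_hist_unique (𝒯 : InfoTree X A H) {x y z : X} {b : A y} {c : A z}
    (hy : (⟨y, b⟩ : Σ x, A x) ∈ 𝒯.hist x) (hz : (⟨z, c⟩ : Σ x, A x) ∈ 𝒯.hist x)
    (h : (𝒯.hist y).length = (𝒯.hist z).length) : y = z := by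
  obtain ⟨l, hl⟩ := 𝒯.hist_eq_append_of_mem hy
  obtain ⟨m, hm⟩ := 𝒯.hist_eq_append_of_mem hz
  have := (List.append_inj' (hl.symm.trans hm) (by simp [h])).2
  simp only [List.cons.injEq] at this
  exact congrArg Sigma.fst this.1

/-- `x'` lies in the subtree of `x`. -/
def Descends (𝒯 : InfoTree X A H) (x x' : X) : Prop :=
  x' = x ∨ ∃ a : A x, (⟨x, a⟩ : Σ x, A x) ∈ 𝒯.hist x'

theorem length_le_of_descends (𝒯 : InfoTree X A H) {x x' : X} (h : 𝒯.Descends x x') :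
    (𝒯.hist x).length ≤ (𝒯.hist x').length := by
  rcases h with rfl | ⟨a, h⟩
  · exact le_rfl
  · obtain ⟨l, hl⟩ := 𝒯.hist_eq_append_of_mem h
    rw [hl]; simp; omega

theorem length_lt_of_mem_hist (𝒯 : InfoTree X A H) {x x' : X} {a : A x}
    (h : (⟨x, a⟩ : Σ x, A x) ∈ 𝒯.hist x') : (𝒯.hist x).length < (𝒯.hist x').length := by
  obtain ⟨l, hl⟩ := 𝒯.hist_eq_append_of_mem h
  rw [hl]; simp; omega

theorem descends_unique (𝒯 : InfoTree X A H) {x y z : X} (hy : 𝒯.Descends y x)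
    (hz : 𝒯.Descends z x) (h : (𝒯.hist y).length = (𝒯.hist z).length) : y = z := by
  rcases hy with rfl | ⟨b, hb⟩ <;> rcases hz with rfl | ⟨c, hc⟩
  · rfl
  · exact absurd (𝒯.length_lt_of_mem_hist hc) (by omega)
  · exact absurd (𝒯.length_lt_of_mem_hist hb) (by omega)
  · exact 𝒯.mem_hist_unique hb hc h

theorem descends_of_child (𝒯 : InfoTree X A H) {x c x' : X} {a : A x}
    (hc : 𝒯.hist c = ⟨x, a⟩ :: 𝒯.hist x) (h : 𝒯.Descends c x') :
    (⟨x, a⟩ : Σ x, A x) ∈ 𝒯.hist x' := by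
  rcases h with rfl | ⟨b, hb⟩
  · rw [hc]; simp
  · obtain ⟨l, hl⟩ := 𝒯.hist_eq_append_of_mem hb
    rw [hl, hc]; simp

/-- The oldest entry of the history is a root: were its own history nonempty, it would end in that
same entry, which would be a strict ancestor of itself. -/
theorem exists_root_descends (𝒯 : InfoTree X A H) (x : X) :
    ∃ r, 𝒯.hist r = [] ∧ 𝒯.Descends r x := by
  rcases List.eq_nil_or_concat (𝒯.hist x) with h | ⟨l, ⟨y, b⟩, h⟩
  · exact ⟨x, h, Or.inl rfl⟩
  · have hm : (⟨y, b⟩ : Σ x, A x) ∈ 𝒯.hist x := by rw [h]; simp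
    refine ⟨y, ?_, Or.inr ⟨b, hm⟩⟩
    obtain ⟨m, hm⟩ := 𝒯.hist_eq_append_of_mem hm
    have hlen : ((⟨y, b⟩ :: 𝒯.hist y : List (Σ x, A x))).getLast (by simp) = ⟨y, b⟩ := by
      have h1 : (𝒯.hist x).getLast? = some ⟨y, b⟩ := by rw [h]; simp
      rw [hm, List.getLast?_append_of_ne_nil _ (by simp), List.getLast?_eq_getLast_of_ne_nil
        (by simp)] at h1
      exact Option.some.inj h1
    by_contra hne
    rw [List.getLast_cons hne] at hlen
    have := 𝒯.length_lt_of_mem_hist (hlen ▸ List.getLast_mem hne :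
      (⟨y, b⟩ : Σ x, A x) ∈ 𝒯.hist y)
    omega

theorem hist_induction (𝒯 : InfoTree X A H) {p : X → Prop}
    (root : ∀ x, 𝒯.hist x = [] → p x)
    (child : ∀ x y (b : A y), 𝒯.hist x = ⟨y, b⟩ :: 𝒯.hist y → p y → p x) (x : X) : p x := by
  induction hn : (𝒯.hist x).length generalizing x with
  | zero => exact root x (List.length_eq_zero_iff.1 hn)
  | succ n ih =>
    rcases hl : 𝒯.hist x with _ | ⟨⟨y, b⟩, l⟩
    · simp [hl] at hn
    · have hy := 𝒯.hist_tail x y b l hl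
      refine child x y b (by rw [hl, hy]) (ih y ?_)
      rw [hy]; simpa [hl] using hn

/-! ### Realization plans. -/

section Plans

variable [∀ x, Fintype (A x)]

/-- The product of the probabilities of the past actions on the way to `x`. -/
noncomputable def prefixPlan (𝒯 : InfoTree X A H) (μ : Policy A) (x : X) : ℝ :=
  ((𝒯.hist x).map fun q => μ.1 q.1 q.2).prod

theorem plan_eq (𝒯 : InfoTree X A H) (μ : Policy A) (x : X) (a : A x) :
    𝒯.plan μ x a = 𝒯.prefixPlan μ x * μ.1 x a := rfl

theorem prefixPlan_root (𝒯 : InfoTree X A H) (μ : Policy A) {x : X} (h : 𝒯.hist x = []) :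
    𝒯.prefixPlan μ x = 1 := by simp [prefixPlan, h]

theorem prefixPlan_child (𝒯 : InfoTree X A H) (μ : Policy A) {x y : X} {b : A y}
    (h : 𝒯.hist x = ⟨y, b⟩ :: 𝒯.hist y) : 𝒯.prefixPlan μ x = 𝒯.plan μ y b := by
  simp [prefixPlan, plan, h, mul_comm]

theorem prefixPlan_nonneg (𝒯 : InfoTree X A H) (μ : Policy A) (x : X) : 0 ≤ 𝒯.prefixPlan μ x :=
  List.prod_nonneg (by
    intro r hr
    obtain ⟨q, -, rfl⟩ := List.mem_map.1 hr
    exact (μ.2 q.1).1 q.2)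

theorem plan_nonneg (𝒯 : InfoTree X A H) (μ : Policy A) (x : X) (a : A x) :
    0 ≤ 𝒯.plan μ x a :=
  mul_nonneg (𝒯.prefixPlan_nonneg μ x) ((μ.2 x).1 a)

theorem sum_plan (𝒯 : InfoTree X A H) (μ : Policy A) (x : X) :
    ∑ a, 𝒯.plan μ x a = 𝒯.prefixPlan μ x := by
  simp_rw [plan_eq, ← Finset.mul_sum, (μ.2 x).2, mul_one]

/-- Realization plans form a convex set. -/
theorem exists_mixture {ι : Type*} (𝒯 : InfoTree X A H) (s : Finset ι) (c : ι → ℝ)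
    (hc : ∀ i ∈ s, 0 ≤ c i) (hc1 : ∑ i ∈ s, c i = 1) (m : ι → Policy A) :
    ∃ μ : Policy A, ∀ x a, 𝒯.plan μ x a = ∑ i ∈ s, c i * 𝒯.plan (m i) x a := by
  classical
  obtain ⟨i₀⟩ : Nonempty ι := by
    by_contra h
    rw [not_nonempty_iff] at h
    simp [Finset.eq_empty_of_isEmpty s] at hc1
  set Q : X → ℝ := fun x => ∑ i ∈ s, c i * 𝒯.prefixPlan (m i) x with hQ
  have hQ0 : ∀ x, 0 ≤ Q x := fun x =>
    Finset.sum_nonneg fun i hi => mul_nonneg (hc i hi) (𝒯.prefixPlan_nonneg _ _)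
  have hqsum : ∀ x, ∑ a, ∑ i ∈ s, c i * 𝒯.plan (m i) x a = Q x := fun x => by
    rw [Finset.sum_comm]
    simp_rw [← Finset.mul_sum, sum_plan, hQ]
  -- The behavioural policy is the conditional distribution given that `x` is reached. Where the
  -- mixture never reaches `x`, any distribution will do, and that of `m i₀` is borrowed.
  let μ : Policy A := ⟨fun x a => if Q x = 0 then (m i₀).1 x a else
    (∑ i ∈ s, c i * 𝒯.plan (m i) x a) / Q x, fun x => by
      by_cases h : Q x = 0
      · simpa [h] using (m i₀).2 x
      · simp only [h, if_false]
        exact ⟨fun a => div_nonneg (Finset.sum_nonneg fun i hi =>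
            mul_nonneg (hc i hi) (𝒯.plan_nonneg _ _ _)) (hQ0 x), by
          rw [← Finset.sum_div, hqsum, div_self h]⟩⟩
  have key : ∀ x a, Q x * μ.1 x a = ∑ i ∈ s, c i * 𝒯.plan (m i) x a := by
    intro x a
    by_cases h : Q x = 0
    · rw [h, zero_mul]
      have h0 := (Finset.sum_eq_zero_iff_of_nonneg fun i hi =>
        mul_nonneg (hc i hi) (𝒯.prefixPlan_nonneg (m i) x)).1 h
      refine (Finset.sum_eq_zero fun i hi => ?_).symm
      rw [plan_eq, ← mul_assoc, h0 i hi, zero_mul]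
    · simp only [μ, h, if_false]
      field_simp
  have hpre : ∀ x, 𝒯.prefixPlan μ x = Q x := by
    refine 𝒯.hist_induction (fun x hx => ?_) (fun x y b hx ih => ?_)
    · simp only [hQ, 𝒯.prefixPlan_root _ hx, mul_one, hc1]
    · rw [𝒯.prefixPlan_child μ hx, plan_eq, ih, key]
      simp only [hQ, 𝒯.prefixPlan_child _ hx]
  exact ⟨μ, fun x a => by rw [plan_eq, hpre, key]⟩

theorem exists_isAverage (𝒯 : InfoTree X A H) {T : ℕ} (hT : 0 < T) (μ : ℕ → Policy A) :
    ∃ μbar, 𝒯.IsAverage T μ μbar := by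
  obtain ⟨m, hm⟩ := 𝒯.exists_mixture (Finset.range T) (fun _ => 1 / (T : ℝ))
    (fun _ _ => by positivity) (by
      rw [Finset.sum_const, Finset.card_range, nsmul_eq_mul]
      field_simp) μ
  exact ⟨m, fun x a => by rw [hm, Finset.mul_sum]⟩

/-- Realization plan as a vector indexed by the pairs (information set, action). -/
noncomputable def planVec (𝒯 : InfoTree X A H) (μ : Policy A) (i : Σ x, A x) : ℝ :=
  𝒯.plan μ i.1 i.2

theorem convex_range_planVec (𝒯 : InfoTree X A H) : Convex ℝ (Set.range 𝒯.planVec) := by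
  rintro _ ⟨μ, rfl⟩ _ ⟨μ', rfl⟩ r s hr hs hrs
  obtain ⟨m, hm⟩ := 𝒯.exists_mixture Finset.univ ![r, s]
    (by intro i _; fin_cases i <;> simp [hr, hs]) (by simpa using hrs) ![μ, μ']
  refine ⟨m, ?_⟩
  ext ⟨x, a⟩
  simp [planVec, hm]

end Plans

end InfoTree

/-! ### Counting actions in subtrees. -/

namespace InfoTree

variable {X : Type u} {A : X → Type u} {H : ℕ} [Fintype X]

open Classical in
/-- The information sets in the subtree of `x`. -/
noncomputable def descendants (𝒯 : InfoTree X A H) (x : X) : Finset X :=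
  Finset.univ.filter (𝒯.Descends x)

theorem mem_descendants (𝒯 : InfoTree X A H) {x x' : X} :
    x' ∈ 𝒯.descendants x ↔ 𝒯.Descends x x' := by simp [descendants]

open Classical in
/-- The information sets that may follow the action `a` at `x`. -/
noncomputable def children (𝒯 : InfoTree X A H) (x : X) (a : A x) : Finset X :=
  Finset.univ.filter fun x' => 𝒯.hist x' = ⟨x, a⟩ :: 𝒯.hist x

theorem mem_children (𝒯 : InfoTree X A H) {x x' : X} {a : A x} :
    x' ∈ 𝒯.children x a ↔ 𝒯.hist x' = ⟨x, a⟩ :: 𝒯.hist x := by simp [children]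

theorem children_nonempty (𝒯 : InfoTree X A H) {x : X} (a : A x)
    (hx : (𝒯.hist x).length + 1 < H) : (𝒯.children x a).Nonempty := by
  obtain ⟨x', h⟩ := 𝒯.exists_next x a hx
  exact ⟨x', 𝒯.mem_children.2 h⟩

variable [∀ x, Fintype (A x)]

theorem subtreeActions_eq (𝒯 : InfoTree X A H) (x : X) :
    𝒯.subtreeActions x = ∑ x' ∈ 𝒯.descendants x, Fintype.card (A x') := by
  unfold subtreeActions
  refine Finset.sum_congr ?_ fun _ _ => rfl
  ext x'
  simp [mem_descendants, Descends]

/-- Information sets of the same step have disjoint subtrees, as an information set has only one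
ancestor at each step. -/
theorem sum_subtreeActions (𝒯 : InfoTree X A H) [DecidableEq X] (C : Finset X) {n : ℕ}
    (hC : ∀ x ∈ C, (𝒯.hist x).length = n) :
    ∑ x ∈ C, 𝒯.subtreeActions x =
      ∑ x' ∈ C.biUnion 𝒯.descendants, Fintype.card (A x') := by
  rw [Finset.sum_biUnion]
  · exact Finset.sum_congr rfl fun x _ => 𝒯.subtreeActions_eq x
  · intro x hx y hy hxy
    rw [Function.onFun, Finset.disjoint_left]
    intro z hz hz'
    rw [mem_descendants] at hz hz'
    exact hxy (𝒯.descends_unique hz hz' (by rw [hC x hx, hC y hy]))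

open Classical in
theorem sum_subtreeActions_root (𝒯 : InfoTree X A H) :
    ∑ x with 𝒯.hist x = [], 𝒯.subtreeActions x = totalActions A := by
  rw [𝒯.sum_subtreeActions _ (n := 0) (by simp), totalActions]
  refine Finset.sum_congr ?_ fun _ _ => rfl
  ext x'
  simpa [mem_descendants] using 𝒯.exists_root_descends x'

theorem sum_children_subtreeActions_le (𝒯 : InfoTree X A H) (x : X) :
    Fintype.card (A x) + ∑ a, ∑ x' ∈ 𝒯.children x a, 𝒯.subtreeActions x' ≤
      𝒯.subtreeActions x := by
  classical
  rw [← Finset.sum_biUnion, 𝒯.sum_subtreeActions _ (n := (𝒯.hist x).length + 1),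
    𝒯.subtreeActions_eq x, ← Finset.sum_insert (s := Finset.biUnion _ _)
      (f := fun x' => Fintype.card (A x')) (a := x)]
  · refine Finset.sum_le_sum_of_subset fun x' hx' => ?_
    simp only [Finset.mem_insert, Finset.mem_biUnion, Finset.mem_univ, true_and, mem_children,
      mem_descendants] at hx' ⊢
    rcases hx' with rfl | ⟨c, ⟨a, ha⟩, hc⟩
    · exact Or.inl rfl
    · exact Or.inr ⟨a, 𝒯.descends_of_child ha hc⟩
  · simp only [Finset.mem_biUnion, Finset.mem_univ, true_and, mem_children, mem_descendants,
      not_exists, not_and]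
    rintro c ⟨a, ha⟩ hc
    have := 𝒯.length_le_of_descends hc
    rw [ha] at this
    simp at this
  · simp only [Finset.mem_biUnion, Finset.mem_univ, true_and, mem_children]
    rintro c ⟨a, ha⟩
    simp [ha]
  · intro a _ b _ hab
    rw [Function.onFun, Finset.disjoint_left]
    intro c hc hc'
    rw [mem_children] at hc hc'
    rw [hc] at hc'
    simp at hc'
    exact hab hc'

theorem card_le_subtreeActions (𝒯 : InfoTree X A H) (x : X) :
    Fintype.card (A x) ≤ 𝒯.subtreeActions x :=
  (Nat.le_add_right _ _).trans (𝒯.sum_children_subtreeActions_le x)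

theorem subtreeActions_pos (𝒯 : InfoTree X A H) (hA : ∀ x, 0 < Fintype.card (A x)) (x : X) :
    0 < 𝒯.subtreeActions x := (hA x).trans_le (𝒯.card_le_subtreeActions x)

theorem totalActions_pos [Nonempty X] (hA : ∀ x, 0 < Fintype.card (A x)) : 0 < totalActions A :=
  Finset.sum_pos (fun x _ => hA x) Finset.univ_nonempty

/-- Recursive lower bound on the size of subtrees. -/
theorem le_subtreeActions_of_rec (𝒯 : InfoTree X A H) {a : ℕ} (hA : ∀ x, Fintype.card (A x) = a)
    {f : ℕ → ℕ} (hf1 : f 1 ≤ a) (hf : ∀ n, 0 < n → f (n + 1) ≤ a + a * f n) (x : X) :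
    f (H - (𝒯.hist x).length) ≤ 𝒯.subtreeActions x := by
  have hlt := 𝒯.length_hist_lt x
  induction hn : H - (𝒯.hist x).length generalizing x with
  | zero => omega
  | succ n ih =>
    have h1 := 𝒯.sum_children_subtreeActions_le x
    rw [hA] at h1
    rcases Nat.eq_zero_or_pos n with rfl | hn0
    · exact hf1.trans ((Nat.le_add_right _ _).trans h1)
    · have h2 : ∀ b : A x, f n ≤ ∑ x' ∈ 𝒯.children x b, 𝒯.subtreeActions x' := fun b => by
        obtain ⟨c, hc⟩ := 𝒯.children_nonempty b (by omega)
        have hl := 𝒯.mem_children.1 hc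
        refine (ih c (𝒯.length_hist_lt c) ?_).trans
          (Finset.single_le_sum (f := 𝒯.subtreeActions) (fun _ _ => Nat.zero_le _) hc)
        rw [hl, List.length_cons]; omega
      have h3 : a * f n ≤ ∑ b, ∑ x' ∈ 𝒯.children x b, 𝒯.subtreeActions x' := by
        rw [← hA x, Fintype.card, ← smul_eq_mul, ← Finset.sum_const]
        exact Finset.sum_le_sum fun b _ => h2 b
      have h4 := hf n hn0
      omega

theorem pow_le_subtreeActions (𝒯 : InfoTree X A H) {a : ℕ} (hA : ∀ x, Fintype.card (A x) = a)
    (x : X) : a ^ (H - (𝒯.hist x).length) ≤ 𝒯.subtreeActions x :=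
  𝒯.le_subtreeActions_of_rec hA (f := fun n => a ^ n) (by simp)
    (fun n _ => by rw [pow_succ, mul_comm]; omega) x

theorem subtreeActions_le_totalActions (𝒯 : InfoTree X A H) (x : X) :
    𝒯.subtreeActions x ≤ totalActions A := by
  rw [subtreeActions_eq]
  exact Finset.sum_le_sum_of_subset (Finset.subset_univ _)

theorem pow_le_totalActions (𝒯 : InfoTree X A H) {a : ℕ} (hA : ∀ x, Fintype.card (A x) = a)
    [hX : Nonempty X] : a ^ H ≤ totalActions A := by
  obtain ⟨r, hr, -⟩ := 𝒯.exists_root_descends hX.some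
  have := 𝒯.pow_le_subtreeActions hA r
  rw [hr] at this
  exact this.trans (𝒯.subtreeActions_le_totalActions r)

/-- Lets `√N` absorb the factor `H` of the martingale deviation. -/
theorem sq_le_totalActions (𝒯 : InfoTree X A H) {a : ℕ} (hA : ∀ x, Fintype.card (A x) = a)
    (ha : 2 ≤ a) [hX : Nonempty X] : H ^ 2 ≤ totalActions A := by
  obtain ⟨r, hr, -⟩ := 𝒯.exists_root_descends hX.some
  -- `(n + 1)² ≤ 2 + 2 n²` because `(n - 1)² ≥ 0`; this is where `a ≥ 2` is needed.
  have := 𝒯.le_subtreeActions_of_rec hA (f := fun n => n ^ 2) (by simp; omega)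
    (fun n _ => by zify at ha ⊢; nlinarith [sq_nonneg ((n : ℤ) - 1), sq_nonneg (n : ℤ)]) r
  rw [hr] at this
  exact this.trans (𝒯.subtreeActions_le_totalActions r)

/-! ### Balanced transitions and the policy adapted to them. -/

section Balanced

/-- Total size of the subtrees that may follow the action `a` at `x`. -/
noncomputable def childMass (𝒯 : InfoTree X A H) (x : X) (a : A x) : ℝ :=
  ∑ x' ∈ 𝒯.children x a, (𝒯.subtreeActions x' : ℝ)

theorem childMass_nonneg (𝒯 : InfoTree X A H) (x : X) (a : A x) : 0 ≤ 𝒯.childMass x a :=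
  Finset.sum_nonneg fun _ _ => Nat.cast_nonneg _

theorem subtreeActions_le_childMass (𝒯 : InfoTree X A H) {x y : X} {b : A y}
    (h : 𝒯.hist x = ⟨y, b⟩ :: 𝒯.hist y) : (𝒯.subtreeActions x : ℝ) ≤ 𝒯.childMass y b :=
  Finset.single_le_sum (f := fun x' => (𝒯.subtreeActions x' : ℝ))
    (fun _ _ => Nat.cast_nonneg _) (𝒯.mem_children.2 h)

theorem balancedStep_root (𝒯 : InfoTree X A H) {x : X} (h : 𝒯.hist x = []) :
    𝒯.balancedStep x = (𝒯.subtreeActions x : ℝ) / totalActions A := by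
  rw [balancedStep, if_pos h]

theorem balancedStep_child (𝒯 : InfoTree X A H) {x y : X} {b : A y}
    (h : 𝒯.hist x = ⟨y, b⟩ :: 𝒯.hist y) :
    𝒯.balancedStep x = (𝒯.subtreeActions x : ℝ) / 𝒯.childMass y b := by
  rw [balancedStep, if_neg (by simp [h]), childMass, children, h]

theorem balanced_root (𝒯 : InfoTree X A H) {x : X} (h : 𝒯.hist x = []) :
    𝒯.balanced x = (𝒯.subtreeActions x : ℝ) / totalActions A := by
  rw [balanced, 𝒯.balancedStep_root h, h]; simp

theorem balanced_child (𝒯 : InfoTree X A H) {x y : X} {b : A y}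
    (h : 𝒯.hist x = ⟨y, b⟩ :: 𝒯.hist y) :
    𝒯.balanced x = (𝒯.subtreeActions x : ℝ) / 𝒯.childMass y b * 𝒯.balanced y := by
  rw [balanced, 𝒯.balancedStep_child h, h, balanced]; simp

theorem balanced_pos (𝒯 : InfoTree X A H) (hA : ∀ x, 0 < Fintype.card (A x)) (x : X) :
    0 < 𝒯.balanced x := by
  have hpos : ∀ x, (0 : ℝ) < 𝒯.subtreeActions x := fun x =>
    Nat.cast_pos.2 (𝒯.subtreeActions_pos hA x)
  induction x using 𝒯.hist_induction with
  | root x h =>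
    rw [𝒯.balanced_root h]
    exact div_pos (hpos x) ((hpos x).trans_le
      (Nat.cast_le.2 (𝒯.subtreeActions_le_totalActions x)))
  | child x y b h ih =>
    rw [𝒯.balanced_child h]
    exact mul_pos (div_pos (hpos x) ((hpos x).trans_le (𝒯.subtreeActions_le_childMass h))) ih

open Classical in
/-- The products of balanced transitions and realization plans are probability distributions. -/
theorem sum_balanced_mul_plan [Nonempty X] (𝒯 : InfoTree X A H)
    (hA : ∀ x, 0 < Fintype.card (A x)) (μ : Policy A) (h : Fin H) :
    ∑ x with 𝒯.level x = h, ∑ a, 𝒯.balanced x * 𝒯.plan μ x a = 1 := by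
  obtain ⟨n, hn⟩ := h
  simp_rw [level, Fin.mk.injEq]
  induction n with
  | zero =>
    have h0 : ∀ x ∈ Finset.univ.filter (fun x => (𝒯.hist x).length = 0),
        ∑ a, 𝒯.balanced x * 𝒯.plan μ x a = (𝒯.subtreeActions x : ℝ) / totalActions A := by
      intro x hx
      have hx := List.length_eq_zero_iff.1 (Finset.mem_filter.1 hx).2
      rw [← Finset.mul_sum, sum_plan, 𝒯.prefixPlan_root μ hx, 𝒯.balanced_root hx, mul_one]
    rw [Finset.sum_congr rfl h0, ← Finset.sum_div, ← Nat.cast_sum]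
    simp_rw [List.length_eq_zero_iff]
    rw [sum_subtreeActions_root, div_self]
    exact Nat.cast_ne_zero.2 (totalActions_pos hA).ne'
  | succ n ih =>
    rw [← ih (by omega)]
    have hunion : (Finset.univ.filter fun x => (𝒯.hist x).length = n + 1) =
        ((Finset.univ.filter fun x => (𝒯.hist x).length = n).sigma fun _ => Finset.univ).biUnion
          fun p => 𝒯.children p.1 p.2 := by
      ext x
      simp only [Finset.mem_filter, Finset.mem_univ, true_and, Finset.mem_biUnion,
        Finset.mem_sigma, and_true, mem_children]
      constructor
      · intro hx
        rcases hl : 𝒯.hist x with _ | ⟨⟨y, b⟩, l⟩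
        · simp [hl] at hx
        · have hy := 𝒯.hist_tail x y b l hl
          refine ⟨⟨y, b⟩, ?_, by rw [hy]⟩
          rw [hy]; simpa [hl] using hx
      · rintro ⟨p, hp, hx⟩
        rw [hx, List.length_cons, hp]
    rw [hunion, Finset.sum_biUnion, Finset.sum_sigma]
    · refine Finset.sum_congr rfl fun y hy => Finset.sum_congr rfl fun b _ => ?_
      have hy := (Finset.mem_filter.1 hy).2
      have hcm : 𝒯.childMass y b ≠ 0 := by
        refine (Finset.sum_pos (fun x _ => Nat.cast_pos.2 (𝒯.subtreeActions_pos hA x)) ?_).ne'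
        exact 𝒯.children_nonempty b (by omega)
      have h1 : ∀ x ∈ 𝒯.children y b, ∑ a, 𝒯.balanced x * 𝒯.plan μ x a =
          (𝒯.subtreeActions x : ℝ) * (𝒯.balanced y * 𝒯.plan μ y b / 𝒯.childMass y b) := by
        intro x hx
        have hx := 𝒯.mem_children.1 hx
        rw [← Finset.mul_sum, sum_plan, 𝒯.prefixPlan_child μ hx, 𝒯.balanced_child hx]
        ring
      dsimp only
      rw [Finset.sum_congr rfl h1, ← Finset.sum_mul]
      change 𝒯.childMass y b * _ = _
      field_simp
    · rintro ⟨y, b⟩ _ ⟨z, c⟩ _ hne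
      rw [Function.onFun, Finset.disjoint_left]
      intro x hx hx'
      rw [mem_children] at hx hx'
      rw [hx] at hx'
      exact hne (List.cons.inj hx').1

/-- A policy that spreads the mass of the balanced transitions evenly over the tree. -/
theorem exists_balancedPolicy [Nonempty X] (𝒯 : InfoTree X A H) {a : ℕ}
    (hA : ∀ x, Fintype.card (A x) = a) (ha : 0 < a) :
    ∃ μ : Policy A, ∀ x b, (a : ℝ) ^ (H - ((𝒯.level x).1 + 1)) / totalActions A ≤
      𝒯.balanced x * 𝒯.plan μ x b := by
  have hA0 : ∀ x, 0 < Fintype.card (A x) := fun x => by rw [hA]; exact ha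
  have hN : (0 : ℝ) < totalActions A := Nat.cast_pos.2 (totalActions_pos hA0)
  -- The weight of an action counts the actions behind it and, through the `+ 1`, the action itself;
  -- the latter keeps the weight positive at the last step. The total is at most the size of the
  -- subtree.
  set Z : X → ℝ := fun x => ∑ b, (𝒯.childMass x b + 1) with hZ
  have hZpos : ∀ x, 0 < Z x := fun x => by
    have : Nonempty (A x) := Fintype.card_pos_iff.1 (hA0 x)
    exact Finset.sum_pos (fun b _ => by linarith [𝒯.childMass_nonneg x b]) Finset.univ_nonempty
  have hZle : ∀ x, Z x ≤ 𝒯.subtreeActions x := fun x => by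
    have := 𝒯.sum_children_subtreeActions_le x
    have h2 : ((Fintype.card (A x) + ∑ a, ∑ x' ∈ 𝒯.children x a, 𝒯.subtreeActions x' : ℕ) : ℝ) ≤
      𝒯.subtreeActions x := Nat.cast_le.2 this
    push_cast at h2
    simp only [hZ, Finset.sum_add_distrib, childMass, Finset.sum_const, Finset.card_univ,
      nsmul_eq_mul, mul_one]
    linarith
  let μ : Policy A := ⟨fun x b => (𝒯.childMass x b + 1) / Z x, fun x =>
    ⟨fun b => div_nonneg (by linarith [𝒯.childMass_nonneg x b]) (hZpos x).le, by
      rw [← Finset.sum_div]; exact div_self (hZpos x).ne'⟩⟩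
  have hμ : ∀ x b, μ.1 x b = (𝒯.childMass x b + 1) / Z x := fun _ _ => rfl
  have hstep : ∀ x b, (𝒯.childMass x b + 1) / totalActions A ≤
      (𝒯.subtreeActions x : ℝ) / totalActions A * μ.1 x b := fun x b => by
    rw [hμ, div_mul_div_comm, div_le_div_iff₀ hN (mul_pos hN (hZpos x))]
    have := mul_le_mul_of_nonneg_left (hZle x)
      (mul_nonneg (add_nonneg (𝒯.childMass_nonneg x b) zero_le_one) hN.le)
    nlinarith
  -- Invariant: mass reaches each information set at least in proportion to its subtree. The
  -- balanced step divides the mass behind an action among its successors in exactly these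
  -- proportions.
  have key : ∀ x, (𝒯.subtreeActions x : ℝ) / totalActions A ≤
      𝒯.balanced x * 𝒯.prefixPlan μ x := by
    refine 𝒯.hist_induction (fun x hx => ?_) (fun x y b hx ih => ?_)
    · rw [𝒯.balanced_root hx, 𝒯.prefixPlan_root μ hx, mul_one]
    · rw [𝒯.balanced_child hx, 𝒯.prefixPlan_child μ hx, plan_eq]
      have hx0 : (0 : ℝ) < 𝒯.subtreeActions x := Nat.cast_pos.2 (𝒯.subtreeActions_pos hA0 x)
      have hcm : 0 < 𝒯.childMass y b := hx0.trans_le (𝒯.subtreeActions_le_childMass hx)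
      have h1 := (hstep y b).trans (mul_le_mul_of_nonneg_right ih ((μ.2 y).1 b))
      have h2 : 𝒯.childMass y b / totalActions A ≤ (𝒯.childMass y b + 1) / totalActions A :=
        div_le_div_of_nonneg_right (by linarith) hN.le
      have h3 := mul_le_mul_of_nonneg_left (h2.trans h1) (div_pos hx0 hcm).le
      calc (𝒯.subtreeActions x : ℝ) / totalActions A
          = 𝒯.subtreeActions x / 𝒯.childMass y b * (𝒯.childMass y b / totalActions A) := by
            field_simp
        _ ≤ _ := h3
        _ = _ := by ring
  refine ⟨μ, fun x b => ?_⟩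
  have h1 := (hstep x b).trans (mul_le_mul_of_nonneg_right (key x) ((μ.2 x).1 b))
  rw [plan_eq, ← mul_assoc]
  refine le_trans (div_le_div_of_nonneg_right ?_ hN.le) h1
  have hlt := 𝒯.length_hist_lt x
  change (a : ℝ) ^ (H - ((𝒯.hist x).length + 1)) ≤ _
  rcases Nat.lt_or_ge ((𝒯.hist x).length + 1) H with hH | hH
  · obtain ⟨c, hc⟩ := 𝒯.children_nonempty b hH
    have hc := 𝒯.mem_children.1 hc
    have h2 := 𝒯.pow_le_subtreeActions hA c
    rw [hc, List.length_cons] at h2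
    have h3 : ((a ^ (H - ((𝒯.hist x).length + 1)) : ℕ) : ℝ) ≤ 𝒯.subtreeActions c :=
      Nat.cast_le.2 h2
    push_cast at h3
    linarith [𝒯.subtreeActions_le_childMass hc]
  · rw [Nat.sub_eq_zero_of_le hH, pow_zero]
    linarith [𝒯.childMass_nonneg x b]

end Balanced

end InfoTree

/-! ### Law of an episode and linearity of the value in the realization plan. -/

namespace Game

variable {S X Y : Type u} [Fintype S] {A : X → Type u} {B : Y → Type u} {H : ℕ}

theorem nonempty_infoX (G : Game S X Y A B H) : Nonempty X := by
  by_contra h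
  rw [not_nonempty_iff] at h
  have : IsEmpty S := Function.isEmpty G.infoX
  simpa using G.init_mem.2

theorem arrival_castSucc (G : Game S X Y A B H) {n : ℕ} (e : Fin (n + 1) → G.Node) (i : Fin n) :
    G.arrival e i.castSucc = G.arrival (Fin.init e) i := by
  obtain ⟨_ | k, hk⟩ := i <;> rfl

theorem arrival_nonneg (G : Game S X Y A B H) {n : ℕ} (e : Fin n → G.Node) (i : Fin n) :
    0 ≤ G.arrival e i := by
  obtain ⟨_ | k, hk⟩ := i
  · exact G.init_mem.1 _
  · exact (G.trans_mem _ _ _ _).1 _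

/-- Treats the initial draw and the later transitions alike: either way the new state has a law
determined by the past. -/
theorem exists_arrival_last (G : Game S X Y A B H) {n : ℕ} (e : Fin n → G.Node) :
    ∃ f ∈ stdSimplex ℝ S,
      ∀ z, G.arrival (Fin.snoc e z : Fin (n + 1) → G.Node) (Fin.last n) = f z.1 := by
  cases n with
  | zero => exact ⟨G.init, G.init_mem, fun z => rfl⟩
  | succ k =>
    refine ⟨_, G.trans_mem k (e (Fin.last k)).1 (e (Fin.last k)).2.1 (e (Fin.last k)).2.2,
      fun z => ?_⟩
    have h1 : (Fin.snoc e z : Fin (k + 2) → G.Node) ⟨k, by omega⟩ = e (Fin.last k) :=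
      Fin.snoc_castSucc (α := fun _ => G.Node) _ _ (Fin.last k)
    have h2 : (Fin.snoc e z : Fin (k + 2) → G.Node) ⟨k + 1, by omega⟩ = z :=
      Fin.snoc_last (α := fun _ => G.Node) _ _
    change G.trans k (Fin.snoc (α := fun _ => G.Node) e z ⟨k, by omega⟩).1 _ _
      (Fin.snoc (α := fun _ => G.Node) e z ⟨k + 1, by omega⟩).1 = _
    rw [h1, h2]

/-- The information set and the action of the max-player. -/
def pairX (G : Game S X Y A B H) (z : G.Node) : Σ x, A x := ⟨G.infoX z.1, z.2.1⟩

/-- The information set and the action of the min-player. -/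
def pairY (G : Game S X Y A B H) (z : G.Node) : Σ y, B y := ⟨G.infoY z.1, z.2.2⟩

/-- The loss of the max-player at step `h`. -/
def lossX (G : Game S X Y A B H) (h : ℕ) (z : G.Node) : ℝ := 1 - G.reward h z.1 z.2.1 z.2.2

theorem lossX_nonneg (G : Game S X Y A B H) (h : ℕ) (z : G.Node) : 0 ≤ G.lossX h z :=
  sub_nonneg.2 (G.reward_mem _ _ _ _).2

theorem lossX_le_one (G : Game S X Y A B H) (h : ℕ) (z : G.Node) : G.lossX h z ≤ 1 :=
  sub_le_self _ (G.reward_mem _ _ _ _).1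

variable [∀ x, Fintype (A x)] [∀ y, Fintype (B y)]

theorem prob_eq (G : Game S X Y A B H) (μ : Policy A) (ν : Policy B) {n : ℕ}
    (e : Fin n → G.Node) : G.prob μ ν e = ∏ h, G.arrival e h *
      (μ.1 (G.pairX (e h)).1 (G.pairX (e h)).2 * ν.1 (G.pairY (e h)).1 (G.pairY (e h)).2) := rfl

theorem prob_nonneg (G : Game S X Y A B H) (μ : Policy A) (ν : Policy B) {n : ℕ}
    (e : Fin n → G.Node) : 0 ≤ G.prob μ ν e :=
  Finset.prod_nonneg fun i _ => mul_nonneg (G.arrival_nonneg e i)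
    (mul_nonneg ((μ.2 _).1 _) ((ν.2 _).1 _))

theorem prob_snoc (G : Game S X Y A B H) (μ : Policy A) (ν : Policy B) {n : ℕ}
    (e : Fin n → G.Node) (z : G.Node) :
    G.prob μ ν (Fin.snoc e z : Fin (n + 1) → G.Node) = G.prob μ ν e *
      (G.arrival (Fin.snoc e z : Fin (n + 1) → G.Node) (Fin.last n) *
        (μ.1 (G.infoX z.1) z.2.1 * ν.1 (G.infoY z.1) z.2.2)) := by
  obtain ⟨w, hw⟩ : ∃ w : G.Node → ℝ,
      ∀ z, w z = μ.1 (G.infoX z.1) z.2.1 * ν.1 (G.infoY z.1) z.2.2 := ⟨_, fun _ => rfl⟩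
  simp_rw [prob, ← hw]
  rw [Fin.prod_univ_castSucc]
  simp only [arrival_castSucc, Fin.init_snoc, Fin.snoc_castSucc, Fin.snoc_last]

theorem sum_prob_snoc (G : Game S X Y A B H) (μ : Policy A) (ν : Policy B) {n : ℕ}
    (e : Fin n → G.Node) :
    ∑ z, G.prob μ ν (Fin.snoc e z : Fin (n + 1) → G.Node) = G.prob μ ν e := by
  obtain ⟨f, hf, hfe⟩ := G.exists_arrival_last e
  simp_rw [prob_snoc, hfe]
  rw [← Finset.mul_sum, Fintype.sum_sigma]
  have : ∀ s, ∑ p : A (G.infoX s) × B (G.infoY s),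
      f s * (μ.1 (G.infoX s) p.1 * ν.1 (G.infoY s) p.2) = f s := fun s => by
    rw [← Finset.mul_sum, Fintype.sum_prod_type]
    simp_rw [← Finset.mul_sum, (ν.2 _).2, mul_one, (μ.2 _).2, mul_one]
  simp_rw [this]
  rw [hf.2, mul_one]

/-- The law of the first `m` steps is a marginal of the law of the first `n` steps. -/
theorem sum_prob_restrict (G : Game S X Y A B H) (μ : Policy A) (ν : Policy B) {m n : ℕ}
    (hmn : m ≤ n) (f : (Fin m → G.Node) → ℝ) :
    ∑ e : Fin n → G.Node, G.prob μ ν e * f (fun i => e (Fin.castLE hmn i)) =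
      ∑ e : Fin m → G.Node, G.prob μ ν e * f e := by
  induction n, hmn using Nat.le_induction with
  | base => rfl
  | succ n hmn ih =>
    rw [← ih, ← (Fin.snocEquiv fun _ => G.Node).sum_comp, Fintype.sum_prod_type_right]
    refine Finset.sum_congr rfl fun e _ => ?_
    rw [← G.sum_prob_snoc μ ν e, Finset.sum_mul]
    refine Finset.sum_congr rfl fun z _ => ?_
    have h : (fun i : Fin m => (Fin.snoc e z : Fin (n + 1) → G.Node)
        (Fin.castLE (hmn.trans n.le_succ) i)) = fun i => e (Fin.castLE hmn i) := by
      funext i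
      exact Fin.snoc_castSucc (α := fun _ => G.Node) _ _ (Fin.castLE hmn i)
    change G.prob μ ν (Fin.snoc e z : Fin (n + 1) → G.Node) * f (fun i : Fin m =>
      (Fin.snoc e z : Fin (n + 1) → G.Node) (Fin.castLE (hmn.trans n.le_succ) i)) = _
    rw [h]

theorem sum_prob (G : Game S X Y A B H) (μ : Policy A) (ν : Policy B) (n : ℕ) :
    ∑ e : Fin n → G.Node, G.prob μ ν e = 1 := by
  have := G.sum_prob_restrict μ ν (Nat.zero_le n) fun _ => 1
  simpa [prob] using this

/-- The part of the probability of `e` that does not depend on the policy of the max-player. -/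
noncomputable def opponentProb (G : Game S X Y A B H) (ν : Policy B) {n : ℕ}
    (e : Fin n → G.Node) : ℝ :=
  ∏ h, G.arrival e h * ν.1 (G.pairY (e h)).1 (G.pairY (e h)).2

omit [∀ x, Fintype (A x)] in
theorem opponentProb_nonneg (G : Game S X Y A B H) (ν : Policy B) {n : ℕ}
    (e : Fin n → G.Node) : 0 ≤ G.opponentProb ν e :=
  Finset.prod_nonneg fun i _ => mul_nonneg (G.arrival_nonneg e i) ((ν.2 _).1 _)

theorem prob_eq_opponentProb_mul (G : Game S X Y A B H) (μ : Policy A) (ν : Policy B) {n : ℕ}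
    (e : Fin n → G.Node) : G.prob μ ν e =
      G.opponentProb ν e * ∏ h, μ.1 (G.pairX (e h)).1 (G.pairX (e h)).2 := by
  rw [prob_eq, opponentProb, ← Finset.prod_mul_distrib]
  exact Finset.prod_congr rfl fun _ _ => by ring

/-- Only chance and the opponent need to give `e` positive weight. The history found is therefore
the same for every policy `μ` of the max-player, including those that never play along `e`. -/
theorem exists_reach_of_opponentProb_ne_zero (G : Game S X Y A B H) (ν : Policy B) {n : ℕ}
    (hn : n < H) (e : Fin (n + 1) → G.Node) (he : G.opponentProb ν e ≠ 0) :
    ∃ lX lY, lX.length = n ∧ G.toGameForm.Reach H lX lY (e (Fin.last n)).1 ∧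
      ∀ μ : Policy A, (lX.map fun q => μ.1 q.1 q.2).prod *
        μ.1 (G.pairX (e (Fin.last n))).1 (G.pairX (e (Fin.last n))).2 =
          ∏ h, μ.1 (G.pairX (e h)).1 (G.pairX (e h)).2 := by
  induction n with
  | zero =>
    refine ⟨[], [], rfl, .start _ ?_, fun μ => by simp⟩
    have := Finset.prod_ne_zero_iff.1 he 0 (Finset.mem_univ _)
    exact lt_of_le_of_ne (G.init_mem.1 _) (left_ne_zero_of_mul this).symm
  | succ n ih =>
    have hlast := left_ne_zero_of_mul (Finset.prod_ne_zero_iff.1 he (Fin.last _)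
      (Finset.mem_univ _))
    have hinit : G.opponentProb ν (Fin.init e) ≠ 0 := by
      rw [opponentProb, Fin.prod_univ_castSucc] at he
      simp only [arrival_castSucc] at he
      exact left_ne_zero_of_mul he
    obtain ⟨lX, lY, hl, hr, hμ⟩ := ih (by omega) (Fin.init e) hinit
    refine ⟨_, _, ?_, .step lX lY _ (Fin.init e (Fin.last n)).2.1 (Fin.init e (Fin.last n)).2.2
      (e (Fin.last _)).1 hr (by omega) ?_, fun μ => ?_⟩
    · simp [hl]
    · rw [hl]
      exact lt_of_le_of_ne ((G.trans_mem _ _ _ _).1 _) (Ne.symm hlast)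
    · have h1 := hμ μ
      rw [Fin.prod_univ_castSucc (n := n + 1), List.map_cons, List.prod_cons]
      congr 1
      rw [mul_comm]
      exact h1

/-- Perfect recall, in terms of realization plans. -/
theorem recall_of_opponentProb_ne_zero (G : Game S X Y A B H) (ν : Policy B) {n : ℕ}
    (hn : n < H) (e : Fin (n + 1) → G.Node) (he : G.opponentProb ν e ≠ 0) :
    (G.treeX.level (G.pairX (e (Fin.last n))).1).1 = n ∧
      ∀ μ, G.treeX.plan μ (G.pairX (e (Fin.last n))).1 (G.pairX (e (Fin.last n))).2 =
        ∏ h, μ.1 (G.pairX (e h)).1 (G.pairX (e h)).2 := by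
  obtain ⟨lX, lY, hl, hr, hμ⟩ := G.exists_reach_of_opponentProb_ne_zero ν hn e he
  have hX : G.treeX.hist (G.pairX (e (Fin.last n))).1 = lX := G.recallX _ _ _ hr
  exact ⟨(congrArg List.length hX).trans hl, fun μ => by rw [← hμ, ← hX]; rfl⟩

open Classical in
/-- Expected loss attached to `(x, a)`, up to the realization plan of the max-player. -/
noncomputable def lossVec (G : Game S X Y A B H) (ν : Policy B) (x : X) (a : A x) : ℝ :=
  ∑ e : Fin ((G.treeX.level x).1 + 1) → G.Node,
    if G.pairX (e (Fin.last _)) = ⟨x, a⟩ then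
      G.opponentProb ν e * G.lossX (G.treeX.level x) (e (Fin.last _)) else 0

theorem lossVec_nonneg (G : Game S X Y A B H) (ν : Policy B) (x : X) (a : A x) :
    0 ≤ G.lossVec ν x a :=
  Finset.sum_nonneg fun e _ => by
    split_ifs
    · exact mul_nonneg (G.opponentProb_nonneg ν e) (G.lossX_nonneg _ _)
    · exact le_rfl

open Classical in
-- After marginalizing to the steps up to that of `x`, perfect recall makes the max-player's factor
-- the same on all contributing trajectories, namely the plan at `(x, a)`, so it comes out of the
-- sum.
theorem sum_prob_mul_lossX (G : Game S X Y A B H) (μ : Policy A) (ν : Policy B) (x : X)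
    (a : A x) :
    ∑ e : Fin H → G.Node, G.prob μ ν e * (if G.pairX (e (G.treeX.level x)) = ⟨x, a⟩ then
      G.lossX (G.treeX.level x) (e (G.treeX.level x)) else 0) =
      G.treeX.plan μ x a * G.lossVec ν x a := by
  have h := G.sum_prob_restrict μ ν (Nat.succ_le_of_lt (G.treeX.level x).2)
    fun e => if G.pairX (e (Fin.last _)) = ⟨x, a⟩ then
      G.lossX (G.treeX.level x) (e (Fin.last _)) else 0
  refine h.trans ?_
  rw [lossVec, Finset.mul_sum]
  refine Finset.sum_congr rfl fun e _ => ?_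
  split_ifs with hp
  · by_cases h0 : G.opponentProb ν e = 0
    · rw [prob_eq_opponentProb_mul, h0]; simp
    · have h1 := (G.recall_of_opponentProb_ne_zero ν (G.treeX.level x).2 e h0).2 μ
      rw [hp] at h1
      rw [prob_eq_opponentProb_mul, h1]
      ring
  · simp

/-- Reconciles the step read off the tree with the time index of the trajectory, so that looking at
`e` at the level of `x` is enough to know whether `x` is visited. -/
theorem level_of_prob_ne_zero (G : Game S X Y A B H) (μ : Policy A) (ν : Policy B)
    (e : Fin H → G.Node) (he : G.prob μ ν e ≠ 0) (h : Fin H) :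
    G.treeX.level (G.pairX (e h)).1 = h := by
  have hne : ∀ (m n : ℕ) (hmn : m ≤ n) (e : Fin n → G.Node), G.opponentProb ν e ≠ 0 →
      G.opponentProb ν (fun i => e (Fin.castLE hmn i)) ≠ 0 := by
    intro m n hmn e he
    refine Finset.prod_ne_zero_iff.2 fun i _ => ?_
    have := Finset.prod_ne_zero_iff.1 he (Fin.castLE hmn i) (Finset.mem_univ _)
    convert this using 2
    obtain ⟨_ | k, hk⟩ := i <;> rfl
  rw [prob_eq_opponentProb_mul] at he
  have := (G.recall_of_opponentProb_ne_zero ν h.2 _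
    (hne (h.1 + 1) H (Nat.succ_le_of_lt h.2) e (left_ne_zero_of_mul he))).1
  exact Fin.ext this

variable [Fintype X]

omit [∀ y, Fintype (B y)] in
open Classical in
/-- At each step, exactly one pair (information set, action) is visited. -/
theorem sum_level_ite_pairX (G : Game S X Y A B H) (e : Fin H → G.Node) (h : Fin H)
    (he : G.treeX.level (G.pairX (e h)).1 = h) (f : (x : X) → A x → ℝ) :
    ∑ x with G.treeX.level x = h, ∑ a,
      (if G.pairX (e (G.treeX.level x)) = ⟨x, a⟩ then f x a else 0) =
      f (G.pairX (e h)).1 (G.pairX (e h)).2 := by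
  have h1 : ∀ x ∈ Finset.univ.filter (fun x => G.treeX.level x = h), ∑ a,
      (if G.pairX (e (G.treeX.level x)) = ⟨x, a⟩ then f x a else 0) =
      ∑ a, (if G.pairX (e h) = ⟨x, a⟩ then f x a else 0) := fun x hx => by
    rw [(Finset.mem_filter.1 hx).2]
  rw [Finset.sum_congr rfl h1]
  generalize G.pairX (e h) = p at he ⊢
  obtain ⟨y, b⟩ := p
  rw [Finset.sum_eq_single y, Finset.sum_eq_single b]
  · simp
  · intro c _ hc
    rw [if_neg]
    intro hh
    simp only [Sigma.mk.injEq, heq_eq_eq, true_and] at hh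
    exact hc hh.symm
  · simp
  · intro z _ hz
    refine Finset.sum_eq_zero fun c _ => if_neg fun hh => hz ?_
    exact (congrArg Sigma.fst hh).symm
  · intro hy
    exact absurd (Finset.mem_filter.2 ⟨Finset.mem_univ y, he⟩) hy

open Classical in
theorem sum_level_plan_mul_lossVec (G : Game S X Y A B H) (μ : Policy A) (ν : Policy B)
    (h : Fin H) :
    ∑ x with G.treeX.level x = h, ∑ a, G.treeX.plan μ x a * G.lossVec ν x a =
      ∑ e : Fin H → G.Node, G.prob μ ν e * G.lossX h (e h) := by
  simp_rw [← sum_prob_mul_lossX]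
  rw [Finset.sum_congr rfl fun x _ => Finset.sum_comm, Finset.sum_comm]
  refine Finset.sum_congr rfl fun e _ => ?_
  simp_rw [← Finset.mul_sum]
  by_cases he : G.prob μ ν e = 0
  · simp [he]
  · have hl := G.level_of_prob_ne_zero μ ν e he h
    rw [G.sum_level_ite_pairX e h hl fun x _ => G.lossX (G.treeX.level x) (e (G.treeX.level x)),
      hl]

/-- Reduces the game to linear losses on plans: `lossVec` does not depend on `μ`. -/
theorem sum_plan_mul_lossVec (G : Game S X Y A B H) (μ : Policy A) (ν : Policy B) :
    ∑ x, ∑ a, G.treeX.plan μ x a * G.lossVec ν x a = H - G.value μ ν := by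
  classical
  rw [← Finset.sum_fiberwise (g := G.treeX.level)]
  simp_rw [sum_level_plan_mul_lossVec]
  rw [Finset.sum_comm, value]
  have : ∀ e : Fin H → G.Node, ∑ h : Fin H, G.prob μ ν e * G.lossX h (e h) =
      G.prob μ ν e * H - G.prob μ ν e *
        ∑ h : Fin H, G.reward h (e h).1 (e h).2.1 (e h).2.2 := fun e => by
    rw [← Finset.mul_sum, ← mul_sub]
    simp [lossX]
  simp_rw [this]
  rw [Finset.sum_sub_distrib, ← Finset.sum_mul, sum_prob, one_mul]

open Classical in
theorem sum_level_plan_mul_lossVec_le_one (G : Game S X Y A B H) (μ : Policy A) (ν : Policy B)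
    (h : Fin H) :
    ∑ x with G.treeX.level x = h, ∑ a, G.treeX.plan μ x a * G.lossVec ν x a ≤ 1 := by
  rw [sum_level_plan_mul_lossVec, ← G.sum_prob μ ν H]
  exact Finset.sum_le_sum fun e _ =>
    mul_le_of_le_one_right (G.prob_nonneg μ ν e) (G.lossX_le_one _ _)

open Classical in
/-- Under the balanced transitions, the losses cannot concentrate on a part of the tree. -/
theorem sum_level_lossVec_div_balanced_le (G : Game S X Y A B H) (ν : Policy B) {a : ℕ}
    (hA : ∀ x, Fintype.card (A x) = a) (ha : 0 < a) (h : Fin H) :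
    ∑ x with G.treeX.level x = h, ∑ b, G.lossVec ν x b / G.treeX.balanced x ≤
      totalActions A / (a : ℝ) ^ (H - (h.1 + 1)) := by
  have := G.nonempty_infoX
  have hA0 : ∀ x, 0 < Fintype.card (A x) := fun x => by rw [hA]; exact ha
  have hN : (0 : ℝ) < totalActions A := Nat.cast_pos.2 (InfoTree.totalActions_pos hA0)
  -- For this policy `1 / p⋆ ≤ (N / a^(H-h)) μ_{1:h}` at each pair, so the weighted sum is dominated
  -- by a multiple of an expected loss, itself at most one.
  obtain ⟨μ, hμ⟩ := G.treeX.exists_balancedPolicy hA ha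
  have hD : (0 : ℝ) < (a : ℝ) ^ (H - (h.1 + 1)) := pow_pos (Nat.cast_pos.2 ha) _
  refine le_trans ?_ (mul_le_of_le_one_right (div_pos hN hD).le
    (G.sum_level_plan_mul_lossVec_le_one μ ν h))
  rw [Finset.mul_sum]
  refine Finset.sum_le_sum fun x hx => ?_
  rw [Finset.mul_sum]
  refine Finset.sum_le_sum fun b _ => ?_
  have h1 := hμ x b
  rw [(Finset.mem_filter.1 hx).2] at h1
  have hp := G.treeX.balanced_pos hA0 x
  rw [div_le_iff₀ hN] at h1
  rw [div_mul_eq_mul_div, div_le_div_iff₀ hp hD]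
  have := mul_le_mul_of_nonneg_left h1 (G.lossVec_nonneg ν x b)
  linarith

end Game

/-! ### Exchanging the roles of the players. -/

section Swap

variable {S X Y : Type u} [Fintype S] {A : X → Type u} {B : Y → Type u} {H : ℕ}

/-- The game in which the two players exchange their roles. -/
def GameForm.swap (G : GameForm S X Y A B) : GameForm S Y X B A where
  infoX := G.infoY
  infoY := G.infoX
  infoX_surjective := G.infoY_surjective
  infoY_surjective := G.infoX_surjective
  init := G.init
  init_mem := G.init_mem
  trans h s b a := G.trans h s a b
  trans_mem h s b a := G.trans_mem h s a b
  -- `1 - r` rather than `-r` keeps rewards in `[0, 1]` and turns the loss into `r`, as the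
  -- min-player's version requires; values become `H - V`, and the constant cancels in regrets.
  reward h s b a := 1 - G.reward h s a b
  reward_mem h s b a := by
    have := G.reward_mem h s a b
    exact ⟨sub_nonneg.2 this.2, sub_le_self _ this.1⟩

theorem GameForm.Reach.length_eq {G : GameForm S X Y A B} {lX : List (Σ x, A x)}
    {lY : List (Σ y, B y)} {s : S} (h : G.Reach H lX lY s) : lX.length = lY.length := by
  induction h with
  | start => rfl
  | step lX lY s a b s' _ _ _ ih => simp [ih]

theorem GameForm.Reach.swap {G : GameForm S X Y A B} {lX : List (Σ x, A x)}
    {lY : List (Σ y, B y)} {s : S} (h : G.swap.Reach H lY lX s) : G.Reach H lX lY s := by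
  induction h with
  | start s hs => exact .start s hs
  | step lY lX s b a s' h hl ht ih =>
    have := h.length_eq
    exact .step lX lY s a b s' ih (by omega) (by rw [← this]; exact ht)

namespace Game

/-- The game in which the two players exchange their roles. -/
def swap (G : Game S X Y A B H) : Game S Y X B A H where
  toGameForm := G.toGameForm.swap
  treeX := G.treeY
  treeY := G.treeX
  recallX lY lX s h := G.recallY lX lY s (GameForm.Reach.swap h)
  recallY lY lX s h := G.recallX lX lY s (GameForm.Reach.swap h)

/-- Trajectories of the game and of the game with exchanged roles. -/
def swapEpisode (G : Game S X Y A B H) (n : ℕ) : (Fin n → G.Node) ≃ (Fin n → G.swap.Node) :=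
  Equiv.arrowCongr (Equiv.refl _) (Equiv.sigmaCongrRight fun _ => Equiv.prodComm _ _)

theorem arrival_swap (G : Game S X Y A B H) {n : ℕ} (e : Fin n → G.Node) (i : Fin n) :
    G.swap.arrival (G.swapEpisode n e) i = G.arrival e i := by
  obtain ⟨_ | k, hk⟩ := i <;> rfl

theorem observedX_swap (G : Game S X Y A B H) (e : Fin H → G.Node) :
    G.swap.observedX (G.swapEpisode H e) = G.observedY e := by
  funext h
  exact Prod.ext rfl (sub_sub_cancel _ _)

variable [∀ x, Fintype (A x)] [∀ y, Fintype (B y)]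

theorem prob_swap (G : Game S X Y A B H) (μ : Policy A) (ν : Policy B) {n : ℕ}
    (e : Fin n → G.Node) : G.swap.prob ν μ (G.swapEpisode n e) = G.prob μ ν e := by
  unfold prob
  simp_rw [arrival_swap]
  refine Finset.prod_congr rfl fun i _ => ?_
  congr 1
  exact mul_comm _ _

theorem value_swap (G : Game S X Y A B H) (μ : Policy A) (ν : Policy B) :
    G.swap.value ν μ = H - G.value μ ν := by
  rw [value, ← (G.swapEpisode H).sum_comp, value]
  simp_rw [prob_swap]
  rw [eq_sub_iff_add_eq, ← Finset.sum_add_distrib, ← mul_one (H : ℝ), ← G.sum_prob μ ν H,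
    Finset.mul_sum]
  refine Finset.sum_congr rfl fun e _ => ?_
  rw [← mul_add, ← Finset.sum_add_distrib, mul_comm]
  congr 1
  have : ∀ h : Fin H, G.swap.reward h (G.swapEpisode H e h).1 (G.swapEpisode H e h).2.1
      (G.swapEpisode H e h).2.2 + G.reward h (e h).1 (e h).2.1 (e h).2.2 = 1 :=
    fun h => sub_add_cancel _ _
  simp_rw [this]
  simp

/-- The same episodes, in the game with exchanged roles. -/
def Interaction.swap {G : Game S X Y A B H} {T : ℕ} {Ω : Type v} [MeasurableSpace Ω]
    {P : Measure Ω} (I : G.Interaction T P) : G.swap.Interaction T P where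
  ℱ := I.ℱ
  μ := I.ν
  ν := I.μ
  τ t ω := G.swapEpisode H (I.τ t ω)
  measurable_μ := I.measurable_ν
  measurable_ν := I.measurable_μ
  measurable_τ t ht e := by
    simp_rw [← Equiv.eq_symm_apply]
    exact I.measurable_τ t ht _
  law_τ t ht e := by
    have := I.law_τ t ht ((G.swapEpisode H).symm e)
    simp_rw [← Equiv.eq_symm_apply]
    refine this.trans (Filter.Eventually.of_forall fun ω => ?_)
    change G.prob _ _ _ = G.swap.prob _ _ _
    rw [← prob_swap, Equiv.apply_symm_apply]

end Game

end Swap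

/-! ### Exponential supermartingales along the episodes. -/

namespace Game.Interaction

variable {S X Y : Type u} [Fintype S] {A : X → Type u} {B : Y → Type u} {H : ℕ}
  [∀ x, Fintype (A x)] [∀ y, Fintype (B y)] {G : Game S X Y A B H} {T : ℕ}
  {Ω : Type v} [mΩ : MeasurableSpace Ω] {P : Measure Ω}

theorem measurable_prob (I : G.Interaction T P) {t : ℕ} (ht : t < T) {n : ℕ}
    (e : Fin n → G.Node) : Measurable[I.ℱ t] fun ω => G.prob (I.μ t ω) (I.ν t ω) e := by
  unfold prob
  refine Finset.measurable_fun_prod _ fun i _ => ?_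
  exact ((I.measurable_μ t ht _ _).mul (I.measurable_ν t ht _ _)).const_mul _

variable [IsProbabilityMeasure P]

/-- The conditional law of the episode in a form that needs no integrability of `f`: restricting `P`
to the event and weighting it by the conditional probability give the same measure on `ℱ t`. -/
theorem lintegral_restrict_τ (I : G.Interaction T P) {t : ℕ} (ht : t < T) (e : Fin H → G.Node)
    {f : Ω → ENNReal} (hf : Measurable[I.ℱ t] f) :
    ∫⁻ ω in {ω | I.τ t ω = e}, f ω ∂P =
      ∫⁻ ω, ENNReal.ofReal (G.prob (I.μ t ω) (I.ν t ω) e) * f ω ∂P := by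
  have hm := I.ℱ.le t
  have hp := I.measurable_prob ht e
  have hp' : Measurable fun ω => ENNReal.ofReal (G.prob (I.μ t ω) (I.ν t ω) e) :=
    (hp.mono hm le_rfl).ennreal_ofReal
  have hτ : MeasurableSet {ω | I.τ t ω = e} := I.ℱ.le _ _ (I.measurable_τ t ht e)
  rw [← lintegral_trim hm hf]
  have heq : (P.restrict {ω | I.τ t ω = e}).trim hm =
      (P.withDensity fun ω => ENNReal.ofReal (G.prob (I.μ t ω) (I.ν t ω) e)).trim hm := by
    refine @Measure.ext _ (I.ℱ t) _ _ fun s hs => ?_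
    rw [trim_measurableSet_eq hm hs, trim_measurableSet_eq hm hs, Measure.restrict_apply (hm s hs),
      withDensity_apply _ (hm s hs)]
    have hint : Integrable ({ω | I.τ t ω = e}.indicator fun _ => (1 : ℝ)) P :=
      (integrable_const 1).indicator hτ
    have h1 := setIntegral_condExp hm hint hs
    have h2 : ∫ ω in s, G.prob (I.μ t ω) (I.ν t ω) e ∂P = P.real (s ∩ {ω | I.τ t ω = e}) := by
      rw [← setIntegral_congr_ae (g := fun ω => G.prob (I.μ t ω) (I.ν t ω) e) (hm s hs)
        ((I.law_τ t ht e).mono fun ω h _ => h)]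
      rw [h1, setIntegral_indicator hτ]
      simp
    rw [← ofReal_integral_eq_lintegral_ofReal, h2, ofReal_measureReal]
    · refine Integrable.integrableOn ?_
      exact (integrable_condExp (m := I.ℱ t)).congr (I.law_τ t ht e)
    · exact Filter.Eventually.of_forall fun ω => G.prob_nonneg _ _ _
  rw [heq, lintegral_trim hm hf, lintegral_withDensity_eq_lintegral_mul _ hp'
    (hf.mono hm le_rfl)]
  rfl

/-- An exponential supermartingale inequality for the successive episodes. -/
theorem lintegral_exp_sum_le_one (I : G.Interaction T P) {g : ℕ → Ω → (Fin H → G.Node) → ℝ}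
    (hg : ∀ t < T, ∀ e, Measurable[I.ℱ t] fun ω => g t ω e)
    (hexp : ∀ t < T, ∀ ω, ∑ e, G.prob (I.μ t ω) (I.ν t ω) e * Real.exp (g t ω e) ≤ 1) :
    ∀ n ≤ T, (Measurable[I.ℱ n] fun ω => ∑ t ∈ Finset.range n, g t ω (I.τ t ω)) ∧
      ∫⁻ ω, ENNReal.ofReal (Real.exp (∑ t ∈ Finset.range n, g t ω (I.τ t ω))) ∂P ≤ 1 := by
  classical
  intro n
  induction n with
  | zero => intro _; simp
  | succ n ih =>
    intro hn
    obtain ⟨hmeas, hle⟩ := ih (by omega)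
    have hgn := fun e => hg n (by omega) e
    have hsum : ∀ f : (Fin H → G.Node) → ℝ, ∀ ω, f (I.τ n ω) =
        ∑ e, {ω | I.τ n ω = e}.indicator (fun _ => f e) ω := fun f ω => by
      simp [Set.indicator_apply]
    constructor
    · have hF := I.ℱ.mono n.le_succ
      simp_rw [Finset.sum_range_succ]
      refine (hmeas.mono hF le_rfl).add ?_
      have : (fun ω => g n ω (I.τ n ω)) =
          fun ω => ∑ e, {ω | I.τ n ω = e}.indicator (fun ω => g n ω e) ω := by
        funext ω
        rw [hsum (g n ω)]
        rfl
      rw [this]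
      exact Finset.measurable_fun_sum _ fun e _ =>
        ((hgn e).mono hF le_rfl).indicator (I.measurable_τ n (by omega) e)
    · set M : Ω → ENNReal :=
        fun ω => ENNReal.ofReal (Real.exp (∑ t ∈ Finset.range n, g t ω (I.τ t ω))) with hM
      have hMm : Measurable[I.ℱ n] M := hmeas.exp.ennreal_ofReal
      have hEm : ∀ e, Measurable[I.ℱ n] fun ω => M ω * ENNReal.ofReal (Real.exp (g n ω e)) :=
        fun e => hMm.mul (hgn e).exp.ennreal_ofReal
      -- An episode takes finitely many values; on each of them the integrand is `ℱ n`-measurable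
      -- and the conditional law applies.
      have h1 : ∀ ω, ENNReal.ofReal (Real.exp (∑ t ∈ Finset.range (n + 1), g t ω (I.τ t ω))) =
          ∑ e, {ω | I.τ n ω = e}.indicator
            (fun ω => M ω * ENNReal.ofReal (Real.exp (g n ω e))) ω := by
        intro ω
        rw [Finset.sum_range_succ, Real.exp_add, ENNReal.ofReal_mul (Real.exp_pos _).le]
        simp [Set.indicator_apply, hM]
      have hτ : ∀ e, MeasurableSet {ω | I.τ n ω = e} := fun e =>
        I.ℱ.le _ _ (I.measurable_τ n (by omega) e)
      simp_rw [h1]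
      rw [lintegral_finsetSum _ fun e _ => ((hEm e).mono (I.ℱ.le n) le_rfl).indicator (hτ e)]
      simp_rw [lintegral_indicator (hτ _), I.lintegral_restrict_τ (show n < T by omega) _ (hEm _)]
      have hpm : ∀ e, Measurable fun ω => ENNReal.ofReal (G.prob (I.μ n ω) (I.ν n ω) e) *
          (M ω * ENNReal.ofReal (Real.exp (g n ω e))) := fun e =>
        (((I.measurable_prob (show n < T by omega) e).mono (I.ℱ.le n) le_rfl).ennreal_ofReal).mul
          ((hEm e).mono (I.ℱ.le n) le_rfl)
      rw [← lintegral_finsetSum _ fun e _ => hpm e]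
      refine le_trans (lintegral_mono fun ω => ?_) hle
      have h2 : ∀ e, ENNReal.ofReal (G.prob (I.μ n ω) (I.ν n ω) e) *
          (M ω * ENNReal.ofReal (Real.exp (g n ω e))) =
          M ω * ENNReal.ofReal (G.prob (I.μ n ω) (I.ν n ω) e * Real.exp (g n ω e)) := fun e => by
        rw [ENNReal.ofReal_mul (G.prob_nonneg _ _ _)]; ring
      simp_rw [h2]
      rw [← Finset.mul_sum, ← ENNReal.ofReal_sum_of_nonneg fun e _ =>
        mul_nonneg (G.prob_nonneg _ _ _) (Real.exp_pos _).le]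
      exact mul_le_of_le_one_right zero_le (ENNReal.ofReal_le_one.2 (hexp n (by omega) ω))

/-- Markov's inequality for the exponential of the sum. -/
theorem measure_le_sum_le (I : G.Interaction T P) {g : ℕ → Ω → (Fin H → G.Node) → ℝ}
    (hg : ∀ t < T, ∀ e, Measurable[I.ℱ t] fun ω => g t ω e)
    (hexp : ∀ t < T, ∀ ω, ∑ e, G.prob (I.μ t ω) (I.ν t ω) e * Real.exp (g t ω e) ≤ 1) (J : ℝ) :
    P {ω | J ≤ ∑ t ∈ Finset.range T, g t ω (I.τ t ω)} ≤ ENNReal.ofReal (Real.exp (-J)) := by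
  obtain ⟨hm, hle⟩ := I.lintegral_exp_sum_le_one hg hexp T le_rfl
  have h := mul_meas_ge_le_lintegral (μ := P) ((hm.mono (I.ℱ.le T) le_rfl).exp.ennreal_ofReal)
    (ENNReal.ofReal (Real.exp J))
  have hset : {ω | J ≤ ∑ t ∈ Finset.range T, g t ω (I.τ t ω)} =
      {ω | ENNReal.ofReal (Real.exp J) ≤
        ENNReal.ofReal (Real.exp (∑ t ∈ Finset.range T, g t ω (I.τ t ω)))} := by
    ext ω
    simp only [Set.mem_ofPred_eq]
    rw [ENNReal.ofReal_le_ofReal_iff (Real.exp_pos _).le, Real.exp_le_exp]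
  rw [hset, Real.exp_neg, ENNReal.ofReal_inv_of_pos (Real.exp_pos _)]
  rw [ENNReal.le_inv_iff_mul_le, mul_comm]
  exact h.trans hle

end Game.Interaction

/-! ### The algorithm as entropic FTRL over realization plans. -/

namespace InfoTree

variable {X : Type u} {A : X → Type u} {H : ℕ} [∀ x, Fintype (A x)]

/-- Uniform play supplies the interior point that the barrier argument requires. -/
theorem exists_plan_pos (𝒯 : InfoTree X A H) (hA : ∀ x, 0 < Fintype.card (A x)) :
    ∃ μ : Policy A, ∀ x a, 0 < 𝒯.plan μ x a := by
  have hpos : ∀ x, (0 : ℝ) < (Fintype.card (A x) : ℝ)⁻¹ := fun x =>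
    inv_pos.2 (Nat.cast_pos.2 (hA x))
  let μ : Policy A := ⟨fun x _ => (Fintype.card (A x) : ℝ)⁻¹, fun x => ⟨fun _ => (hpos x).le, by
    rw [Finset.sum_const, Finset.card_univ, nsmul_eq_mul,
      mul_inv_cancel₀ (Nat.cast_ne_zero.2 (hA x).ne')]⟩⟩
  refine ⟨μ, fun x a => ?_⟩
  have hp : ∀ x, 0 < 𝒯.prefixPlan μ x := by
    refine 𝒯.hist_induction (fun x hx => ?_) (fun x y b hx ih => ?_)
    · rw [𝒯.prefixPlan_root μ hx]; exact one_pos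
    · rw [𝒯.prefixPlan_child μ hx]; exact mul_pos ih (hpos y)
  exact mul_pos (hp x) (hpos x)

variable [Fintype X]

theorem ftrlObjective_eq (𝒯 : InfoTree X A H) (η : Fin H → ℝ) (L : (x : X) → A x → ℝ)
    (μ : Policy A) : 𝒯.ftrlObjective η L μ =
      entropicObjective (fun i : Σ x, A x => 𝒯.balanced i.1) (fun i => η (𝒯.level i.1))
        (fun i => L i.1 i.2) (𝒯.planVec μ) := by
  classical
  unfold ftrlObjective entropicObjective shannon
  rw [Finset.sum_add_distrib, Fintype.sum_sigma, Fintype.sum_sigma,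
    ← Finset.sum_fiberwise (s := Finset.univ) (g := 𝒯.level)
      (f := fun x => ∑ a : A x, 𝒯.balanced x * 𝒯.planVec μ ⟨x, a⟩ * _ / _)]
  congr 1
  refine Finset.sum_congr rfl fun h _ => ?_
  rw [Finset.sum_div]
  refine Finset.sum_congr rfl fun x hx => ?_
  rw [Finset.sum_div]
  refine Finset.sum_congr rfl fun a _ => ?_
  change _ = _ / η (𝒯.level x)
  rw [(Finset.mem_filter.1 hx).2]
  rfl

theorem ixLoss_nonneg (𝒯 : InfoTree X A H) {γ : Fin H → ℝ} (hγ : ∀ h, 0 < γ h)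
    (hA : ∀ x, 0 < Fintype.card (A x)) (μ : Policy A) {o : Fin H → (Σ x, A x) × ℝ}
    (ho : ∀ h, 0 ≤ (o h).2) (x : X) (a : A x) : 0 ≤ 𝒯.ixLoss γ μ o x a := by
  unfold ixLoss
  split_ifs
  · exact div_nonneg (ho _) (add_nonneg (𝒯.plan_nonneg _ _ _)
      (div_pos (hγ _) (𝒯.balanced_pos hA x)).le)
  · exact le_rfl

theorem plan_mul_ixLoss_le_one (𝒯 : InfoTree X A H) {γ : Fin H → ℝ} (hγ : ∀ h, 0 < γ h)
    (hA : ∀ x, 0 < Fintype.card (A x)) (μ : Policy A) {o : Fin H → (Σ x, A x) × ℝ}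
    (ho1 : ∀ h, (o h).2 ≤ 1) (x : X) (a : A x) :
    𝒯.plan μ x a * 𝒯.ixLoss γ μ o x a ≤ 1 := by
  unfold ixLoss
  split_ifs
  · have h1 := 𝒯.plan_nonneg μ x a
    have h2 := div_pos (hγ (𝒯.level x)) (𝒯.balanced_pos hA x)
    rw [← mul_div_assoc, div_le_one (by linarith)]
    have := mul_le_mul_of_nonneg_left (ho1 (𝒯.level x)) h1
    linarith
  · simp

theorem plan_pos_of_isBalancedFTRL (𝒯 : InfoTree X A H) (hA : ∀ x, 0 < Fintype.card (A x))
    {γ η : Fin H → ℝ} (hη : ∀ h, 0 < η h) {T : ℕ} {μ : ℕ → Policy A}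
    {o : ℕ → Fin H → (Σ x, A x) × ℝ} (hμ : 𝒯.IsBalancedFTRL γ η T μ o) {t : ℕ} (ht : t < T)
    (x : X) (a : A x) : 0 < 𝒯.plan (μ t) x a := by
  obtain ⟨u, hu⟩ := 𝒯.exists_plan_pos hA
  have hmin := hμ t ht
  simp_rw [ftrlObjective_eq] at hmin
  refine entropicObjective_minimizer_pos (K := Set.range 𝒯.planVec)
    (c := fun i => 𝒯.balanced i.1) (η := fun i => η (𝒯.level i.1))
    (L := fun i => ∑ k ∈ Finset.range t, 𝒯.ixLoss γ (μ k) (o k) i.1 i.2) (fun i => 𝒯.balanced_pos hA i.1) (fun i => hη _)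
    𝒯.convex_range_planVec ?_ ⟨μ t, rfl⟩ ?_ ⟨u, rfl⟩ (fun i => hu i.1 i.2) ⟨x, a⟩
  · rintro _ ⟨m, rfl⟩ i
    exact 𝒯.plan_nonneg m i.1 i.2
  · rintro _ ⟨m, rfl⟩
    exact hmin m

open Classical in
/-- The entropic regularizer ranges over an interval of length at most `∑ h, log N / η h`. -/
theorem neg_le_ftrlObjective_zero [Nonempty X] (𝒯 : InfoTree X A H)
    (hA : ∀ x, 0 < Fintype.card (A x)) {η : Fin H → ℝ} (hη : ∀ h, 0 < η h) (μ : Policy A) :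
    -∑ h, Real.log (totalActions A) / η h ≤ 𝒯.ftrlObjective η (fun _ _ => 0) μ := by
  unfold ftrlObjective
  simp only [mul_zero, Finset.sum_const_zero, zero_add]
  rw [← Finset.sum_neg_distrib]
  refine Finset.sum_le_sum fun h _ => ?_
  rw [← neg_div]
  refine div_le_div_of_nonneg_right ?_ (hη h).le
  unfold shannon
  have hs := 𝒯.sum_balanced_mul_plan hA μ h
  rw [← Finset.sum_sigma (Finset.univ.filter fun x => 𝒯.level x = h) (fun _ => Finset.univ)
    (fun i : Σ x, A x => 𝒯.balanced i.1 * 𝒯.plan μ i.1 i.2)] at hs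
  rw [← Finset.sum_sigma (Finset.univ.filter fun x => 𝒯.level x = h) (fun _ => Finset.univ)
    (fun i : Σ x, A x => 𝒯.balanced i.1 * 𝒯.plan μ i.1 i.2 *
      Real.log (𝒯.balanced i.1 * 𝒯.plan μ i.1 i.2))]
  refine neg_log_le_sum_mul_log _ (fun i : Σ x, A x => mul_nonneg (𝒯.balanced_pos hA i.1).le
    (𝒯.plan_nonneg μ i.1 i.2)) hs (Nat.cast_pos.2 (totalActions_pos hA)) (Nat.cast_le.2 ?_)
  refine (Finset.card_le_univ _).trans ?_
  rw [Fintype.card_sigma, totalActions]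

theorem mul_plan_le_one [Nonempty X] (𝒯 : InfoTree X A H)
    (hA : ∀ x, 0 < Fintype.card (A x)) (μ : Policy A) (x : X) (a : A x) :
    𝒯.balanced x * 𝒯.plan μ x a ≤ 1 := by
  classical
  have h0 : ∀ x a, 0 ≤ 𝒯.balanced x * 𝒯.plan μ x a := fun x a =>
    mul_nonneg (𝒯.balanced_pos hA x).le (𝒯.plan_nonneg μ x a)
  rw [← 𝒯.sum_balanced_mul_plan hA μ (𝒯.level x)]
  refine le_trans ?_ (Finset.single_le_sum (f := fun x => ∑ a, 𝒯.balanced x * 𝒯.plan μ x a)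
    (fun y _ => Finset.sum_nonneg fun c _ => h0 y c)
    (Finset.mem_filter.2 ⟨Finset.mem_univ x, rfl⟩))
  exact Finset.single_le_sum (f := fun a => 𝒯.balanced x * 𝒯.plan μ x a)
    (fun c _ => h0 x c) (Finset.mem_univ a)

theorem ftrlObjective_le [Nonempty X] (𝒯 : InfoTree X A H) (hA : ∀ x, 0 < Fintype.card (A x))
    {η : Fin H → ℝ} (hη : ∀ h, 0 < η h) (L : (x : X) → A x → ℝ) (μ : Policy A) :
    𝒯.ftrlObjective η L μ ≤ ∑ x, ∑ a, 𝒯.plan μ x a * L x a := by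
  unfold ftrlObjective
  rw [add_le_iff_nonpos_right]
  refine Finset.sum_nonpos fun h _ => div_nonpos_of_nonpos_of_nonneg ?_ (hη h).le
  refine Finset.sum_nonpos fun x _ => Finset.sum_nonpos fun a _ => ?_
  have h0 := mul_nonneg (𝒯.balanced_pos hA x).le (𝒯.plan_nonneg μ x a)
  exact mul_nonpos_of_nonneg_of_nonpos h0 (Real.log_nonpos h0 (𝒯.mul_plan_le_one hA μ x a))

open Classical in
/-- Deterministic regret bound of the algorithm with respect to the loss estimates. -/
theorem regret_ixLoss_le [Nonempty X] (𝒯 : InfoTree X A H) (hA : ∀ x, 0 < Fintype.card (A x))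
    {γ η : Fin H → ℝ} (hγ : ∀ h, 0 < γ h) (hη : ∀ h, 0 < η h) {T : ℕ} (hT : 0 < T)
    {μ : ℕ → Policy A} {o : ℕ → Fin H → (Σ x, A x) × ℝ} (ho : ∀ t h, 0 ≤ (o t h).2)
    (ho1 : ∀ t h, (o t h).2 ≤ 1) (hμ : 𝒯.IsBalancedFTRL γ η T μ o) (μ' : Policy A) :
    ∑ t ∈ Finset.range T, ∑ x, ∑ a,
        (𝒯.plan (μ t) x a - 𝒯.plan μ' x a) * 𝒯.ixLoss γ (μ t) (o t) x a ≤
      ∑ h, (Real.log (totalActions A) / η h + η h / 2 * ∑ t ∈ Finset.range T,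
        ∑ x with 𝒯.level x = h, ∑ a, 𝒯.ixLoss γ (μ t) (o t) x a / 𝒯.balanced x) := by
  obtain ⟨u, hu⟩ := 𝒯.exists_plan_pos hA
  -- The FTRL inequality after all `T` episodes is the one indexed by the last episode `n = T - 1`.
  obtain ⟨n, rfl⟩ : ∃ n, T = n + 1 := ⟨T - 1, by omega⟩
  have hmin := hμ
  unfold IsBalancedFTRL at hmin
  simp_rw [ftrlObjective_eq] at hmin
  have h0 : ∀ t x a, 0 ≤ 𝒯.ixLoss γ (μ t) (o t) x a := fun t =>
    𝒯.ixLoss_nonneg hγ hA (μ t) (ho t)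
  have key := entropicFTRL_regret (K := Set.range 𝒯.planVec) (T := n + 1)
    (q := fun t => 𝒯.planVec (μ t)) (ℓ := fun t i => 𝒯.ixLoss γ (μ t) (o t) i.1 i.2)
    (c := fun i => 𝒯.balanced i.1) (η := fun i => η (𝒯.level i.1))
    (fun i => 𝒯.balanced_pos hA i.1) (fun i => hη _) 𝒯.convex_range_planVec
    (by rintro _ ⟨m, rfl⟩ i; exact 𝒯.plan_nonneg m i.1 i.2) ⟨u, rfl⟩ (fun i => hu i.1 i.2)
    (fun t i => h0 t _ _) (fun t _ => ⟨μ t, rfl⟩)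
    (by rintro t ht _ ⟨m, rfl⟩; exact hmin t ht m) n (Nat.lt_succ_self n) _ ⟨μ', rfl⟩
  have h1 := 𝒯.ftrlObjective_le hA hη
    (fun x a => ∑ k ∈ Finset.range (n + 1), 𝒯.ixLoss γ (μ k) (o k) x a) μ'
  have h2 := 𝒯.neg_le_ftrlObjective_zero hA hη (μ 0)
  rw [ftrlObjective_eq] at h1 h2
  have h3 := (add_le_add_left h2 _).trans (key.trans h1)
  simp only [planVec, Finset.sum_sub_distrib] at h3
  simp_rw [Fintype.sum_sigma] at h3
  have h4 : ∑ x, ∑ a, 𝒯.plan μ' x a * ∑ k ∈ Finset.range (n + 1), 𝒯.ixLoss γ (μ k) (o k) x a =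
      ∑ k ∈ Finset.range (n + 1), ∑ x, ∑ a, 𝒯.plan μ' x a * 𝒯.ixLoss γ (μ k) (o k) x a := by
    simp_rw [Finset.mul_sum]
    symm
    rw [Finset.sum_comm]
    exact Finset.sum_congr rfl fun x _ => Finset.sum_comm
  -- Second-order terms become first-order ones, as plan times estimate is at most one; what remains
  -- is the weighted sum for which a concentration bound is available.
  have h5 : ∑ k ∈ Finset.range (n + 1), ∑ x, ∑ a, η (𝒯.level x) / 2 *
        (𝒯.plan (μ k) x a * 𝒯.ixLoss γ (μ k) (o k) x a ^ 2 / 𝒯.balanced x) ≤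
      ∑ h, η h / 2 * ∑ t ∈ Finset.range (n + 1),
        ∑ x with 𝒯.level x = h, ∑ a, 𝒯.ixLoss γ (μ t) (o t) x a / 𝒯.balanced x := by
    simp_rw [Finset.mul_sum]
    rw [Finset.sum_comm (s := Finset.univ (α := Fin H))]
    refine Finset.sum_le_sum fun t _ => ?_
    rw [← Finset.sum_fiberwise (s := Finset.univ) (g := 𝒯.level)]
    refine Finset.sum_le_sum fun h _ => Finset.sum_le_sum fun x hx =>
      Finset.sum_le_sum fun a _ => ?_
    rw [(Finset.mem_filter.1 hx).2]
    refine mul_le_mul_of_nonneg_left ?_ (half_pos (hη h)).le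
    refine div_le_div_of_nonneg_right ?_ (𝒯.balanced_pos hA x).le
    have := mul_le_mul_of_nonneg_right
      (𝒯.plan_mul_ixLoss_le_one hγ hA (μ t) (ho1 t) x a) (h0 t x a)
    linarith
  simp only [sub_mul, Finset.sum_sub_distrib, Finset.sum_add_distrib]
  linarith

end InfoTree

/-- Exponential moment of the lower deviations of a bounded nonnegative random variable. -/
theorem Finset.sum_mul_exp_mean_sub_le_one {ι : Type*} (s : Finset ι) {p Z : ι → ℝ}
    (hp : ∀ i ∈ s, 0 ≤ p i) (hp1 : ∑ i ∈ s, p i = 1) {M : ℝ}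
    (hZ : ∀ i ∈ s, p i ≠ 0 → 0 ≤ Z i ∧ Z i ≤ M) {c : ℝ} (hc : 0 ≤ c) :
    ∑ i ∈ s, p i * Real.exp (c * (∑ j ∈ s, p j * Z j - Z i) - c ^ 2 * M ^ 2 / 2) ≤ 1 := by
  set m := ∑ j ∈ s, p j * Z j with hm
  have h1 : ∀ i ∈ s, p i * Real.exp (c * (m - Z i) - c ^ 2 * M ^ 2 / 2) ≤
      Real.exp (c * m - c ^ 2 * M ^ 2 / 2) * (p i - c * (p i * Z i) + p i * (c ^ 2 * M ^ 2 / 2)) := by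
    intro i hi
    by_cases h0 : p i = 0
    · simp [h0]
    obtain ⟨hz0, hzM⟩ := hZ i hi h0
    have h2 := Real.exp_neg_le_quadratic (mul_nonneg hc hz0)
    have h3 : c * (m - Z i) - c ^ 2 * M ^ 2 / 2 = (c * m - c ^ 2 * M ^ 2 / 2) + -(c * Z i) := by
      ring
    have h4 : (c * Z i) ^ 2 ≤ c ^ 2 * M ^ 2 := by
      rw [← mul_pow]
      exact pow_le_pow_left₀ (mul_nonneg hc hz0) (mul_le_mul_of_nonneg_left hzM hc) 2
    rw [h3, Real.exp_add]
    have h5 : Real.exp (-(c * Z i)) ≤ 1 - c * Z i + c ^ 2 * M ^ 2 / 2 := by linarith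
    have h6 := mul_le_mul_of_nonneg_left h5
      (mul_nonneg (hp i hi) (Real.exp_pos (c * m - c ^ 2 * M ^ 2 / 2)).le)
    linarith
  refine (Finset.sum_le_sum h1).trans ?_
  rw [← Finset.mul_sum, Finset.sum_add_distrib, Finset.sum_sub_distrib, ← Finset.mul_sum,
    ← Finset.sum_mul, hp1, ← hm]
  have h7 := Real.add_one_le_exp (-(c * m - c ^ 2 * M ^ 2 / 2))
  calc _ ≤ Real.exp (c * m - c ^ 2 * M ^ 2 / 2) * Real.exp (-(c * m - c ^ 2 * M ^ 2 / 2)) :=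
        mul_le_mul_of_nonneg_left (by linarith) (Real.exp_pos _).le
    _ = 1 := by rw [← Real.exp_add]; simp

/-! ### Conditional moments of the loss estimates. -/

namespace Game

variable {S X Y : Type u} [Fintype S] [Fintype X] {A : X → Type u} {B : Y → Type u} {H : ℕ}
  [∀ x, Fintype (A x)] [∀ y, Fintype (B y)] {γ : Fin H → ℝ}

omit [∀ y, Fintype (B y)] in
open Classical in
theorem ixLoss_observedX (G : Game S X Y A B H) (γ : Fin H → ℝ) (μ : Policy A)
    (e : Fin H → G.Node) (x : X) (b : A x) :
    G.treeX.ixLoss γ μ (G.observedX e) x b =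
      if G.pairX (e (G.treeX.level x)) = ⟨x, b⟩ then
        G.lossX (G.treeX.level x) (e (G.treeX.level x)) /
          (G.treeX.plan μ x b + γ (G.treeX.level x) / G.treeX.balanced x) else 0 := rfl

theorem sum_prob_mul_ixLoss (G : Game S X Y A B H) (γ : Fin H → ℝ) (μ : Policy A) (ν : Policy B)
    (x : X) (b : A x) :
    ∑ e, G.prob μ ν e * G.treeX.ixLoss γ μ (G.observedX e) x b =
      G.treeX.plan μ x b * G.lossVec ν x b /
        (G.treeX.plan μ x b + γ (G.treeX.level x) / G.treeX.balanced x) := by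
  classical
  rw [← sum_prob_mul_lossX, Finset.sum_div]
  refine Finset.sum_congr rfl fun e _ => ?_
  rw [ixLoss_observedX]
  split_ifs
  · rw [mul_div_assoc]
  · simp

open Classical in
/-- Exponential moment of the implicit-exploration loss estimates at a given step. -/
theorem sum_prob_mul_exp_ixLoss_le_one (G : Game S X Y A B H) {μ : Policy A} (ν : Policy B)
    (hμ : ∀ x b, 0 < G.treeX.plan μ x b) (h : Fin H) {α : (x : X) → A x → ℝ}
    (hα0 : ∀ x b, 0 ≤ α x b)
    (hα : ∀ x b, G.treeX.level x = h → α x b ≤ 2 * (γ h / G.treeX.balanced x)) :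
    ∑ e, G.prob μ ν e * Real.exp (∑ x with G.treeX.level x = h, ∑ b,
      α x b * (G.treeX.ixLoss γ μ (G.observedX e) x b - G.lossVec ν x b)) ≤ 1 := by
  set D := ∑ x with G.treeX.level x = h, ∑ b, α x b * G.lossVec ν x b with hD
  have hpt : ∀ e : Fin H → G.Node, G.prob μ ν e * Real.exp (∑ x with G.treeX.level x = h, ∑ b,
      α x b * (G.treeX.ixLoss γ μ (G.observedX e) x b - G.lossVec ν x b)) ≤
      Real.exp (-D) * (G.prob μ ν e + ∑ x with G.treeX.level x = h, ∑ b,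
        α x b / G.treeX.plan μ x b * (G.prob μ ν e *
          if G.pairX (e (G.treeX.level x)) = ⟨x, b⟩ then
            G.lossX (G.treeX.level x) (e (G.treeX.level x)) else 0)) := by
    intro e
    by_cases h0 : G.prob μ ν e = 0
    · simp [h0]
    have hl := G.level_of_prob_ne_zero μ ν e h0 h
    have h1 := G.sum_level_ite_pairX e h hl fun x b => α x b *
      (G.lossX (G.treeX.level x) (e (G.treeX.level x)) /
        (G.treeX.plan μ x b + γ (G.treeX.level x) / G.treeX.balanced x))
    have h2 := G.sum_level_ite_pairX e h hl fun x b => α x b *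
      (G.lossX (G.treeX.level x) (e (G.treeX.level x)) / G.treeX.plan μ x b)
    have h3 : ∑ x with G.treeX.level x = h, ∑ b,
        α x b * (G.treeX.ixLoss γ μ (G.observedX e) x b - G.lossVec ν x b) =
        -D + ∑ x with G.treeX.level x = h, ∑ b,
          (if G.pairX (e (G.treeX.level x)) = ⟨x, b⟩ then α x b *
            (G.lossX (G.treeX.level x) (e (G.treeX.level x)) /
              (G.treeX.plan μ x b + γ (G.treeX.level x) / G.treeX.balanced x)) else 0) := by
      simp_rw [mul_sub, Finset.sum_sub_distrib, ixLoss_observedX, mul_ite, mul_zero]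
      rw [hD]; ring
    have h4 : ∑ x with G.treeX.level x = h, ∑ b, α x b / G.treeX.plan μ x b * (G.prob μ ν e *
          if G.pairX (e (G.treeX.level x)) = ⟨x, b⟩ then
            G.lossX (G.treeX.level x) (e (G.treeX.level x)) else 0) =
        G.prob μ ν e * ∑ x with G.treeX.level x = h, ∑ b,
          (if G.pairX (e (G.treeX.level x)) = ⟨x, b⟩ then α x b *
            (G.lossX (G.treeX.level x) (e (G.treeX.level x)) / G.treeX.plan μ x b) else 0) := by
      simp_rw [Finset.mul_sum]
      refine Finset.sum_congr rfl fun x _ => Finset.sum_congr rfl fun b _ => ?_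
      split_ifs
      · ring
      · simp
    -- Exactly one pair is visited at step `h`, so the random part of the exponent is a single term.
    -- The resulting bound is linear in the unbiased importance-weighted loss, whose mean gives back
    -- `D`.
    have h5 := Real.exp_ix_le (hα0 _ _) (G.lossX_nonneg h (e h)) (G.lossX_le_one h (e h))
      (hμ (G.pairX (e h)).1 (G.pairX (e h)).2) (hα _ (G.pairX (e h)).2 hl)
    rw [h3, h4, h1, h2, hl, Real.exp_add]
    have h6 := mul_le_mul_of_nonneg_left h5
      (mul_nonneg (G.prob_nonneg μ ν e) (Real.exp_pos (-D)).le)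
    linarith
  refine (Finset.sum_le_sum fun e _ => hpt e).trans ?_
  rw [← Finset.mul_sum, Finset.sum_add_distrib, G.sum_prob]
  have h7 : ∑ e : Fin H → G.Node, ∑ x with G.treeX.level x = h, ∑ b,
      α x b / G.treeX.plan μ x b * (G.prob μ ν e *
          if G.pairX (e (G.treeX.level x)) = ⟨x, b⟩ then
            G.lossX (G.treeX.level x) (e (G.treeX.level x)) else 0) = D := by
    rw [Finset.sum_comm, hD]
    refine Finset.sum_congr rfl fun x _ => ?_
    rw [Finset.sum_comm]
    refine Finset.sum_congr rfl fun b _ => ?_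
    rw [← Finset.mul_sum, sum_prob_mul_lossX]
    have := (hμ x b).ne'
    field_simp
  rw [h7]
  have h8 := Real.add_one_le_exp D
  calc _ ≤ Real.exp (-D) * Real.exp D :=
        mul_le_mul_of_nonneg_left (by linarith) (Real.exp_pos _).le
    _ = 1 := by rw [← Real.exp_add]; simp

/-- The estimated loss suffered by the max-player is at most the number of steps. -/
theorem sum_plan_mul_ixLoss_mem (G : Game S X Y A B H) (hγ : ∀ h, 0 < γ h)
    (hA : ∀ x, 0 < Fintype.card (A x)) (μ : Policy A) (ν : Policy B) (e : Fin H → G.Node)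
    (he : G.prob μ ν e ≠ 0) :
    0 ≤ ∑ x, ∑ b, G.treeX.plan μ x b * G.treeX.ixLoss γ μ (G.observedX e) x b ∧
      ∑ x, ∑ b, G.treeX.plan μ x b * G.treeX.ixLoss γ μ (G.observedX e) x b ≤ H := by
  classical
  constructor
  · exact Finset.sum_nonneg fun x _ => Finset.sum_nonneg fun b _ =>
      mul_nonneg (G.treeX.plan_nonneg μ x b)
        (G.treeX.ixLoss_nonneg hγ hA μ (fun h => G.lossX_nonneg h (e h)) x b)
  · rw [← Finset.sum_fiberwise (s := Finset.univ) (g := G.treeX.level)]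
    have : (H : ℝ) = ∑ _h : Fin H, (1 : ℝ) := by simp
    rw [this]
    refine Finset.sum_le_sum fun h _ => ?_
    have hl := G.level_of_prob_ne_zero μ ν e he h
    have h1 := G.sum_level_ite_pairX e h hl fun x b => G.treeX.plan μ x b *
      G.treeX.ixLoss γ μ (G.observedX e) x b
    refine le_trans (le_of_eq ?_) (h1.le.trans
      (G.treeX.plan_mul_ixLoss_le_one hγ hA μ (fun h => G.lossX_le_one h (e h)) _ _))
    refine Finset.sum_congr rfl fun x _ => Finset.sum_congr rfl fun b _ => ?_
    rw [ixLoss_observedX]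
    split_ifs <;> simp

/-- The bias of the loss estimates towards the policy in use is controlled by the
implicit-exploration parameters. -/
theorem sum_plan_mul_lossVec_sub_mean_le (G : Game S X Y A B H) (hγ : ∀ h, 0 < γ h) {a : ℕ}
    (hA : ∀ x, Fintype.card (A x) = a) (ha : 0 < a) {μ : Policy A} (ν : Policy B)
    (hμ : ∀ x b, 0 < G.treeX.plan μ x b) :
    ∑ x, ∑ b, G.treeX.plan μ x b * G.lossVec ν x b -
      ∑ e, G.prob μ ν e * ∑ x, ∑ b,
        G.treeX.plan μ x b * G.treeX.ixLoss γ μ (G.observedX e) x b ≤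
      ∑ h : Fin H, γ h * (totalActions A / (a : ℝ) ^ (H - (h.1 + 1))) := by
  classical
  have hA0 : ∀ x, 0 < Fintype.card (A x) := fun x => by rw [hA]; exact ha
  have hmean : ∑ e, G.prob μ ν e * ∑ x, ∑ b,
        G.treeX.plan μ x b * G.treeX.ixLoss γ μ (G.observedX e) x b =
      ∑ x, ∑ b, G.treeX.plan μ x b * (G.treeX.plan μ x b * G.lossVec ν x b /
        (G.treeX.plan μ x b + γ (G.treeX.level x) / G.treeX.balanced x)) := by
    simp_rw [← sum_prob_mul_ixLoss, Finset.mul_sum]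
    rw [Finset.sum_comm]
    refine Finset.sum_congr rfl fun x _ => ?_
    rw [Finset.sum_comm]
    exact Finset.sum_congr rfl fun b _ => Finset.sum_congr rfl fun e _ => by ring
  rw [hmean]
  simp_rw [← Finset.sum_sub_distrib]
  rw [← Finset.sum_fiberwise (s := Finset.univ) (g := G.treeX.level)]
  refine Finset.sum_le_sum fun h _ => ?_
  refine le_trans ?_ (mul_le_mul_of_nonneg_left
    (G.sum_level_lossVec_div_balanced_le ν hA ha h) (hγ h).le)
  rw [Finset.mul_sum]
  refine Finset.sum_le_sum fun x hx => ?_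
  rw [Finset.mul_sum]
  refine Finset.sum_le_sum fun b _ => ?_
  rw [(Finset.mem_filter.1 hx).2]
  have hp := hμ x b
  have hg : 0 < γ h / G.treeX.balanced x := div_pos (hγ h) (G.treeX.balanced_pos hA0 x)
  have hℓ := G.lossVec_nonneg ν x b
  have h1 : γ h * (G.lossVec ν x b / G.treeX.balanced x) =
      γ h / G.treeX.balanced x * G.lossVec ν x b := by ring
  rw [h1]
  generalize γ h / G.treeX.balanced x = g at *
  generalize G.treeX.plan μ x b = p at *
  generalize G.lossVec ν x b = ℓ at *
  -- Exact bias at one pair: `g ℓ`, damped by the factor `p / (p + g) ≤ 1`.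
  have h2 : p * ℓ - p * (p * ℓ / (p + g)) = p / (p + g) * (g * ℓ) := by field_simp; ring
  rw [h2]
  exact mul_le_of_le_one_left (mul_nonneg hg.le hℓ) ((div_le_one (by linarith)).2 (by linarith))

end Game

/-! ### Deviation bounds and the general regret bound. -/

namespace Game.Interaction

variable {S X Y : Type u} [Fintype S] [Fintype X] {A : X → Type u} {B : Y → Type u} {H : ℕ}
  [∀ x, Fintype (A x)] [∀ y, Fintype (B y)] {G : Game S X Y A B H} {T : ℕ}
  {Ω : Type v} [mΩ : MeasurableSpace Ω] {P : Measure Ω}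

omit [Fintype X] in
theorem measurable_plan (I : G.Interaction T P) {t : ℕ} (ht : t < T) (x : X) (b : A x) :
    Measurable[I.ℱ t] fun ω => G.treeX.plan (I.μ t ω) x b := by
  unfold InfoTree.plan
  refine Measurable.mul ?_ (I.measurable_μ t ht x b)
  induction G.treeX.hist x with
  | nil => simp
  | cons q l ih =>
    simp only [List.map_cons, List.prod_cons]
    exact (I.measurable_μ t ht _ _).mul ih

theorem measurable_ixLoss (I : G.Interaction T P) {t : ℕ} (ht : t < T) (γ : Fin H → ℝ)
    (o : Fin H → (Σ x, A x) × ℝ) (x : X) (b : A x) :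
    Measurable[I.ℱ t] fun ω => G.treeX.ixLoss γ (I.μ t ω) o x b := by
  unfold InfoTree.ixLoss
  split_ifs
  · exact ((I.measurable_plan ht x b).add_const _).const_div _
  · exact measurable_const

omit [Fintype X] in
theorem measurable_lossVec (I : G.Interaction T P) {t : ℕ} (ht : t < T) (x : X) (b : A x) :
    Measurable[I.ℱ t] fun ω => G.lossVec (I.ν t ω) x b := by
  unfold Game.lossVec
  refine Finset.measurable_fun_sum _ fun e _ => ?_
  split_ifs
  · refine Measurable.mul_const ?_ _
    unfold Game.opponentProb
    exact Finset.measurable_fun_prod _ fun i _ => (I.measurable_ν t ht _ _).const_mul _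
  · exact measurable_const

end Game.Interaction

namespace Game.Interaction

variable {S X Y : Type u} [Fintype S] [Fintype X] {A : X → Type u} {B : Y → Type u} {H : ℕ}
  [∀ x, Fintype (A x)] [∀ y, Fintype (B y)] {G : Game S X Y A B H} {T : ℕ}
  {Ω : Type v} [mΩ : MeasurableSpace Ω] {P : Measure Ω} [IsProbabilityMeasure P]
  {γ : Fin H → ℝ}

/-- The cumulative loss estimate of a pair does not exceed the cumulative loss by much. -/
theorem measure_sum_ixLoss_sub_ge_le (I : G.Interaction T P) (hγ : ∀ h, 0 < γ h)
    (hA : ∀ x, 0 < Fintype.card (A x))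
    (hμ : ∀ t < T, ∀ ω x b, 0 < G.treeX.plan (I.μ t ω) x b) (i : Σ x, A x) (J : ℝ) :
    P {ω | J ≤ ∑ t ∈ Finset.range T, 2 * (γ (G.treeX.level i.1) / G.treeX.balanced i.1) *
      (G.treeX.ixLoss γ (I.μ t ω) (G.observedX (I.τ t ω)) i.1 i.2 -
        G.lossVec (I.ν t ω) i.1 i.2)} ≤ ENNReal.ofReal (Real.exp (-J)) := by
  classical
  have hg : 0 ≤ 2 * (γ (G.treeX.level i.1) / G.treeX.balanced i.1) :=
    mul_nonneg zero_le_two (div_pos (hγ _) (G.treeX.balanced_pos hA i.1)).le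
  refine I.measure_le_sum_le (g := fun t ω e =>
    2 * (γ (G.treeX.level i.1) / G.treeX.balanced i.1) *
      (G.treeX.ixLoss γ (I.μ t ω) (G.observedX e) i.1 i.2 - G.lossVec (I.ν t ω) i.1 i.2))
    (fun t ht e => ((I.measurable_ixLoss ht γ _ _ _).sub
      (I.measurable_lossVec ht _ _)).const_mul _) (fun t ht ω => ?_) J
  -- All weight sits on the pair `i`, with the largest value that implicit exploration allows.
  have key := G.sum_prob_mul_exp_ixLoss_le_one (γ := γ) (I.ν t ω) (hμ t ht ω)
    (G.treeX.level i.1) (α := fun x b => if (⟨x, b⟩ : Σ x, A x) = i then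
      2 * (γ (G.treeX.level i.1) / G.treeX.balanced i.1) else 0)
    (fun x b => by split_ifs; exacts [hg, le_rfl])
    (fun x b hx => by
      split_ifs with h
      · rw [← h]
      · exact mul_nonneg zero_le_two (div_pos (hγ _) (G.treeX.balanced_pos hA x)).le)
  refine le_trans (le_of_eq (Finset.sum_congr rfl fun e _ => ?_)) key
  congr 2
  rw [Finset.sum_eq_single i.1, Finset.sum_eq_single i.2]
  · simp
  · intro b _ hb
    rw [if_neg, zero_mul]
    intro h
    cases i
    exact hb (by simpa using h)
  · simp
  · intro x _ hx
    refine Finset.sum_eq_zero fun b _ => ?_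
    rw [if_neg, zero_mul]
    rintro rfl
    exact hx rfl
  · intro h
    exact absurd (by simp) h

open Classical in
/-- The same for the sum over all the pairs of a step, weighted by the inverse of the balanced
transitions. -/
theorem measure_sum_level_ixLoss_sub_ge_le (I : G.Interaction T P) (hγ : ∀ h, 0 < γ h)
    (hA : ∀ x, 0 < Fintype.card (A x))
    (hμ : ∀ t < T, ∀ ω x b, 0 < G.treeX.plan (I.μ t ω) x b) (h : Fin H) (J : ℝ) :
    P {ω | J ≤ ∑ t ∈ Finset.range T, ∑ x with G.treeX.level x = h, ∑ b,
      2 * (γ h / G.treeX.balanced x) *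
      (G.treeX.ixLoss γ (I.μ t ω) (G.observedX (I.τ t ω)) x b -
        G.lossVec (I.ν t ω) x b)} ≤ ENNReal.ofReal (Real.exp (-J)) := by
  refine I.measure_le_sum_le (g := fun t ω e => ∑ x with G.treeX.level x = h, ∑ b,
    2 * (γ h / G.treeX.balanced x) *
      (G.treeX.ixLoss γ (I.μ t ω) (G.observedX e) x b - G.lossVec (I.ν t ω) x b))
    (fun t ht e => Finset.measurable_fun_sum _ fun x _ => Finset.measurable_fun_sum _ fun b _ =>
      ((I.measurable_ixLoss ht γ _ _ _).sub (I.measurable_lossVec ht _ _)).const_mul _)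
    (fun t ht ω => ?_) J
  exact G.sum_prob_mul_exp_ixLoss_le_one (I.ν t ω) (hμ t ht ω) h
    (α := fun x _ => 2 * (γ h / G.treeX.balanced x))
    (fun x b => mul_nonneg zero_le_two (div_pos (hγ _) (G.treeX.balanced_pos hA x)).le)
    (fun x b _ => le_rfl)

/-- The estimated loss suffered by the max-player does not fall short of its mean by much. -/
theorem measure_sum_mean_sub_ge_le (I : G.Interaction T P) (hγ : ∀ h, 0 < γ h)
    (hA : ∀ x, 0 < Fintype.card (A x)) {c : ℝ} (hc : 0 ≤ c) (J : ℝ) :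
    P {ω | J ≤ ∑ t ∈ Finset.range T, (c * (∑ e, G.prob (I.μ t ω) (I.ν t ω) e * ∑ x, ∑ b,
        G.treeX.plan (I.μ t ω) x b * G.treeX.ixLoss γ (I.μ t ω) (G.observedX e) x b -
      ∑ x, ∑ b, G.treeX.plan (I.μ t ω) x b *
        G.treeX.ixLoss γ (I.μ t ω) (G.observedX (I.τ t ω)) x b) - c ^ 2 * (H : ℝ) ^ 2 / 2)} ≤
      ENNReal.ofReal (Real.exp (-J)) := by
  have hZ : ∀ t < T, ∀ e, Measurable[I.ℱ t] fun ω => ∑ x, ∑ b, G.treeX.plan (I.μ t ω) x b *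
      G.treeX.ixLoss γ (I.μ t ω) (G.observedX e) x b := fun t ht e =>
    Finset.measurable_fun_sum _ fun x _ => Finset.measurable_fun_sum _ fun b _ =>
      (I.measurable_plan ht x b).mul (I.measurable_ixLoss ht γ _ x b)
  refine I.measure_le_sum_le (g := fun t ω e => c * (∑ e, G.prob (I.μ t ω) (I.ν t ω) e *
      ∑ x, ∑ b, G.treeX.plan (I.μ t ω) x b * G.treeX.ixLoss γ (I.μ t ω) (G.observedX e) x b -
      ∑ x, ∑ b, G.treeX.plan (I.μ t ω) x b * G.treeX.ixLoss γ (I.μ t ω) (G.observedX e) x b) -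
        c ^ 2 * (H : ℝ) ^ 2 / 2)
    (fun t ht e => (((Finset.measurable_fun_sum _ fun e _ =>
      (I.measurable_prob ht e).mul (hZ t ht e)).sub (hZ t ht e)).const_mul _).sub_const _)
    (fun t ht ω => ?_) J
  exact Finset.sum_mul_exp_mean_sub_le_one Finset.univ (fun e _ => G.prob_nonneg _ _ e)
    (G.sum_prob _ _ H) (fun e _ he => G.sum_plan_mul_ixLoss_mem hγ hA _ _ e he) hc

/-- Outside a union of events (one per pair, one per step and one for the martingale), the
comparator bias, the stability term and the deviation of the played loss are all controlled, and the
FTRL and mean-bias bounds are deterministic. The events do not involve the comparator, so the bound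
is uniform in it. -/
theorem measure_regret_gt_le (I : G.Interaction T P) {a : ℕ}
    (hA : ∀ x, Fintype.card (A x) = a) (ha : 0 < a) {η : Fin H → ℝ} (hγ : ∀ h, 0 < γ h)
    (hη : ∀ h, 0 < η h) (hT : 0 < T)
    (hμ : ∀ ω, G.treeX.IsBalancedFTRL γ η T (fun t => I.μ t ω)
      (fun t => G.observedX (I.τ t ω))) {c : ℝ} (hc : 0 < c) (J : ℝ) :
    P {ω | ¬ ∀ μ', ∑ t ∈ Finset.range T,
        (G.value μ' (I.ν t ω) - G.value (I.μ t ω) (I.ν t ω)) ≤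
      ∑ h : Fin H, (T * (γ h * (totalActions A / (a : ℝ) ^ (H - (h.1 + 1)))) + J / (2 * γ h) +
        (Real.log (totalActions A) / η h + η h / 2 *
          (T * (totalActions A / (a : ℝ) ^ (H - (h.1 + 1))) + J / (2 * γ h)))) +
        (J / c + c * (H : ℝ) ^ 2 * T / 2)} ≤
      ENNReal.ofReal ((totalActions A + H + 1) * Real.exp (-J)) := by
  classical
  have hX := G.nonempty_infoX
  have hA0 : ∀ x, 0 < Fintype.card (A x) := fun x => by rw [hA]; exact ha
  have hpos : ∀ t < T, ∀ ω x b, 0 < G.treeX.plan (I.μ t ω) x b := fun t ht ω x b =>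
    G.treeX.plan_pos_of_isBalancedFTRL hA0 hη (hμ ω) ht x b
  have hE1 := I.measure_sum_ixLoss_sub_ge_le hγ hA0 hpos
  have hE2 := I.measure_sum_level_ixLoss_sub_ge_le hγ hA0 hpos
  have hE3 := I.measure_sum_mean_sub_ge_le hγ hA0 hc.le J
  set E1 : (Σ x, A x) → Set Ω := fun i => {ω | J ≤ ∑ t ∈ Finset.range T,
    2 * (γ (G.treeX.level i.1) / G.treeX.balanced i.1) *
      (G.treeX.ixLoss γ (I.μ t ω) (G.observedX (I.τ t ω)) i.1 i.2 -
        G.lossVec (I.ν t ω) i.1 i.2)} with hE1def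
  set E2 : Fin H → Set Ω := fun h => {ω | J ≤ ∑ t ∈ Finset.range T,
    ∑ x with G.treeX.level x = h, ∑ b, 2 * (γ h / G.treeX.balanced x) *
      (G.treeX.ixLoss γ (I.μ t ω) (G.observedX (I.τ t ω)) x b -
        G.lossVec (I.ν t ω) x b)} with hE2def
  set E3 : Set Ω := {ω | J ≤ ∑ t ∈ Finset.range T, (c * (∑ e, G.prob (I.μ t ω) (I.ν t ω) e *
      ∑ x, ∑ b, G.treeX.plan (I.μ t ω) x b *
        G.treeX.ixLoss γ (I.μ t ω) (G.observedX e) x b -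
      ∑ x, ∑ b, G.treeX.plan (I.μ t ω) x b *
        G.treeX.ixLoss γ (I.μ t ω) (G.observedX (I.τ t ω)) x b) -
          c ^ 2 * (H : ℝ) ^ 2 / 2)} with hE3def
  have hbound : P (((⋃ i, E1 i) ∪ ⋃ h, E2 h) ∪ E3) ≤
      ENNReal.ofReal ((totalActions A + H + 1) * Real.exp (-J)) := by
    have h1 : P (⋃ i, E1 i) ≤ ENNReal.ofReal (totalActions A * Real.exp (-J)) := by
      refine (measure_iUnion_fintype_le P E1).trans
        ((Finset.sum_le_sum fun i _ => hE1 i J).trans ?_)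
      rw [Finset.sum_const, Finset.card_univ, Fintype.card_sigma, nsmul_eq_mul,
        ENNReal.ofReal_mul (Nat.cast_nonneg _), ENNReal.ofReal_natCast]
      rfl
    have h2 : P (⋃ h, E2 h) ≤ ENNReal.ofReal (H * Real.exp (-J)) := by
      refine (measure_iUnion_fintype_le P E2).trans
        ((Finset.sum_le_sum fun h _ => hE2 h J).trans ?_)
      rw [Finset.sum_const, Finset.card_univ, Fintype.card_fin, nsmul_eq_mul,
        ENNReal.ofReal_mul (Nat.cast_nonneg _), ENNReal.ofReal_natCast]
    rw [add_mul, add_mul, one_mul, ENNReal.ofReal_add (by positivity) (by positivity),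
      ENNReal.ofReal_add (by positivity) (by positivity)]
    exact (measure_union_le _ _).trans (add_le_add
      ((measure_union_le _ _).trans (add_le_add h1 h2)) hE3)
  refine (measure_mono fun ω hω => ?_).trans hbound
  by_contra hgood
  refine hω fun μ' => ?_
  simp only [Set.mem_union, Set.mem_iUnion, not_or, not_exists] at hgood
  obtain ⟨⟨hg1, hg2⟩, hg3⟩ := hgood
  simp only [hE1def, hE2def, hE3def, Set.mem_ofPred_eq, not_le] at hg1 hg2 hg3
  have hbal : ∀ x, 0 < G.treeX.balanced x := G.treeX.balanced_pos hA0
  have hftrl := G.treeX.regret_ixLoss_le hA0 hγ hη hT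
    (fun t h => G.lossX_nonneg h (I.τ t ω h)) (fun t h => G.lossX_le_one h (I.τ t ω h)) (hμ ω) μ'
  have hmean := Finset.sum_le_sum fun t (ht : t ∈ Finset.range T) =>
    G.sum_plan_mul_lossVec_sub_mean_le hγ hA ha (I.ν t ω) (hpos t (Finset.mem_range.1 ht) ω)
  rw [Finset.sum_const, Finset.card_range, nsmul_eq_mul] at hmean
  -- stability term
  have hstab : ∀ h, ∑ t ∈ Finset.range T, ∑ x with G.treeX.level x = h, ∑ b,
      G.treeX.ixLoss γ (I.μ t ω) (G.observedX (I.τ t ω)) x b / G.treeX.balanced x ≤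
      T * (totalActions A / (a : ℝ) ^ (H - (h.1 + 1))) + J / (2 * γ h) := by
    intro h
    have h1 : ∑ t ∈ Finset.range T, ∑ x with G.treeX.level x = h, ∑ b,
        2 * (γ h / G.treeX.balanced x) *
          (G.treeX.ixLoss γ (I.μ t ω) (G.observedX (I.τ t ω)) x b - G.lossVec (I.ν t ω) x b) =
        2 * γ h * (∑ t ∈ Finset.range T, ∑ x with G.treeX.level x = h, ∑ b,
          G.treeX.ixLoss γ (I.μ t ω) (G.observedX (I.τ t ω)) x b / G.treeX.balanced x -
          ∑ t ∈ Finset.range T, ∑ x with G.treeX.level x = h, ∑ b,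
            G.lossVec (I.ν t ω) x b / G.treeX.balanced x) := by
      simp_rw [← Finset.sum_sub_distrib, Finset.mul_sum]
      exact Finset.sum_congr rfl fun t _ => Finset.sum_congr rfl fun x _ =>
        Finset.sum_congr rfl fun b _ => by ring
    have h2 := hg2 h
    have h3 : (0 : ℝ) < 2 * γ h := mul_pos two_pos (hγ h)
    rw [h1, mul_comm, ← lt_div_iff₀ h3] at h2
    have h4 := Finset.sum_le_sum fun t (_ : t ∈ Finset.range T) =>
      G.sum_level_lossVec_div_balanced_le (I.ν t ω) hA ha h
    rw [Finset.sum_const, Finset.card_range, nsmul_eq_mul] at h4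
    linarith
  have hstab' := Finset.sum_le_sum fun h (_ : h ∈ Finset.univ) => add_le_add_right
    (mul_le_mul_of_nonneg_left (hstab h) (half_pos (hη h)).le)
    (Real.log (totalActions A) / η h)
  -- bias with respect to the comparator
  have hcomp : ∑ x, ∑ b, G.treeX.plan μ' x b * ∑ t ∈ Finset.range T,
      (G.treeX.ixLoss γ (I.μ t ω) (G.observedX (I.τ t ω)) x b - G.lossVec (I.ν t ω) x b) ≤
      ∑ h, J / (2 * γ h) := by
    rw [← Finset.sum_fiberwise (s := Finset.univ) (g := G.treeX.level)]
    refine Finset.sum_le_sum fun h _ => ?_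
    -- The budget of the step is distributed over its pairs with the weights `p⋆ μ'`, which sum to
    -- one.
    have h1 : J / (2 * γ h) = ∑ x with G.treeX.level x = h, ∑ b,
        (G.treeX.balanced x * G.treeX.plan μ' x b) * (J / (2 * γ h)) := by
      simp_rw [← Finset.sum_mul]
      rw [G.treeX.sum_balanced_mul_plan hA0, one_mul]
    rw [h1]
    refine Finset.sum_le_sum fun x hx => Finset.sum_le_sum fun b _ => ?_
    rw [mul_comm (G.treeX.balanced x), mul_assoc]
    refine mul_le_mul_of_nonneg_left ?_ (G.treeX.plan_nonneg μ' x b)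
    have h2 := hg1 ⟨x, b⟩
    rw [← Finset.mul_sum] at h2
    simp only [(Finset.mem_filter.1 hx).2] at h2
    have h3 := hγ h
    have h4 := hbal x
    have h5 : 2 * (γ h / G.treeX.balanced x) * (G.treeX.balanced x * (J / (2 * γ h))) = J := by
      field_simp
    nlinarith [div_pos h3 h4]
  have hcomp' : ∑ x, ∑ b, G.treeX.plan μ' x b * ∑ t ∈ Finset.range T,
      (G.treeX.ixLoss γ (I.μ t ω) (G.observedX (I.τ t ω)) x b - G.lossVec (I.ν t ω) x b) =
      ∑ t ∈ Finset.range T, (∑ x, ∑ b, G.treeX.plan μ' x b *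
        G.treeX.ixLoss γ (I.μ t ω) (G.observedX (I.τ t ω)) x b -
        ∑ x, ∑ b, G.treeX.plan μ' x b * G.lossVec (I.ν t ω) x b) := by
    simp_rw [← Finset.sum_sub_distrib, ← mul_sub, Finset.mul_sum]
    symm
    rw [Finset.sum_comm]
    exact Finset.sum_congr rfl fun x _ => Finset.sum_comm
  have hval : ∑ t ∈ Finset.range T, (G.value μ' (I.ν t ω) - G.value (I.μ t ω) (I.ν t ω)) =
      ∑ t ∈ Finset.range T, (∑ x, ∑ b, G.treeX.plan (I.μ t ω) x b * G.lossVec (I.ν t ω) x b -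
        ∑ x, ∑ b, G.treeX.plan μ' x b * G.lossVec (I.ν t ω) x b) := by
    refine Finset.sum_congr rfl fun t _ => ?_
    rw [sum_plan_mul_lossVec, sum_plan_mul_lossVec]; ring
  rw [hcomp'] at hcomp
  rw [hval]
  simp only [sub_mul, Finset.sum_sub_distrib] at hmean hftrl hcomp ⊢
  have hg3' : ∑ t ∈ Finset.range T, (∑ e, G.prob (I.μ t ω) (I.ν t ω) e * ∑ x, ∑ b,
        G.treeX.plan (I.μ t ω) x b * G.treeX.ixLoss γ (I.μ t ω) (G.observedX e) x b) -
      ∑ t ∈ Finset.range T, ∑ x, ∑ b, G.treeX.plan (I.μ t ω) x b *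
        G.treeX.ixLoss γ (I.μ t ω) (G.observedX (I.τ t ω)) x b ≤
      J / c + c * (H : ℝ) ^ 2 * T / 2 := by
    rw [Finset.sum_sub_distrib, ← Finset.mul_sum, Finset.sum_sub_distrib, Finset.sum_const,
      Finset.card_range, nsmul_eq_mul] at hg3
    generalize ∑ t ∈ Finset.range T, (∑ e, G.prob (I.μ t ω) (I.ν t ω) e * ∑ x, ∑ b,
        G.treeX.plan (I.μ t ω) x b * G.treeX.ixLoss γ (I.μ t ω) (G.observedX e) x b) = m at *
    generalize ∑ t ∈ Finset.range T, ∑ x, ∑ b, G.treeX.plan (I.μ t ω) x b *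
        G.treeX.ixLoss γ (I.μ t ω) (G.observedX (I.τ t ω)) x b = z at *
    have h6 : J / c + c * (H : ℝ) ^ 2 * T / 2 = (J + T * (c ^ 2 * (H : ℝ) ^ 2 / 2)) / c := by
      field_simp
    rw [h6, le_div_iff₀ hc]
    linarith
  rw [Finset.mul_sum] at hmean
  rw [Finset.sum_add_distrib, Finset.sum_add_distrib]
  linarith

end Game.Interaction

/-! ### Computations with the prescribed parameters. -/

section Parameters

/-- The case `a = 2` dominates: a geometric series of ratio `1/√2`, with sum below `1 + √2 < 2.42`.
-/
theorem sum_sqrt_inv_two_mul_pow_le {a : ℕ} (ha : 2 ≤ a) (H : ℕ) :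
    ∑ h : Fin H, √(1 / (2 * (a : ℝ) ^ (H - (h.1 + 1)))) ≤ 2.42 := by
  set r : ℝ := √(1 / 2) with hr
  have hr0 : 0 < r := Real.sqrt_pos.2 (by norm_num)
  have hr1 : r ≤ 0.7072 := Real.sqrt_le_iff.2 ⟨by norm_num, by norm_num⟩
  have h1 : ∀ n : ℕ, √(1 / (2 * (a : ℝ) ^ n)) ≤ r ^ (n + 1) := fun n => by
    have h2 : r ^ (n + 1) = √(1 / 2 ^ (n + 1)) := by
      rw [← Real.sqrt_sq (pow_nonneg hr0.le (n + 1)), ← pow_mul, mul_comm, pow_mul, hr,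
        Real.sq_sqrt (by norm_num), one_div_pow]
    rw [h2, pow_succ']
    refine Real.sqrt_le_sqrt (one_div_le_one_div_of_le (by positivity) ?_)
    have : (2 : ℝ) ≤ a := by exact_mod_cast ha
    gcongr
  have h3 : ∀ n : ℕ, ∑ j ∈ Finset.range n, r ^ (j + 1) ≤ 2.42 * (1 - r ^ n) := fun n => by
    induction n with
    | zero => simp
    | succ n ih =>
      rw [Finset.sum_range_succ, pow_succ]
      have := pow_pos hr0 n
      nlinarith
  calc ∑ h : Fin H, √(1 / (2 * (a : ℝ) ^ (H - (h.1 + 1))))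
      = ∑ j ∈ Finset.range H, √(1 / (2 * (a : ℝ) ^ (H - (j + 1)))) :=
        Fin.sum_univ_eq_sum_range (fun j => √(1 / (2 * (a : ℝ) ^ (H - (j + 1))))) H
    _ = ∑ j ∈ Finset.range H, √(1 / (2 * (a : ℝ) ^ j)) := by
        rw [← Finset.sum_range_reflect]
        refine Finset.sum_congr rfl fun j hj => ?_
        have := Finset.mem_range.1 hj
        congr 4
        omega
    _ ≤ ∑ j ∈ Finset.range H, r ^ (j + 1) := Finset.sum_le_sum fun j _ => h1 j
    _ ≤ 2.42 * (1 - r ^ H) := h3 H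
    _ ≤ 2.42 := by linarith [pow_pos hr0 H]

/-- The contribution of one step to the regret bound, for the prescribed parameters. -/
theorem step_bound_eq {D ι N T L κ : ℝ} (hD : 0 < D) (hι : 0 < ι) (hN : 0 < N) (hT : 0 < T)
    (hL : 0 < L) :
    T * (√(D * ι / (2 * N * T)) * (N / D)) + κ * ι / (2 * √(D * ι / (2 * N * T))) +
      (L / √(2 * D * L / (N * T)) + √(2 * D * L / (N * T)) / 2 *
        (T * (N / D) + κ * ι / (2 * √(D * ι / (2 * N * T))))) =
    ((1 + κ) * √ι + 2 * √L) * √N * √T * √(1 / (2 * D)) + κ * √L * √ι / 2 := by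
  -- Every quantity is replaced by the square of a positive variable, and `2` by `q²`, so that no
  -- root is left and the identity becomes rational.
  obtain ⟨q, hq, hq2⟩ : ∃ q : ℝ, 0 < q ∧ q ^ 2 = 2 :=
    ⟨√2, by positivity, Real.sq_sqrt (by norm_num)⟩
  obtain ⟨d, hd, rfl⟩ : ∃ d : ℝ, 0 < d ∧ d ^ 2 = D := ⟨√D, by positivity, Real.sq_sqrt hD.le⟩
  obtain ⟨i, hi, rfl⟩ : ∃ d : ℝ, 0 < d ∧ d ^ 2 = ι := ⟨√ι, by positivity, Real.sq_sqrt hι.le⟩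
  obtain ⟨n, hn, rfl⟩ : ∃ d : ℝ, 0 < d ∧ d ^ 2 = N := ⟨√N, by positivity, Real.sq_sqrt hN.le⟩
  obtain ⟨t, ht, rfl⟩ : ∃ d : ℝ, 0 < d ∧ d ^ 2 = T := ⟨√T, by positivity, Real.sq_sqrt hT.le⟩
  obtain ⟨l, hl, rfl⟩ : ∃ d : ℝ, 0 < d ∧ d ^ 2 = L := ⟨√L, by positivity, Real.sq_sqrt hL.le⟩
  have h1 : √(d ^ 2 * i ^ 2 / (2 * n ^ 2 * t ^ 2)) = d * i / (q * n * t) := by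
    rw [← hq2, ← mul_pow, ← mul_pow, ← mul_pow, ← div_pow, Real.sqrt_sq (by positivity)]
  have h2 : √(2 * d ^ 2 * l ^ 2 / (n ^ 2 * t ^ 2)) = q * d * l / (n * t) := by
    rw [← hq2, ← mul_pow, ← mul_pow, ← mul_pow, ← div_pow, Real.sqrt_sq (by positivity)]
  have h3 : √(1 / (2 * d ^ 2)) = 1 / (q * d) := by
    rw [← hq2, ← mul_pow, ← one_pow (2 : ℕ), ← div_pow, Real.sqrt_sq (by positivity), one_pow]
  rw [h1, h2, h3, Real.sqrt_sq hi.le, Real.sqrt_sq hn.le, Real.sqrt_sq ht.le, Real.sqrt_sq hl.le]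
  have h4 : κ * i ^ 2 / (2 * (d * i / (q * n * t))) = κ * (i * n * t / (q * d)) := by
    rw [← hq2]; field_simp
  have h5 : t ^ 2 * (d * i / (q * n * t) * (n ^ 2 / d ^ 2)) = i * n * t / (q * d) := by
    field_simp
  have h6 : l ^ 2 / (q * d * l / (n * t)) = l * n * t / (q * d) := by field_simp
  have h7 : q * d * l / (n * t) / 2 * (t ^ 2 * (n ^ 2 / d ^ 2) + κ * (i * n * t / (q * d))) =
      l * n * t / (q * d) + κ * l * i / 2 := by
    have : q * d * l / (n * t) / 2 * (t ^ 2 * (n ^ 2 / d ^ 2)) = l * n * t / (q * d) := by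
      rw [← hq2]; field_simp
    rw [mul_add, this]
    field_simp
  rw [h4, h5, h6, h7]
  ring

theorem deviation_bound_eq {ι T κ H : ℝ} (hι : 0 < ι) (hT : 0 < T) (hH : 0 < H) :
    κ * ι / (√(2 * ι / T) / H) + √(2 * ι / T) / H * H ^ 2 * T / 2 =
      (κ + 1) * √ι * √T * H * √(1 / 2) := by
  obtain ⟨q, hq, hq2⟩ : ∃ q : ℝ, 0 < q ∧ q ^ 2 = 2 :=
    ⟨√2, by positivity, Real.sq_sqrt (by norm_num)⟩
  obtain ⟨i, hi, rfl⟩ : ∃ d : ℝ, 0 < d ∧ d ^ 2 = ι := ⟨√ι, by positivity, Real.sq_sqrt hι.le⟩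
  obtain ⟨t, ht, rfl⟩ : ∃ d : ℝ, 0 < d ∧ d ^ 2 = T := ⟨√T, by positivity, Real.sq_sqrt hT.le⟩
  rw [← hq2, ← mul_pow, ← div_pow, ← one_pow (2 : ℕ), ← div_pow, Real.sqrt_sq (by positivity),
    Real.sqrt_sq (by positivity), Real.sqrt_sq (by positivity), Real.sqrt_sq (by positivity),
    hq2]
  have h1 : κ * i ^ 2 / (q * i / t / H) = κ * i * t * H * (1 / q) := by field_simp
  have h2 : q * i / t / H * H ^ 2 * t ^ 2 / 2 = i * t * H * (1 / q) := by
    rw [← hq2]; field_simp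
  rw [h1, h2]; simp only [one_pow]; ring

theorem one_le_iota {N : ℕ} (hN : 0 < N) {δ : ℝ} (hδ : 0 < δ) (hδ1 : δ < 1) :
    1 ≤ iota N δ := by
  rw [iota, Real.le_log_iff_exp_le (by positivity), le_div_iff₀ hδ]
  have h1 : (1 : ℝ) ≤ N := by exact_mod_cast hN
  have := Real.exp_one_lt_d9
  nlinarith

theorem log_le_iota {N : ℕ} (hN : 0 < N) {δ : ℝ} (hδ : 0 < δ) (hδ1 : δ < 1) :
    Real.log N ≤ iota N δ := by
  have h1 : (0 : ℝ) < N := by exact_mod_cast hN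
  refine Real.log_le_log h1 ?_
  rw [le_div_iff₀ hδ]
  nlinarith

theorem exp_neg_iota {N : ℕ} (hN : 0 < N) {δ : ℝ} (hδ : 0 < δ) :
    Real.exp (-iota N δ) = δ / (3 * N) := by
  rw [iota, Real.exp_neg, Real.exp_log (by positivity), inv_div]

end Parameters

section Policies

variable {X : Type u} {A : X → Type u} [∀ x, Fintype (A x)]

theorem Policy.card_pos (μ : Policy A) (x : X) : 0 < Fintype.card (A x) := by
  by_contra h
  have : IsEmpty (A x) := Fintype.card_eq_zero_iff.1 (by omega)
  simpa using (μ.2 x).2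

theorem Policy.eq_of_card_le_one (hA : ∀ x, Fintype.card (A x) ≤ 1) (μ μ' : Policy A) :
    μ = μ' := by
  have h : ∀ (m : Policy A) x b, m.1 x b = 1 := fun m x b => by
    have := Fintype.card_le_one_iff_subsingleton.1 (hA x)
    rw [← (m.2 x).2, Fintype.sum_subsingleton _ b]
  exact Subtype.ext (funext fun x => funext fun b => by rw [h, h])

end Policies

/-! ### Regret bounds with explicit constants. -/

namespace Game.Interaction

variable {S X Y : Type u} [Fintype S] [Fintype X] {A : X → Type u} {B : Y → Type u} {H : ℕ}
  [∀ x, Fintype (A x)] [∀ y, Fintype (B y)] {G : Game S X Y A B H} {T : ℕ}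
  {Ω : Type v} [mΩ : MeasurableSpace Ω] {P : Measure Ω} [IsProbabilityMeasure P]

/-- The deviation level is `κ ι`, while the parameters remain tuned to `ι`. Part (i) takes `κ = 1`;
part (ii) takes `κ = 2`, since each player may fail with probability at most `δ / 2` although both
tune to `δ`. -/
theorem measure_regret_balancedFTRL_gt_le (I : G.Interaction T P) {a : ℕ}
    (hA : ∀ x, Fintype.card (A x) = a) (ha : 2 ≤ a) {δ : ℝ} (hδ : 0 < δ) (hδ1 : δ < 1)
    (hT : 0 < T)
    (hμ : ∀ ω, G.treeX.IsBalancedFTRL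
      (ixParam a (totalActions A) H T δ) (learningRate a (totalActions A) H T) T
      (fun t => I.μ t ω) (fun t => G.observedX (I.τ t ω))) {κ : ℝ} (hκ : 0 ≤ κ) :
    P {ω | ¬ ∀ μ', ∑ t ∈ Finset.range T,
        (G.value μ' (I.ν t ω) - G.value (I.μ t ω) (I.ν t ω)) ≤
      2.42 * (((1 + κ) * √(iota (totalActions A) δ) + 2 * √(Real.log (totalActions A))) *
        √(totalActions A) * √T) +
      κ * H * √(Real.log (totalActions A)) * √(iota (totalActions A) δ) / 2 +
      0.7072 * ((κ + 1) * √(iota (totalActions A) δ) * √T * H)} ≤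
      ENNReal.ofReal (3 * totalActions A * Real.exp (-(κ * iota (totalActions A) δ))) := by
  have hX := G.nonempty_infoX
  have ha0 : 0 < a := by omega
  have hA0 : ∀ x, 0 < Fintype.card (A x) := fun x => by rw [hA]; exact ha0
  have hH : 0 < H := (Nat.zero_le _).trans_lt (G.treeX.length_hist_lt hX.some)
  have hN : 0 < totalActions A := InfoTree.totalActions_pos hA0
  have hpow := G.treeX.pow_le_totalActions hA
  have hsq := G.treeX.sq_le_totalActions hA ha
  have hN1 : 1 < totalActions A := (Nat.one_lt_pow hH.ne' ha).trans_le hpow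
  have hι := one_le_iota hN hδ hδ1
  have hL : 0 < Real.log (totalActions A) := Real.log_pos (by exact_mod_cast hN1)
  have hNr : (0 : ℝ) < totalActions A := by exact_mod_cast hN
  have hTr : (0 : ℝ) < T := by exact_mod_cast hT
  have hHr : (0 : ℝ) < H := by exact_mod_cast hH
  have har : (0 : ℝ) < a := by exact_mod_cast ha0
  set ι := iota (totalActions A) δ with hιdef
  have hι0 : 0 < ι := by linarith
  have hγ : ∀ h, 0 < ixParam a (totalActions A) H T δ h := fun h =>
    Real.sqrt_pos.2 (div_pos (mul_pos (pow_pos har _) hι0) (by positivity))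
  have hη : ∀ h, 0 < learningRate a (totalActions A) H T h := fun h =>
    Real.sqrt_pos.2 (by positivity)
  -- The minimizer of `ι / c + c H² T / 2`, that is, the optimal choice for `κ = 1`.
  have hc : 0 < √(2 * ι / T) / H := by positivity
  have key := I.measure_regret_gt_le hA ha0 hγ hη hT hμ hc (κ * ι)
  refine le_trans ?_ (key.trans (ENNReal.ofReal_le_ofReal ?_))
  · refine measure_mono fun ω hω h => hω fun μ' => (h μ').trans ?_
    have h1 : ∀ h : Fin H, T * (ixParam a (totalActions A) H T δ h *
        (totalActions A / (a : ℝ) ^ (H - (h.1 + 1)))) +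
        κ * ι / (2 * ixParam a (totalActions A) H T δ h) +
        (Real.log (totalActions A) / learningRate a (totalActions A) H T h +
          learningRate a (totalActions A) H T h / 2 *
          (T * (totalActions A / (a : ℝ) ^ (H - (h.1 + 1))) +
            κ * ι / (2 * ixParam a (totalActions A) H T δ h))) = _ := fun h =>
      step_bound_eq (pow_pos har (H - (h.1 + 1))) hι0 hNr hTr hL
    rw [deviation_bound_eq hι0 hTr hHr]
    simp_rw [h1]
    rw [Finset.sum_add_distrib, ← Finset.mul_sum, Finset.sum_const, Finset.card_univ,
      Fintype.card_fin, nsmul_eq_mul]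
    have h2 := mul_le_mul_of_nonneg_left (sum_sqrt_inv_two_mul_pow_le ha H)
      (show 0 ≤ ((1 + κ) * √ι + 2 * √(Real.log (totalActions A))) * √(totalActions A) * √T by
        positivity)
    have h3 : √(1 / 2 : ℝ) ≤ 0.7072 := Real.sqrt_le_iff.2 ⟨by norm_num, by norm_num⟩
    have h4 := mul_le_mul_of_nonneg_left h3
      (show 0 ≤ (κ + 1) * √ι * √T * H by positivity)
    linarith
  · refine mul_le_mul_of_nonneg_right ?_ (Real.exp_pos _).le
    -- Accounts for the factor `3` in `ι`; it uses `H ≤ H² ≤ N`.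
    have h5 : totalActions A + H + 1 ≤ 3 * totalActions A := by nlinarith
    exact_mod_cast h5

omit [Fintype X] [IsProbabilityMeasure P] in
-- With at most one action everywhere there is only one policy. This case is set apart because `H² ≤
-- N`, the geometric series and the positivity of `η` may fail in it.
theorem regret_nonpos_of_trivial (I : G.Interaction T P) {a : ℕ}
    (hA : ∀ x, Fintype.card (A x) = a) (h : a < 2 ∨ T = 0) (ω : Ω) (μ' : Policy A) :
    ∑ t ∈ Finset.range T, (G.value μ' (I.ν t ω) - G.value (I.μ t ω) (I.ν t ω)) ≤ 0 := by
  rcases h with h | rfl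
  · refine Finset.sum_nonpos fun t _ => ?_
    rw [Policy.eq_of_card_le_one (fun x => by rw [hA]; omega) μ' (I.μ t ω), sub_self]
  · simp

/-- High-probability regret bound of the algorithm against an adaptive opponent. -/
theorem measure_regret_gt_confidence_le (I : G.Interaction T P) {a : ℕ}
    (hA : ∀ x, Fintype.card (A x) = a) {δ : ℝ} (hδ : 0 < δ) (hδ1 : δ < 1)
    (hμ : ∀ ω, G.treeX.IsBalancedFTRL
      (ixParam a (totalActions A) H T δ) (learningRate a (totalActions A) H T) T
      (fun t => I.μ t ω) (fun t => G.observedX (I.τ t ω))) :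
    P {ω | ¬ ∀ μ', ∑ t ∈ Finset.range T,
        (G.value μ' (I.ν t ω) - G.value (I.μ t ω) (I.ν t ω)) ≤
      (5 * √(Real.log (totalActions A)) + 8 * iota (totalActions A) δ) *
        √((totalActions A : ℝ) * T)} ≤ ENNReal.ofReal δ := by
  have hX := G.nonempty_infoX
  obtain ⟨ω₀⟩ := P.nonempty_of_neZero
  have hN : 0 < totalActions A := InfoTree.totalActions_pos (I.μ 0 ω₀).card_pos
  have hι := one_le_iota hN hδ hδ1
  by_cases htriv : a < 2 ∨ T = 0
  · refine le_trans (le_of_eq ?_) (zero_le)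
    convert measure_empty (μ := P)
    rw [Set.eq_empty_iff_forall_notMem]
    exact fun ω hω => hω fun μ' => (I.regret_nonpos_of_trivial hA htriv ω μ').trans (by positivity)
  · push Not at htriv
    obtain ⟨ha, hT⟩ := htriv
    have hT := Nat.pos_of_ne_zero hT
    have hT1 : (1 : ℝ) ≤ √T := Real.one_le_sqrt.2 (by exact_mod_cast hT)
    have hH : (H : ℝ) ≤ √(totalActions A) :=
      Real.le_sqrt_of_sq_le (by exact_mod_cast G.treeX.sq_le_totalActions hA ha)
    have key := I.measure_regret_balancedFTRL_gt_le hA ha hδ hδ1 hT hμ zero_le_one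
    rw [one_mul (iota _ _), exp_neg_iota hN hδ] at key
    have hδN : 3 * (totalActions A : ℝ) * (δ / (3 * totalActions A)) = δ := by field_simp
    rw [hδN] at key
    refine le_trans ?_ key
    refine measure_mono fun ω hω h => hω fun μ' => (h μ').trans ?_
    rw [Real.sqrt_mul (Nat.cast_nonneg _)]
    have hi : iota (totalActions A) δ = √(iota (totalActions A) δ) ^ 2 :=
      (Real.sq_sqrt (by linarith)).symm
    have hi1 : 1 ≤ √(iota (totalActions A) δ) := Real.one_le_sqrt.2 hι
    have hl : √(Real.log (totalActions A)) ≤ √(iota (totalActions A) δ) :=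
      Real.sqrt_le_sqrt (log_le_iota hN hδ hδ1)
    have hl0 := Real.sqrt_nonneg (Real.log (totalActions A))
    rw [hi, Real.sqrt_sq (by linarith)]
    have hn0 : 0 ≤ √(totalActions A : ℝ) := Real.sqrt_nonneg _
    have hH0 : (0 : ℝ) ≤ H := Nat.cast_nonneg _
    generalize √(iota (totalActions A) δ) = i at *
    generalize √(Real.log (totalActions A)) = l at *
    generalize √(totalActions A : ℝ) = n at *
    generalize √(T : ℝ) = t at *
    generalize (H : ℝ) = k at *
    have e0 : i ≤ i ^ 2 := by nlinarith
    have e1 : k * l * i ≤ i ^ 2 * (n * t) := by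
      have : k ≤ n * t := by nlinarith
      calc k * l * i = k * (l * i) := by ring
        _ ≤ (n * t) * (i * i) := by gcongr
        _ = _ := by ring
    have e2 : i * t * k ≤ i ^ 2 * (n * t) := by
      calc i * t * k ≤ i ^ 2 * t * n := by gcongr
        _ = _ := by ring
    have e3 : i * (n * t) ≤ i ^ 2 * (n * t) := by gcongr
    have e4 : 0 ≤ l * (n * t) := by positivity
    have e5 : 0 ≤ i ^ 2 * (n * t) := by positivity
    -- The coefficient of `√(log N)` is `2 · 2.42 ≤ 5`, that of `ι` at most `2 · 2.42 + 1/2 + 2 ·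
    -- 0.7072 ≤ 8`.
    nlinarith

/-- The same with a larger multiple of a smaller power of `iota`. -/
theorem measure_regret_gt_half_confidence_le (I : G.Interaction T P) {a : ℕ}
    (hA : ∀ x, Fintype.card (A x) = a) {δ : ℝ} (hδ : 0 < δ) (hδ1 : δ < 1)
    (hμ : ∀ ω, G.treeX.IsBalancedFTRL
      (ixParam a (totalActions A) H T δ) (learningRate a (totalActions A) H T) T
      (fun t => I.μ t ω) (fun t => G.observedX (I.τ t ω))) :
    P {ω | ¬ ∀ μ', ∑ t ∈ Finset.range T,
        (G.value μ' (I.ν t ω) - G.value (I.μ t ω) (I.ν t ω)) ≤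
      20 * √(iota (totalActions A) δ * totalActions A * T)} ≤ ENNReal.ofReal (δ / 2) := by
  have hX := G.nonempty_infoX
  obtain ⟨ω₀⟩ := P.nonempty_of_neZero
  have hN : 0 < totalActions A := InfoTree.totalActions_pos (I.μ 0 ω₀).card_pos
  have hNr : (1 : ℝ) ≤ totalActions A := by exact_mod_cast hN
  have hι := one_le_iota hN hδ hδ1
  by_cases htriv : a < 2 ∨ T = 0
  · refine le_trans (le_of_eq ?_) (zero_le)
    convert measure_empty (μ := P)
    rw [Set.eq_empty_iff_forall_notMem]
    exact fun ω hω => hω fun μ' => (I.regret_nonpos_of_trivial hA htriv ω μ').trans (by positivity)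
  · push Not at htriv
    obtain ⟨ha, hT⟩ := htriv
    have hT := Nat.pos_of_ne_zero hT
    have hT1 : (1 : ℝ) ≤ √T := Real.one_le_sqrt.2 (by exact_mod_cast hT)
    have hH : (H : ℝ) ≤ √(totalActions A) :=
      Real.le_sqrt_of_sq_le (by exact_mod_cast G.treeX.sq_le_totalActions hA ha)
    have hL0 : 0 ≤ Real.log (totalActions A) := Real.log_natCast_nonneg _
    -- Keeps the lower-order term proportional to `√ι` instead of `ι`. From `2^H ≤ N` follows `H ≤ 2
    -- log N`, and `(log N)³ ≤ 6 N`, so `H² log N ≤ 24 N ≤ 25 N`.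
    have hHL : (H : ℝ) * √(Real.log (totalActions A)) ≤ 5 * √(totalActions A) := by
      have hexp : Real.exp (Real.log (totalActions A)) = totalActions A :=
        Real.exp_log (by linarith)
      have h1 := Real.pow_div_factorial_le_exp _ hL0 3
      rw [hexp] at h1
      have h2 : (H : ℝ) * Real.log 2 ≤ Real.log (totalActions A) := by
        rw [← Real.log_pow]
        refine Real.log_le_log (by positivity) ?_
        exact_mod_cast (Nat.pow_le_pow_left ha H).trans (G.treeX.pow_le_totalActions hA)
      have h3 : (H : ℝ) ≤ 2 * Real.log (totalActions A) := by
        have := Real.log_two_gt_d9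
        have : (0 : ℝ) ≤ H := Nat.cast_nonneg _
        nlinarith
      refine abs_le_of_sq_le_sq' ?_ (by positivity) |>.2
      rw [mul_pow, mul_pow, Real.sq_sqrt hL0, Real.sq_sqrt (by linarith)]
      have h4 : (H : ℝ) ^ 2 ≤ (2 * Real.log (totalActions A)) ^ 2 :=
        pow_le_pow_left₀ (Nat.cast_nonneg _) h3 2
      have h5 := mul_le_mul_of_nonneg_right h4 hL0
      norm_num [Nat.factorial] at h1
      nlinarith
    have key := I.measure_regret_balancedFTRL_gt_le hA ha hδ hδ1 hT hμ zero_le_two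
    have hδN : 3 * (totalActions A : ℝ) * Real.exp (-(2 * iota (totalActions A) δ)) ≤ δ / 2 := by
      rw [two_mul, neg_add, Real.exp_add, exp_neg_iota hN hδ]
      have : 3 * (totalActions A : ℝ) * (δ / (3 * totalActions A) * (δ / (3 * totalActions A))) =
        δ * δ / (3 * totalActions A) := by field_simp
      rw [this, div_le_iff₀ (by positivity)]
      nlinarith [mul_le_mul_of_nonneg_left hNr hδ.le]
    refine le_trans ?_ (key.trans (ENNReal.ofReal_le_ofReal hδN))
    refine measure_mono fun ω hω h => hω fun μ' => (h μ').trans ?_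
    rw [Real.sqrt_mul (by positivity), Real.sqrt_mul (by linarith)]
    have hi1 : 1 ≤ √(iota (totalActions A) δ) := Real.one_le_sqrt.2 hι
    have hl : √(Real.log (totalActions A)) ≤ √(iota (totalActions A) δ) :=
      Real.sqrt_le_sqrt (log_le_iota hN hδ hδ1)
    have hl0 := Real.sqrt_nonneg (Real.log (totalActions A))
    have hn0 : 0 ≤ √(totalActions A : ℝ) := Real.sqrt_nonneg _
    have hH0 : (0 : ℝ) ≤ H := Nat.cast_nonneg _
    generalize √(iota (totalActions A) δ) = i at *
    generalize √(Real.log (totalActions A)) = l at *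
    generalize √(totalActions A : ℝ) = n at *
    generalize √(T : ℝ) = t at *
    generalize (H : ℝ) = k at *
    have e1 : k * l * i ≤ 5 * (i * n * t) := by
      calc k * l * i ≤ 5 * n * i := by gcongr
        _ ≤ 5 * n * i * t := le_mul_of_one_le_right (by positivity) hT1
        _ = _ := by ring
    have e2 : i * t * k ≤ i * n * t := by
      calc i * t * k ≤ i * t * n := by gcongr
        _ = _ := by ring
    have e3 : l * n * t ≤ i * n * t := by gcongr
    have e5 : 0 ≤ i * n * t := by positivity
    -- `2.42 · (3 + 2) + 5 + 3 · 0.7072 ≤ 20`.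
    linarith

end Game.Interaction

/-! ### From regret to approximate equilibrium. -/

section Final

/-- Uses subadditivity only, so the event need not be measurable. -/
theorem ofReal_one_sub_le_measure {Ω : Type v} [MeasurableSpace Ω] {P : Measure Ω}
    [IsProbabilityMeasure P] {p : Ω → Prop} {δ : ℝ} (hδ : 0 ≤ δ)
    (h : P {ω | ¬ p ω} ≤ ENNReal.ofReal δ) : ENNReal.ofReal (1 - δ) ≤ P {ω | p ω} := by
  rw [ENNReal.ofReal_sub _ hδ, ENNReal.ofReal_one, tsub_le_iff_right]
  have h1 : (Set.univ : Set Ω) = {ω | p ω} ∪ {ω | ¬ p ω} := by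
    ext ω; simp [em]
  rw [← measure_univ (μ := P), h1]
  exact (measure_union_le _ _).trans (by gcongr)

namespace Game

variable {S X Y : Type u} [Fintype S] {A : X → Type u} {B : Y → Type u} {H : ℕ}
  [∀ x, Fintype (A x)] [∀ y, Fintype (B y)]

theorem value_of_isAverageX [Fintype X] (G : Game S X Y A B H) {T : ℕ} (hT : 0 < T)
    {μ : ℕ → Policy A} {μbar : Policy A} (h : G.treeX.IsAverage T μ μbar) (ν : Policy B) :
    T * G.value μbar ν = ∑ t ∈ Finset.range T, G.value (μ t) ν := by
  have h1 : ∀ m : Policy A, G.value m ν = H - ∑ x, ∑ a, G.treeX.plan m x a * G.lossVec ν x a :=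
    fun m => by rw [sum_plan_mul_lossVec]; ring
  have hT' : (T : ℝ) ≠ 0 := by exact_mod_cast hT.ne'
  simp_rw [h1]
  rw [Finset.sum_sub_distrib, Finset.sum_const, Finset.card_range, nsmul_eq_mul, mul_sub]
  congr 1
  rw [Finset.sum_comm, Finset.mul_sum]
  refine Finset.sum_congr rfl fun x _ => ?_
  rw [Finset.sum_comm, Finset.mul_sum]
  refine Finset.sum_congr rfl fun a _ => ?_
  rw [h x a, ← Finset.sum_mul]
  field_simp

theorem value_of_isAverageY [Fintype Y] (G : Game S X Y A B H) {T : ℕ} (hT : 0 < T)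
    {ν : ℕ → Policy B} {νbar : Policy B} (h : G.treeY.IsAverage T ν νbar) (μ : Policy A) :
    T * G.value μ νbar = ∑ t ∈ Finset.range T, G.value μ (ν t) := by
  have h1 := G.swap.value_of_isAverageX hT h μ
  simp_rw [value_swap] at h1
  rw [Finset.sum_sub_distrib, Finset.sum_const, Finset.card_range, nsmul_eq_mul] at h1
  linarith

/-- The value is affine in each plan, so averaging turns sums of values over episodes into values
against the average policies; adding the two regrets, the terms `V^{μ^t,ν^t}` cancel. -/
theorem isOptimalProfile_of_regret_le [Fintype X] [Fintype Y] (G : Game S X Y A B H) {T : ℕ}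
    (hT : 0 < T) {μ : ℕ → Policy A} {ν : ℕ → Policy B} {μbar : Policy A} {νbar : Policy B}
    (hμ : G.treeX.IsAverage T μ μbar) (hν : G.treeY.IsAverage T ν νbar) {ε : ℝ}
    (hX : ∀ μ', ∑ t ∈ Finset.range T, (G.value μ' (ν t) - G.value (μ t) (ν t)) ≤ T * ε / 2)
    (hY : ∀ ν', ∑ t ∈ Finset.range T,
      (G.swap.value ν' (μ t) - G.swap.value (ν t) (μ t)) ≤ T * ε / 2) :
    G.IsOptimalProfile ε μbar νbar := by
  intro μ' ν'
  have h1 := hX μ'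
  have h2 := hY ν'
  simp_rw [value_swap] at h2
  have h3 := G.value_of_isAverageX hT hμ ν'
  have h4 := G.value_of_isAverageY hT hν μ'
  simp only [Finset.sum_sub_distrib] at h1 h2
  have hT' : (0 : ℝ) < T := by exact_mod_cast hT
  rw [← mul_le_mul_iff_right₀ hT']
  linarith

end Game

/-- The number of episodes suffices for the regret to be at most `T ε / 2`. -/
theorem regret_bound_le_of_episodes {N : ℕ} {K Z T δ ε : ℝ} (hN : 0 < N) (hNK : (N : ℝ) ≤ K)
    (hδ : 0 < δ) (hε : 0 < ε) (hT : 0 ≤ T) (hδZ : 1 / δ ≤ Z) (hZ : 3 ≤ Z) (hNZ : (N : ℝ) ≤ Z)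
    (h : 4800 * (K * Real.log Z / ε ^ 2) ≤ T) :
    20 * √(iota N δ * N * T) ≤ T * ε / 2 := by
  have hNr : (0 : ℝ) < N := by exact_mod_cast hN
  have h1 : iota N δ ≤ 3 * Real.log Z := by
    have : (3 : ℝ) * Real.log Z = Real.log (Z ^ 3) := by rw [Real.log_pow]; norm_num
    rw [iota, this]
    refine Real.log_le_log (by positivity) ?_
    calc 3 * (N : ℝ) / δ = 3 * N * (1 / δ) := by ring
      _ ≤ Z * Z * Z := by gcongr
      _ = Z ^ 3 := by ring
  have hlog : 0 ≤ Real.log Z := Real.log_nonneg (by linarith)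
  have h2 : 4800 * (K * Real.log Z) ≤ T * ε ^ 2 := by
    rw [← mul_div_assoc, div_le_iff₀ (by positivity)] at h
    exact h
  have h3 : iota N δ * N ≤ 3 * Real.log Z * K := by gcongr
  -- Since `3 N / δ ≤ Z³` gives `ι ≤ 3 log Z`, the requirement `ι N ≤ T ε² / 40²` explains `4800 = 3
  -- · 1600`.
  have h4 : √(iota N δ * N * T) ≤ T * ε / 40 := by
    refine Real.sqrt_le_iff.2 ⟨by positivity, ?_⟩
    have h5 : iota N δ * N ≤ T * ε ^ 2 / 1600 := by linarith
    calc iota N δ * N * T ≤ T * ε ^ 2 / 1600 * T := by gcongr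
      _ = (T * ε / 40) ^ 2 := by ring
  linarith

end Final

theorem theorem5 :
    -- regret of the max-player against an arbitrary adaptive opponent
    (∀ (S X Y : Type u) [Fintype S] [Fintype X] [Fintype Y] (A : X → Type u) (B : Y → Type u)
      [∀ x, Fintype (A x)] [∀ y, Fintype (B y)] (H : ℕ) (G : Game S X Y A B H)
      (a : ℕ) (_ : ∀ x, Fintype.card (A x) = a)
      (δ : ℝ) (_ : 0 < δ) (_ : δ < 1) (T : ℕ)
      (Ω : Type v) [MeasurableSpace Ω] (P : Measure Ω) [IsProbabilityMeasure P]
      (I : G.Interaction T P)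
      (_ : ∀ ω, G.treeX.IsBalancedFTRL
        (ixParam a (totalActions A) H T δ) (learningRate a (totalActions A) H T) T
        (fun t => I.μ t ω) (fun t => G.observedX (I.τ t ω))),
      ENNReal.ofReal (1 - δ) ≤
        P {ω | G.regretMax T (fun t => I.μ t ω) (fun t => I.ν t ω) ≤
          (5 * √(Real.log (totalActions A)) + 8 * iota (totalActions A) δ) *
            √((totalActions A : ℝ) * T)}) ∧
    -- sample complexity when both players use the algorithm
    (∃ C : ℝ, 0 < C ∧
      ∀ (S X Y : Type u) [Fintype S] [Fintype X] [Fintype Y] (A : X → Type u) (B : Y → Type u)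
      [∀ x, Fintype (A x)] [∀ y, Fintype (B y)] (H : ℕ) (G : Game S X Y A B H)
      (a b : ℕ) (_ : ∀ x, Fintype.card (A x) = a) (_ : ∀ y, Fintype.card (B y) = b)
      (ε : ℝ) (_ : 0 < ε) (δ : ℝ) (_ : 0 < δ) (_ : δ < 1) (T : ℕ)
      (_ : C * ((totalActions A + totalActions B : ℝ) *
        Real.log (1 / δ + totalActions A + totalActions B) / ε ^ 2) ≤ T)
      (Ω : Type v) [MeasurableSpace Ω] (P : Measure Ω) [IsProbabilityMeasure P]
      (I : G.Interaction T P)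
      (_ : ∀ ω, G.treeX.IsBalancedFTRL
        (ixParam a (totalActions A) H T δ) (learningRate a (totalActions A) H T) T
        (fun t => I.μ t ω) (fun t => G.observedX (I.τ t ω)))
      (_ : ∀ ω, G.treeY.IsBalancedFTRL
        (ixParam b (totalActions B) H T δ) (learningRate b (totalActions B) H T) T
        (fun t => I.ν t ω) (fun t => G.observedY (I.τ t ω))),
      ENNReal.ofReal (1 - δ) ≤
        P {ω |
          (∃ μbar, G.treeX.IsAverage T (fun t => I.μ t ω) μbar) ∧
          (∃ νbar, G.treeY.IsAverage T (fun t => I.ν t ω) νbar) ∧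
          ∀ μbar νbar, G.treeX.IsAverage T (fun t => I.μ t ω) μbar →
            G.treeY.IsAverage T (fun t => I.ν t ω) νbar →
            G.IsOptimalProfile ε μbar νbar}) := by
  refine ⟨?_, 4800, by norm_num, ?_⟩
  · intro S X Y _ _ _ A B _ _ H G a hA δ hδ hδ1 T Ω _ P _ I hμ
    obtain ⟨ω₀⟩ := P.nonempty_of_neZero
    have : Nonempty (Policy A) := ⟨I.μ 0 ω₀⟩
    refine (ofReal_one_sub_le_measure hδ.le
      (I.measure_regret_gt_confidence_le hA hδ hδ1 hμ)).trans (measure_mono fun ω hω => ?_)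
    exact ciSup_le hω
  · intro S X Y _ _ _ A B _ _ H G a b hA hB ε hε δ hδ hδ1 T hT Ω _ P _ I hμ hν
    obtain ⟨ω₀⟩ := P.nonempty_of_neZero
    have hX := G.nonempty_infoX
    have hY := G.swap.nonempty_infoX
    have hN : 0 < totalActions A := InfoTree.totalActions_pos (I.μ 0 ω₀).card_pos
    have hM : 0 < totalActions B := InfoTree.totalActions_pos (I.ν 0 ω₀).card_pos
    have hN1 : (1 : ℝ) ≤ totalActions A := by exact_mod_cast hN
    have hM1 : (1 : ℝ) ≤ totalActions B := by exact_mod_cast hM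
    have hδ' : 1 < 1 / δ := (one_lt_div hδ).2 hδ1
    -- The logarithm is positive because `1 / δ > 1`; averages over `T` episodes need `T ≠ 0`.
    have hT0 : 0 < T := by
      have hlog : 0 < Real.log (1 / δ + totalActions A + totalActions B) :=
        Real.log_pos (by linarith)
      exact_mod_cast (show (0 : ℝ) < 4800 * ((totalActions A + totalActions B : ℝ) *
        Real.log (1 / δ + totalActions A + totalActions B) / ε ^ 2) by positivity).trans_le hT
    have hobs : ∀ ω, (fun t => G.swap.observedX (I.swap.τ t ω)) =
        fun t => G.observedY (I.τ t ω) := fun ω => funext fun t => G.observedX_swap _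
    have h1 := I.measure_regret_gt_half_confidence_le hA hδ hδ1 hμ
    have h2 := I.swap.measure_regret_gt_half_confidence_le hB hδ hδ1
      (fun ω => by rw [hobs]; exact hν ω)
    have hXT := regret_bound_le_of_episodes (N := totalActions A) hN (by linarith) hδ hε
      (Nat.cast_nonneg T) (by linarith) (by linarith) (by linarith) hT
    have hYT := regret_bound_le_of_episodes (N := totalActions B) hM (by linarith) hδ hε
      (Nat.cast_nonneg T) (by linarith) (by linarith) (by linarith) hT
    refine ofReal_one_sub_le_measure hδ.le ?_
    rw [← add_halves δ, ENNReal.ofReal_add (by linarith) (by linarith)]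
    refine le_trans ?_ ((measure_union_le _ _).trans (add_le_add h1 h2))
    refine measure_mono fun ω hω => ?_
    by_contra hgood
    rw [Set.mem_union, not_or] at hgood
    refine hω ⟨G.treeX.exists_isAverage hT0 _, G.treeY.exists_isAverage hT0 _,
      fun μbar νbar hμbar hνbar => G.isOptimalProfile_of_regret_le hT0 hμbar hνbar ?_ ?_⟩
    · exact fun μ' => (not_not.1 hgood.1 μ').trans hXT
    · exact fun ν' => (not_not.1 hgood.2 ν').trans hYT
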